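/- Let $P$ be a finite-dimensional real Euclidean affine space with translation space $V$, and let $\mathbb W$ be a reflection group on $P$, i.e. a group of isometries of $P$ that is generated by orthogonal reflections in affine hyperplanes and acts properly discontinuously (for every compact $K\subset P$ only finitely many $g\in\mathbb W$ satisfy $gK\cap K\neq\emptyset$). Let $\mathfrak H$ be the set of affine hyperplanes $H$ whose reflection $s_H$ lies in $\mathbb W$. Assume that $\mathbb W$ is infinite, essential (no nonzero vector of $V$ is fixed by the linear parts of all elements of $\mathbb W$) and irreducible ($\mathfrak H\neq\emptyset$, and $\mathfrak H$ is not the union of two nonempty subsets such that every hyperplane in the first is orthogonal to every hyperplane in the second). Let $C$ be an alcove, i.e. a connected component of $P\setminus\bigcup_{H\in\mathfrak H}H$, and let $S$ be the set of its walls, i.e. of those $H\in\mathfrak H$ that are the affine span of $H\cap\overline C$. For $I\subseteq S$ let $\mathbb W_I\subseteq\mathbb W$ be the subgroup generated by the reflections $s_H$, $H\in I$. View the power set $P(S)$ as a category via inclusion of subsets. Then the functor $P(S)\to\mathrm{Top}$, $I\mapsto B\mathbb W_I$, whose maps are induced by the inclusions of subgroups, is a homotopy colimit diagram. That is, the canonical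 map $$\operatorname*{hocolim}_{I\subsetneq S} B\mathbb W_I\longrightarrow B\mathbb W_S$$ is a weak homotopy equivalence. Here $BG$ is the geometric realization of the nerve of $G$. -/

import Mathlib

open CategoryTheory MonoidalCategory Opposite

universe u v w

/-! ## Weak homotopy equivalences -/

section WeakEquivalence

open scoped Topology Topology.Homotopy unitInterval

variable {X : Type v} {Y : Type w} [TopologicalSpace X] [TopologicalSpace Y]

/-- The map induced by a continuous map on sets of path components. -/
def zerothHomotopyMap (f : C(X, Y)) : ZerothHomotopy X → ZerothHomotopy Y :=
  Quotient.map f fun _ _ h => h.map f.continuous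

/-- Post-composition of an `n`-dimensional loop at `x` with a continuous map `f`. -/
def genLoopMap (f : C(X, Y)) (n : ℕ) (x : X) (p : Ω^ (Fin n) X x) : Ω^ (Fin n) Y (f x) :=
  ⟨f.comp p.1, fun y hy => congrArg f (p.2 y hy)⟩

/-- The map `π_n(X, x) → π_n(Y, f x)` induced by a continuous map `f`. -/
def homotopyGroupMap (f : C(X, Y)) (n : ℕ) (x : X) : π_ n X x → π_ n Y (f x) :=
  Quotient.map (genLoopMap f n x) fun _ _ h => h.map fun H => H.compContinuousMap f

/-- A weak homotopy equivalence: a continuous map that is bijective on path components and on all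
homotopy groups, for all base points. -/
def IsWeakHomotopyEquiv (f : C(X, Y)) : Prop :=
  Function.Bijective (zerothHomotopyMap f) ∧
    ∀ (n : ℕ) (x : X), Function.Bijective (homotopyGroupMap f (n + 1) x)

end WeakEquivalence

/-! ## Homotopy colimits of spaces -/

noncomputable section HomotopyColimit

variable {J : Type u} [SmallCategory J]

/-- The bifunctor `(i, j) ↦ |N(i ↓ J)| × F j`, where `N(i ↓ J)` is the nerve of the category of
objects of `J` under `i`. -/
def hocolimIntegrand (F : J ⥤ TopCat.{u}) : Jᵒᵖ ⥤ J ⥤ TopCat.{u} :=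
  (Under.mapFunctor J ⋙ nerveFunctor ⋙ SSet.toTop) ⋙ curriedTensor TopCat.{u} ⋙
    (Functor.whiskeringLeft J TopCat.{u} TopCat.{u}).obj F

/-- The homotopy colimit of a diagram of spaces, by the Bousfield-Kan formula: the coend
`∫^j |N(j ↓ J)| × F j`. -/
def hocolim (F : J ⥤ TopCat.{u}) : TopCat.{u} :=
  Limits.coend (hocolimIntegrand F)

/-- The canonical map from the homotopy colimit of `F` to the vertex of a cocone under `F`. On
`|N(j ↓ J)| × F j` it is the projection to `F j` followed by the leg of the cocone at `j`. -/
def hocolimDesc {F : J ⥤ TopCat.{u}} (c : Limits.Cocone F) : hocolim F ⟶ c.pt :=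
  Limits.coend.desc
    (fun j => SemiCartesianMonoidalCategory.snd
      (SSet.toTop.obj (nerve (Under j))) (F.obj j) ≫ c.ι.app j)
    (fun i j g => by
      rw [← c.w g]
      rfl)

/-- A cocone of spaces is a homotopy colimit cocone if the canonical map from the homotopy colimit
to its vertex is a weak homotopy equivalence. -/
def IsHomotopyColimitCocone {F : J ⥤ TopCat.{u}} (c : Limits.Cocone F) : Prop :=
  IsWeakHomotopyEquiv (hocolimDesc c).hom

/-- The poset of proper subsets of `α`, i.e. the power set of `α` without its terminal object. -/
abbrev ProperSubset (α : Type u) : Type u := {I : Set α // I ≠ Set.univ}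

/-- The inclusion of the poset of proper subsets into the power set. -/
def ProperSubset.incl (α : Type u) : ProperSubset α ⥤ Set α :=
  (Subtype.mono_coe fun I : Set α => I ≠ Set.univ).functor

/-- A functor `D` on the power set of `α`, seen as a cocone with vertex `D α` under its restriction
to the proper subsets. -/
def powerSetCocone {α : Type u} (D : Set α ⥤ TopCat.{u}) :
    Limits.Cocone (ProperSubset.incl α ⋙ D) where
  pt := D.obj Set.univ
  ι :=
    { app := fun I => D.map (homOfLE (Set.subset_univ I.1))
      naturality := fun I I' f => by
        simp only [Functor.comp_map, ← D.map_comp, Functor.const_obj_map]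
        rfl }

/-- A functor on the power set of `α` (a cube of spaces) is a homotopy colimit diagram if it
exhibits its value at the terminal object `α` as the homotopy colimit of its restriction to the
proper subsets. -/
def IsHomotopyColimitDiagram {α : Type u} (D : Set α ⥤ TopCat.{u}) : Prop :=
  IsHomotopyColimitCocone (powerSetCocone D)

/-- The classifying space functor `G ↦ BG`: the geometric realization of the nerve of `G`, where
`G` is seen as a category with one object. -/
def classifyingSpace : GrpCat.{u} ⥤ TopCat.{u} :=
  forget₂ GrpCat.{u} MonCat.{u} ⋙ MonCat.toCat ⋙ nerveFunctor ⋙ SSet.toTop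

end HomotopyColimit

/-! ## Reflection groups in a Euclidean affine space -/

noncomputable section ReflectionGroup

variable {V P : Type u} [NormedAddCommGroup V] [InnerProductSpace ℝ V] [FiniteDimensional ℝ V]
  [MetricSpace P] [NormedAddTorsor V P]

variable (V P) in
/-- Affine hyperplanes of `P`: nonempty affine subspaces whose normal space is a line. -/
structure AffineHyperplane where
  /-- The hyperplane as an affine subspace. -/
  space : AffineSubspace ℝ P
  nonempty : Nonempty space
  finrank_normal : Module.finrank ℝ (space.directionᗮ : Submodule ℝ V) = 1

/-- The orthogonal reflection in an affine hyperplane. -/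
def AffineHyperplane.reflection (H : AffineHyperplane V P) : P ≃ᵃⁱ[ℝ] P :=
  haveI := H.nonempty
  EuclideanGeometry.reflection H.space

/-- A reflection group: a group of isometries of a Euclidean affine space that is generated by
orthogonal reflections in affine hyperplanes and acts properly discontinuously. -/
structure IsReflectionGroup (W : Subgroup (P ≃ᵃⁱ[ℝ] P)) : Prop where
  closure_reflections :
    Subgroup.closure {g | g ∈ W ∧ ∃ H : AffineHyperplane V P, g = H.reflection} = W
  properlyDiscontinuous :
    ∀ K : Set P, IsCompact K → {g : P ≃ᵃⁱ[ℝ] P | g ∈ W ∧ (g '' K ∩ K).Nonempty}.Finite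

/-- The reflecting hyperplanes of `W`. -/
def reflectingHyperplanes (W : Subgroup (P ≃ᵃⁱ[ℝ] P)) : Set (AffineHyperplane V P) :=
  {H | H.reflection ∈ W}

/-- `W` is essential: the linear parts of its elements have no common nonzero fixed vector. -/
def IsEssential (W : Subgroup (P ≃ᵃⁱ[ℝ] P)) : Prop :=
  ∀ x : V, (∀ g ∈ W, g.linearIsometryEquiv x = x) → x = 0

/-- `W` is irreducible: it is nontrivial, and its reflecting hyperplanes cannot be divided into
two nonempty classes such that each hyperplane of the first class is orthogonal to each
hyperplane of the second (equivalently, the Coxeter graph of `W` is nonempty and connected). -/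
def IsIrreducibleReflectionGroup (W : Subgroup (P ≃ᵃⁱ[ℝ] P)) : Prop :=
  (reflectingHyperplanes W).Nonempty ∧
    ∀ A B : Set (AffineHyperplane V P), A ∪ B = reflectingHyperplanes W →
      (∀ H ∈ A, ∀ H' ∈ B, H.space.directionᗮ ⟂ H'.space.directionᗮ) → A = ∅ ∨ B = ∅

/-- The complement of the union of the reflecting hyperplanes of `W`. -/
def hyperplaneComplement (W : Subgroup (P ≃ᵃⁱ[ℝ] P)) : Set P :=
  {x | ∀ H ∈ reflectingHyperplanes W, x ∉ H.space}

/-- Alcoves (chambers) of `W`: the connected components of the complement of the union of the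
reflecting hyperplanes. -/
def IsAlcove (W : Subgroup (P ≃ᵃⁱ[ℝ] P)) (C : Set P) : Prop :=
  ∃ x ∈ hyperplaneComplement W, C = connectedComponentIn (hyperplaneComplement W) x

/-- The walls of an alcove `C`: the reflecting hyperplanes `H` that are spanned by `H ∩ C̄`, i.e.
that support a codimension one face of `C`. -/
def alcoveWalls (W : Subgroup (P ≃ᵃⁱ[ℝ] P)) (C : Set P) : Set (AffineHyperplane V P) :=
  {H | H ∈ reflectingHyperplanes W ∧ affineSpan ℝ ((H.space : Set P) ∩ closure C) = H.space}

/-- The group `W_I` generated by the reflections in the hyperplanes of `I`. -/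
def reflectionSubgroup (I : Set (AffineHyperplane V P)) : Subgroup (P ≃ᵃⁱ[ℝ] P) :=
  Subgroup.closure (AffineHyperplane.reflection '' I)

/-- If `I` consists of reflecting hyperplanes of `W`, then `W_I` is a subgroup of `W`. -/
theorem reflectionSubgroup_le {W : Subgroup (P ≃ᵃⁱ[ℝ] P)} {I : Set (AffineHyperplane V P)}
    (hI : I ⊆ reflectingHyperplanes W) : reflectionSubgroup I ≤ W :=
  (Subgroup.closure_le W).2 (Set.image_subset_iff.2 hI)

/-- The functor `I ↦ W_I` from the power set of `S`, ordered by inclusion, to groups. An inclusion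
of subsets goes to the inclusion of subgroups. -/
def reflectionSubgroupFunctor (S : Set (AffineHyperplane V P)) : Set S ⥤ GrpCat.{u} where
  obj I := GrpCat.of (reflectionSubgroup (Subtype.val '' I))
  map f := GrpCat.ofHom (Subgroup.inclusion
    (Subgroup.closure_mono (Set.image_mono (Set.image_mono (leOfHom f)))))

end ReflectionGroup

/-! Write `S` for the walls, `D(w)` for the set of walls separating the base chamber from its image
under `w`, that is, the left descents of `w`. The Bousfield-Kan coend is the realization of a
simplicial set: a simplex is a chain of proper subsets `c_0 ⊆ … ⊆ c_n` with a simplex of `BW` whose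
entries lie in `W_{c_0}`. Allowing the later members of the chain to be all of `S`, with no
condition on the entries that reach them, gives a cylinder, `cosetComplex`. It deforms onto the end
`BW` without moving the projection to `BW`, so it remains to compare it with its proper part.

That inclusion is anodyne, by a perfect acyclic matching of the simplices outside the proper part
(`DescentSystem.pairingCore`). Such a simplex is a sequence of pairs `(c, v)` with `v` in `W`, up to
right translation; normalize the first pair with `c = S` to have `v = 1`. The proper pairs then have
all their `v` in one coset of `W_{c_0}`; let `m` be its shortest element. The partner is obtained by
inserting or deleting one pair with second entry `m`: just before the first pair with `v ≠ m`, with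
the same subset, or, if all `v` are `m`, at the place where the chain leaves `D(m)`, with the subset
cut down to `D(m)`. This could only fail by creating a pair that is not proper, for `D(m) = S`. But
then `m` would be a longest element, and a group with finitely many generators and bounded word
length is finite. Faces other than the distinguished one have smaller rank, so all simplices are
attached along horns.

The Coxeter combinatorics comes from the sets `N(w)` of reflections in the hyperplanes separating a
point `x` of the alcove from `w x`. They satisfy a cocycle rule, which gives the strong exchange
property, generation by the walls and the theory of minimal coset representatives. The walls are
finite in number because their inward unit normals are pairwise at obtuse or right angles.

On the topological side, singular complexes are Kan, so realizations of anodyne inclusions are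
strong deformation retracts. Realization commutes with products with a finite nerve, which
identifies the coend. Weak equivalences are detected by a relative lifting property for cubes, which
is stable under composition. -/

/-! ### Relative cube lifting and weak homotopy equivalences -/

section RelativeLifting

open scoped Topology Topology.Homotopy unitInterval

variable {X : Type u} {Y : Type v} {Z : Type w} [TopologicalSpace X] [TopologicalSpace Y]
  [TopologicalSpace Z]

/-- A map has relative cube lifting if every map of a cube to the target, lifted on the boundary,
can be lifted up to a homotopy relative to the boundary. -/
def HasRelCubeLift (f : C(X, Y)) : Prop :=
  ∀ (n : ℕ) (u : C(Cube.boundary (Fin n), X)) (v : C(Fin n → I, Y)), (∀ y, f (u y) = v y) →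
    ∃ w : C(Fin n → I, X), (∀ y : Cube.boundary (Fin n), w y = u y) ∧
      (f.comp w).HomotopicRel v (Cube.boundary (Fin n))

theorem Cube.isClosed_boundary (n : ℕ) : IsClosed (Cube.boundary (Fin n)) := by
  have : Cube.boundary (Fin n) = ⋃ i : Fin n, {y | y i = 0} ∪ {y | y i = 1} := by
    ext y; simp [Cube.boundary]
  rw [this]
  refine isClosed_iUnion_of_finite fun i => ?_
  exact (isClosed_eq (continuous_apply i) continuous_const).union
    (isClosed_eq (continuous_apply i) continuous_const)

/-- The homotopy is a map of a cube of one dimension more. On the boundary it is lifted by `p` at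
the bottom, by `q` at the top and by their common values on the sides, so a lift of the whole cube
is the required homotopy. -/
theorem HasRelCubeLift.homotopicRel {f : C(X, Y)} (hf : HasRelCubeLift f) {n : ℕ}
    {p q : C(Fin n → I, X)} (hpq : ∀ y ∈ Cube.boundary (Fin n), p y = q y)
    (h : (f.comp p).HomotopicRel (f.comp q) (Cube.boundary (Fin n))) :
    p.HomotopicRel q (Cube.boundary (Fin n)) := by
  obtain ⟨H⟩ := h
  have htail : Continuous fun z : Fin (n + 1) → I => (Fin.tail z : Fin n → I) :=
    continuous_pi fun i => continuous_apply _
  let v : C(Fin (n + 1) → I, Y) :=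
    ⟨fun z => H (z 0, Fin.tail z), H.continuous.comp ((continuous_apply 0).prodMk htail)⟩
  classical
  -- Only continuous on the boundary, where `p` and `q` agree on the sides adjacent to the top.
  let u' : (Fin (n + 1) → I) → X := fun z => if z 0 = 1 then q (Fin.tail z) else p (Fin.tail z)
  have hmem : ∀ z ∈ Cube.boundary (Fin (n + 1)),
      z 0 = 1 ∨ z 0 = 0 ∨ Fin.tail z ∈ Cube.boundary (Fin n) := by
    rintro z ⟨i, hi⟩
    refine Fin.cases (fun hi => ?_) (fun j hj => ?_) i hi
    · tauto
    · exact Or.inr (Or.inr ⟨j, hj⟩)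
  have hu' : ContinuousOn u' (Cube.boundary (Fin (n + 1))) := by
    have h1 : ContinuousOn u' {z | z 0 = 1} :=
      (q.continuous.comp htail).continuousOn.congr fun z hz => if_pos hz
    have h2 : ContinuousOn u' ({z | z 0 = 0} ∪ {z | Fin.tail z ∈ Cube.boundary (Fin n)}) := by
      refine (p.continuous.comp htail).continuousOn.congr fun z hz => ?_
      by_cases h : z 0 = 1
      · rcases hz with hz | hz
        · exact absurd (hz.symm.trans h) zero_ne_one
        · simp only [u', if_pos h, Function.comp]
          exact (hpq _ hz).symm
      · exact if_neg h
    refine (h1.union_of_isClosed h2 (isClosed_eq (continuous_apply 0) continuous_const) ?_).mono ?_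
    · exact (isClosed_eq (continuous_apply 0) continuous_const).union
        ((Cube.isClosed_boundary n).preimage htail)
    · intro z hz
      rcases hmem z hz with h | h | h
      · exact Or.inl h
      · exact Or.inr (Or.inl h)
      · exact Or.inr (Or.inr h)
  let u : C(Cube.boundary (Fin (n + 1)), X) := ⟨_, continuousOn_iff_continuous_domRestrict.1 hu'⟩
  obtain ⟨w, hw, -⟩ := hf (n + 1) u v (by
    rintro ⟨z, hz⟩
    change f (u' z) = H (z 0, Fin.tail z)
    by_cases h : z 0 = 1
    · simp [u', h]
    · rcases hmem z hz with h' | h' | h'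
      · exact absurd h' h
      · simp [u', h']
      · simp only [u', if_neg h]
        exact (H.eq_fst _ h').symm)
  have hw' : ∀ (t : I) (y : Fin n → I), Fin.cons t y ∈ Cube.boundary (Fin (n + 1)) →
      w (Fin.cons t y) = if t = 1 then q y else p y := by
    intro t y hy
    have := hw ⟨_, hy⟩
    simpa [u, u'] using this
  have hb : ∀ (t : I) (y : Fin n → I), (t = 0 ∨ t = 1) ∨ y ∈ Cube.boundary (Fin n) →
      (Fin.cons t y : Fin (n + 1) → I) ∈ Cube.boundary (Fin (n + 1)) := by
    rintro t y (h | ⟨i, h⟩)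
    · exact ⟨0, by simpa using h⟩
    · exact ⟨i.succ, by simpa using h⟩
  refine ⟨⟨⟨⟨fun x => w (Fin.cons x.1 x.2), w.continuous.comp ?_⟩, ?_, ?_⟩, ?_⟩⟩
  · refine continuous_pi fun i => ?_
    refine Fin.cases ?_ (fun j => ?_) i
    · exact continuous_fst
    · exact (continuous_apply j).comp continuous_snd
  · intro y
    simp only
    rw [hw' _ _ (hb _ _ (by simp))]
    simp
  · intro y
    simp only
    rw [hw' _ _ (hb _ _ (by simp))]
    simp
  · intro t y hy
    simp only
    change w (Fin.cons t y) = p y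
    rw [hw' _ _ (hb _ _ (Or.inr hy)), ← hpq y hy]
    simp

theorem boundary_fin_zero : Cube.boundary (Fin 0) = ∅ := by
  ext y; simp [Cube.boundary]

theorem joined_of_homotopic_const {x y : X}
    (h : (ContinuousMap.const (Fin 0 → I) x).Homotopic (ContinuousMap.const (Fin 0 → I) y)) :
    Joined x y := by
  obtain ⟨H⟩ := h
  exact ⟨⟨⟨fun t => H (t, 0), by fun_prop⟩, by simp, by simp⟩⟩

/-- Surjectivity lifts a loop from the constant lift of its boundary, and injectivity is uniqueness
of lifts up to homotopy. Cubes of dimension `0`, whose boundary is empty, take care of path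
components. -/
theorem HasRelCubeLift.isWeakHomotopyEquiv {f : C(X, Y)} (hf : HasRelCubeLift f) :
    IsWeakHomotopyEquiv f := by
  refine ⟨⟨?_, ?_⟩, fun n x => ⟨?_, ?_⟩⟩
  · rintro ⟨x⟩ ⟨x'⟩ h
    refine Quotient.sound ?_
    obtain ⟨γ⟩ : Joined (f x) (f x') := Quotient.exact h
    apply joined_of_homotopic_const
    have := hf.homotopicRel (n := 0) (p := .const _ x) (q := .const _ x')
      (by simp [boundary_fin_zero]) (by
        rw [boundary_fin_zero, ContinuousMap.homotopicRel_empty]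
        exact ⟨⟨⟨fun z => γ z.1, by fun_prop⟩, by simp, by simp⟩⟩)
    rwa [boundary_fin_zero, ContinuousMap.homotopicRel_empty] at this
  · rintro ⟨y⟩
    have : IsEmpty (Cube.boundary (Fin 0)) := by rw [boundary_fin_zero]; infer_instance
    obtain ⟨w, -, hw⟩ := hf 0 ⟨isEmptyElim, by fun_prop⟩ (.const _ y) isEmptyElim
    refine ⟨Quotient.mk _ (w 0), Quotient.sound ?_⟩
    apply joined_of_homotopic_const
    rw [boundary_fin_zero, ContinuousMap.homotopicRel_empty] at hw
    convert hw
    ext z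
    simp [Subsingleton.elim z 0]
  · rintro ⟨p⟩ ⟨q⟩ h
    refine Quotient.sound ?_
    have h' : (genLoopMap f (n + 1) x p).1.HomotopicRel (genLoopMap f (n + 1) x q).1 _ :=
      Quotient.exact h
    exact hf.homotopicRel (fun y hy => (p.2 y hy).trans (q.2 y hy).symm) h'
  · rintro ⟨p⟩
    obtain ⟨w, hw, h⟩ := hf (n + 1) (.const _ x) p.1 (fun y => (p.2 y y.2).symm)
    exact ⟨Quotient.mk _ ⟨w, fun y hy => hw ⟨y, hy⟩⟩, Quotient.sound h⟩

theorem HasRelCubeLift.comp {g : C(Y, Z)} {f : C(X, Y)} (hg : HasRelCubeLift g)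
    (hf : HasRelCubeLift f) : HasRelCubeLift (g.comp f) := by
  intro n u v h
  obtain ⟨w', hw', h'⟩ := hg n (f.comp u) v h
  obtain ⟨w, hw, h''⟩ := hf n u w' fun y => (hw' y).symm
  exact ⟨w, hw, (h''.comp_continuousMap g).trans h'⟩

theorem HasRelCubeLift.of_homeomorph (e : X ≃ₜ Y) : HasRelCubeLift (e : C(X, Y)) := by
  intro n u v h
  refine ⟨(e.symm : C(Y, X)).comp v, fun y => ?_, ?_⟩
  · simpa using congrArg e.symm (h y).symm
  · convert! ContinuousMap.HomotopicRel.refl v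
    ext; simp

/-- The inclusion of a strong deformation retract has relative cube lifting. -/
theorem HasRelCubeLift.of_deformationRetract (i : C(X, Y)) (r : C(Y, X))
    (hri : ∀ x, r (i x) = x) (H : (ContinuousMap.id Y).HomotopicRel (i.comp r) (Set.range i)) :
    HasRelCubeLift i := by
  intro n u v h
  refine ⟨r.comp v, fun y => ?_, ?_⟩
  · simp [← h, hri]
  · obtain ⟨H⟩ := H.symm
    refine ⟨⟨⟨⟨fun z => H (z.1, v z.2), by fun_prop⟩, by simp, by simp⟩, fun t y hy => ?_⟩⟩
    have : v y ∈ Set.range i := ⟨u ⟨y, hy⟩, h _⟩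
    simpa using H.eq_fst t this

/-! ### A collar of the boundary of the cube -/

section Collar

variable {n : ℕ}

/-- The distance of a point of the cube to its centre, normalized to be `1` on the boundary. -/
noncomputable def cubeRadius (x : Fin n → I) : ℝ := ‖fun i => 2 * (x i : ℝ) - 1‖

theorem continuous_cubeRadius : Continuous (cubeRadius (n := n)) := by
  unfold cubeRadius; fun_prop

theorem abs_le_cubeRadius (x : Fin n → I) (i : Fin n) : |2 * (x i : ℝ) - 1| ≤ cubeRadius x :=
  norm_le_pi_norm (fun i => 2 * (x i : ℝ) - 1) i

theorem cubeRadius_le_one (x : Fin n → I) : cubeRadius x ≤ 1 := by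
  refine (pi_norm_le_iff_of_nonneg zero_le_one).2 fun i => ?_
  have := (x i).2
  rw [Real.norm_eq_abs, abs_le]
  constructor <;> linarith [this.1, this.2]

theorem cubeRadius_eq_one {x : Fin n → I} (hx : x ∈ Cube.boundary (Fin n)) : cubeRadius x = 1 := by
  obtain ⟨i, hi⟩ := hx
  refine le_antisymm (cubeRadius_le_one x) ?_
  refine le_trans ?_ (abs_le_cubeRadius x i)
  rcases hi with hi | hi <;> norm_num [hi]

theorem mem_boundary_of_cubeRadius {x : Fin n → I} (hx : 1 ≤ cubeRadius x) :
    x ∈ Cube.boundary (Fin n) := by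
  by_contra h
  refine absurd hx (not_le.2 ((pi_norm_lt_iff zero_lt_one).2 fun i => ?_))
  have h0 : x i ≠ 0 := fun h' => h ⟨i, Or.inl h'⟩
  have h1 : x i ≠ 1 := fun h' => h ⟨i, Or.inr h'⟩
  have h0' : (0 : ℝ) < x i := unitInterval.pos_iff_ne_zero.2 h0
  have h1' : (x i : ℝ) < 1 := unitInterval.lt_one_iff_ne_one.2 h1
  rw [Real.norm_eq_abs, abs_lt]
  constructor <;> linarith

/-- The radial map of the cube that expands the cube of half size to the whole cube and is
constant in radial direction outside of it. -/
noncomputable def radialExpand (x : Fin n → I) : Fin n → I := fun i =>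
  ⟨((2 * (x i : ℝ) - 1) / max (cubeRadius x) (1 / 2) + 1) / 2, by
    have h0 : 0 < max (cubeRadius x) (1 / 2) := by positivity
    have : |(2 * (x i : ℝ) - 1) / max (cubeRadius x) (1 / 2)| ≤ 1 := by
      rw [abs_div, abs_of_pos h0, div_le_one h0]
      exact (abs_le_cubeRadius x i).trans (le_max_left _ _)
    rw [abs_le] at this
    constructor <;> linarith [this.1, this.2]⟩

theorem continuous_radialExpand : Continuous (radialExpand (n := n)) := by
  refine continuous_pi fun i => Continuous.subtype_mk ?_ _
  have h0 : ∀ x : Fin n → I, max (cubeRadius x) (1 / 2) ≠ 0 := fun x => by positivity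
  have := continuous_cubeRadius (n := n)
  fun_prop (disch := exact h0 _)

theorem cubeRadius_radialExpand (x : Fin n → I) :
    cubeRadius (radialExpand x) = cubeRadius x / max (cubeRadius x) (1 / 2) := by
  have h0 : 0 < max (cubeRadius x) (1 / 2) := by positivity
  have : (fun i => 2 * (radialExpand x i : ℝ) - 1) =
      (max (cubeRadius x) (1 / 2))⁻¹ • fun i => 2 * (x i : ℝ) - 1 := by
    ext i
    simp only [radialExpand, Pi.smul_apply, smul_eq_mul]
    ring
  rw [cubeRadius, this, norm_smul, norm_inv, Real.norm_eq_abs, abs_of_pos h0]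
  exact inv_mul_eq_div _ _

theorem radialExpand_mem_boundary {x : Fin n → I} (hx : 1 / 2 ≤ cubeRadius x) :
    radialExpand x ∈ Cube.boundary (Fin n) := by
  apply mem_boundary_of_cubeRadius
  rw [cubeRadius_radialExpand, max_eq_left hx, div_self (by linarith)]

theorem radialExpand_of_mem_boundary {x : Fin n → I} (hx : x ∈ Cube.boundary (Fin n)) :
    radialExpand x = x := by
  funext i
  apply Subtype.ext
  simp [radialExpand, cubeRadius_eq_one hx]
  norm_num

/-- The radial coordinate of the collar, going from `1` on the inner cube to `0` on the boundary. -/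
noncomputable def collarTime (x : Fin n → I) : I :=
  Set.projIcc 0 1 zero_le_one (2 - 2 * cubeRadius x)

theorem continuous_collarTime : Continuous (collarTime (n := n)) := by
  have := continuous_cubeRadius (n := n)
  unfold collarTime
  fun_prop

end Collar

/-- A retraction with a fibrewise deformation to a section has relative cube lifting. -/
theorem HasRelCubeLift.of_fibrewise_retraction (r : C(X, Y)) (s : C(Y, X))
    (H : C(I × X, X)) (hrs : ∀ y, r (s y) = y) (H0 : ∀ x, H (0, x) = x)
    (H1 : ∀ x, H (1, x) = s (r x)) (hrH : ∀ t x, r (H (t, x)) = r x) :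
    HasRelCubeLift r := by
  intro n u v h
  classical
  have hc := continuous_radialExpand (n := n)
  have hρ := continuous_cubeRadius (n := n)
  have hτ := continuous_collarTime (n := n)
  -- The inner cube carries `s ∘ v`, rescaled. In the collar the homotopy runs from the given lift,
  -- at time `0` on the boundary, to `s ∘ r` of it, at time `1` on the inner cube, where the two
  -- definitions agree. Since the homotopy is fibrewise, the result lifts `v ∘ radialExpand`
  -- exactly.
  let w' : (Fin n → I) → X := fun x =>
    if hx : 1 / 2 ≤ cubeRadius x then
      H (collarTime x, u ⟨radialExpand x, radialExpand_mem_boundary hx⟩)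
    else s (v (radialExpand x))
  have hrw : ∀ x, r (w' x) = v (radialExpand x) := by
    intro x
    by_cases hx : 1 / 2 ≤ cubeRadius x
    · simp only [w', dif_pos hx, hrH]
      exact h _
    · simp only [w', dif_neg hx, hrs]
  have hw' : Continuous w' := by
    rw [← continuousOn_univ]
    have h1 : ContinuousOn w' {x | 1 / 2 ≤ cubeRadius x} := by
      rw [continuousOn_iff_continuous_domRestrict]
      have : Set.domRestrict {x | 1 / 2 ≤ cubeRadius x} w' = fun x =>
          H (collarTime x.1, u ⟨radialExpand x.1, radialExpand_mem_boundary x.2⟩) := by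
        funext x
        exact dif_pos x.2
      rw [this]
      fun_prop
    have h2 : ContinuousOn w' {x | cubeRadius x ≤ 1 / 2} := by
      have : Continuous fun x => s (v (radialExpand (n := n) x)) := by fun_prop
      refine this.continuousOn.congr fun x hx => ?_
      by_cases hx' : 1 / 2 ≤ cubeRadius x
      · have hx'' : cubeRadius x = 1 / 2 := le_antisymm hx hx'
        simp only [w', dif_pos hx']
        have : collarTime x = 1 := by
          rw [collarTime, hx'']; norm_num
        rw [this, H1, h]
      · exact dif_neg hx'
    refine (h1.union_of_isClosed h2 (isClosed_le continuous_const hρ)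
      (isClosed_le hρ continuous_const)).mono fun x _ => ?_
    exact le_total (1 / 2) (cubeRadius x)
  refine ⟨⟨w', hw'⟩, fun ⟨y, hy⟩ => ?_, ?_⟩
  · have h1 := cubeRadius_eq_one hy
    have h2 : 1 / 2 ≤ cubeRadius y := by rw [h1]; norm_num
    simp only [ContinuousMap.coe_mk, w', dif_pos h2]
    have : collarTime y = 0 := by
      rw [collarTime, h1]; norm_num
    rw [this, H0]
    congr
    exact radialExpand_of_mem_boundary hy
  -- The straight-line homotopy from `radialExpand` to the identity. It is constant on the boundary,
  -- which `radialExpand` fixes.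
  · let K : C(I × (Fin n → I), Fin n → I) :=
      ⟨fun z i => ⟨(1 - z.1) * (radialExpand z.2 i : ℝ) + z.1 * (z.2 i : ℝ), by
        have h1 := z.1.2
        have h2 := (radialExpand z.2 i).2
        have h3 := (z.2 i).2
        constructor
        · have := mul_nonneg (sub_nonneg.2 h1.2) h2.1
          have := mul_nonneg h1.1 h3.1
          linarith
        · have := mul_le_mul_of_nonneg_left h2.2 (sub_nonneg.2 h1.2)
          have := mul_le_mul_of_nonneg_left h3.2 h1.1
          linarith⟩, by
        refine continuous_pi fun i => Continuous.subtype_mk ?_ _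
        have : Continuous fun x : I × (Fin n → I) => (radialExpand x.2 i : ℝ) :=
          continuous_subtype_val.comp ((continuous_apply i).comp (hc.comp continuous_snd))
        exact ((continuous_const.sub (by fun_prop)).mul this).add (by fun_prop)⟩
    refine ⟨⟨⟨v.comp K, fun x => ?_, fun x => ?_⟩, fun t x hx => ?_⟩⟩
    · simp only [ContinuousMap.toFun_eq_coe, ContinuousMap.comp_apply, ContinuousMap.coe_mk, hrw]
      congr 1
      funext i
      apply Subtype.ext
      simp [K]
    · simp only [ContinuousMap.toFun_eq_coe, ContinuousMap.comp_apply]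
      congr 1
      funext i
      apply Subtype.ext
      simp [K]
    · simp only [ContinuousMap.comp_apply, ContinuousMap.coe_mk, hrw]
      change v (K (t, x)) = _
      rw [radialExpand_of_mem_boundary hx]
      congr 1
      funext i
      apply Subtype.ext
      simp only [K, ContinuousMap.coe_mk]
      rw [radialExpand_of_mem_boundary hx]
      ring

end RelativeLifting

/-! ### Points of the geometric realization and barycentric coordinates -/

noncomputable section Realization

open Simplicial

namespace SSet

/-- Points of the standard topological simplex. -/
abbrev SimplexPt (n : SimplexCategory) : Type := _root_.stdSimplex ℝ (Fin (n.len + 1))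

/-- The point of the geometric realization of `X` with coordinates `t` in the simplex `σ`. -/
def realPoint {X : SSet.{u}} {n : SimplexCategory} (σ : X.obj (op n))
    (t : SimplexPt n) : SSet.toTop.obj X :=
  SSet.toTop.map (yonedaEquiv.symm σ) (n.toTopHomeo.symm t)

theorem continuous_realPoint {X : SSet.{u}} {n : SimplexCategory} (σ : X.obj (op n)) :
    Continuous (realPoint σ) :=
  (SSet.toTop.map (yonedaEquiv.symm σ)).hom.continuous.comp n.toTopHomeo.symm.continuous

theorem toTop_map_realPoint {X Y : SSet.{u}} (f : X ⟶ Y) {n : SimplexCategory} (σ : X.obj (op n))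
    (t : SimplexPt n) :
    SSet.toTop.map f (realPoint σ t) = realPoint (f.app _ σ) t := by
  unfold realPoint
  rw [← yonedaEquiv_symm_comp, Functor.map_comp]
  rfl

theorem realPoint_map {X : SSet.{u}} {n m : SimplexCategory} (φ : n ⟶ m) (σ : X.obj (op m))
    (t : SimplexPt n) :
    realPoint (X.map φ.op σ) t = realPoint σ (_root_.stdSimplex.map φ t) := by
  unfold realPoint
  rw [SimplexCategory.toTopHomeo_symm_naturality_apply]
  rw [← yonedaEquiv_symm_naturality_left, Functor.map_comp]
  rfl

theorem homEquiv_apply {X : SSet.{u}} {Z : TopCat.{u}} (f : SSet.toTop.obj X ⟶ Z)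
    {n : SimplexCategory} (σ : X.obj (op n)) (t : SimplexPt n) :
    Z.toSSetObjEquiv _ ((sSetTopAdj.homEquiv _ _ f).app _ σ) t = f (realPoint σ t) := by
  rw [Adjunction.homEquiv_unit]
  have := sSetTopAdj_unit_app_app_down X (op n) σ
  change f (ConcreteCategory.hom (show SimplexCategory.toTop.obj n ⟶ SSet.toTop.obj X from
    (((sSetTopAdj.unit.app X).app (op n)) σ).down) (ULift.up t)) = _
  rw [this]
  rfl

theorem toTop_hom_ext {X : SSet.{u}} {Z : TopCat.{u}} {f g : SSet.toTop.obj X ⟶ Z}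
    (h : ∀ (n : SimplexCategory) (σ : X.obj (op n)) (t : SimplexPt n),
      f (realPoint σ t) = g (realPoint σ t)) : f = g := by
  apply (sSetTopAdj.homEquiv _ _).injective
  ext n σ
  apply (Z.toSSetObjEquiv n).injective
  ext t
  exact (homEquiv_apply f σ t).trans ((h _ _ _).trans (homEquiv_apply g σ t).symm)

/-- The type of propositions (lifted to a universe) with the indiscrete topology. -/
def IndiscreteProp : Type u := ULift Prop

instance : TopologicalSpace IndiscreteProp.{u} := ⊤

/-- Every predicate is a continuous map to the indiscrete space of propositions. The predicate of
being such a point and the true one agree on all simplices, hence are equal as maps out of the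
realization. -/
theorem exists_realPoint {X : SSet.{u}} (x : SSet.toTop.obj X) :
    ∃ (n : ℕ) (σ : X _⦋n⦌) (t : SimplexPt ⦋n⦌), realPoint σ t = x := by
  let Z : TopCat.{u} := TopCat.of IndiscreteProp
  let f : SSet.toTop.obj X ⟶ Z := TopCat.ofHom (@ContinuousMap.mk _ IndiscreteProp _ _
    (fun x => ULift.up (∃ (n : ℕ) (σ : X _⦋n⦌) (t : SimplexPt ⦋n⦌), realPoint σ t = x))
    continuous_top)
  let g : SSet.toTop.obj X ⟶ Z := TopCat.ofHom (@ContinuousMap.mk _ IndiscreteProp _ _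
    (fun x => ULift.up True) continuous_top)
  have : f = g := toTop_hom_ext fun n σ t => congrArg ULift.up (eq_true ⟨n.len, σ, t, rfl⟩)
  have h := congrArg (fun k : SSet.toTop.obj X ⟶ Z => ULift.down (show ULift Prop from k x)) this
  exact of_eq_true h

/-- A map out of the geometric realization is given by a compatible family of maps on simplices. -/
def realLift {X : SSet.{u}} {Z : TopCat.{u}}
    (F : ∀ n : SimplexCategory, X.obj (op n) → C(SimplexPt n, Z))
    (hF : ∀ ⦃n m : SimplexCategory⦄ (φ : n ⟶ m) (σ : X.obj (op m)) t,
      F n (X.map φ.op σ) t = F m σ (_root_.stdSimplex.map φ t)) : SSet.toTop.obj X ⟶ Z :=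
  (sSetTopAdj.homEquiv _ _).symm
    { app := fun n => TypeCat.ofHom fun σ => (Z.toSSetObjEquiv n).symm (F n.unop σ)
      naturality := by
        intro n m φ
        ext σ
        apply (Z.toSSetObjEquiv m).injective
        ext t
        exact hF _ _ _ }

theorem realLift_realPoint {X : SSet.{u}} {Z : TopCat.{u}}
    (F : ∀ n : SimplexCategory, X.obj (op n) → C(SimplexPt n, Z))
    (hF : ∀ ⦃n m : SimplexCategory⦄ (φ : n ⟶ m) (σ : X.obj (op m)) t,
      F n (X.map φ.op σ) t = F m σ (_root_.stdSimplex.map φ t)) {n : SimplexCategory}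
    (σ : X.obj (op n)) t : realLift F hF (realPoint σ t) = F n σ t := by
  rw [← homEquiv_apply, realLift, Equiv.apply_symm_apply]
  rfl

theorem stdSimplex_map_apply {n m : SimplexCategory} (φ : n ⟶ m) (t : SimplexPt n)
    (j : Fin (m.len + 1)) :
    _root_.stdSimplex.map φ t j = ∑ i, if φ i = j then t i else 0 := by
  classical
  rw [stdSimplex.map_coe, FunOnFinite.linearMap_apply_apply, Finset.sum_filter]

theorem sum_mul_stdSimplex_map {n m : SimplexCategory} (φ : n ⟶ m) (t : SimplexPt n)
    (g : Fin (m.len + 1) → ℝ) :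
    ∑ j, g j * _root_.stdSimplex.map φ t j = ∑ i, g (φ i) * t i := by
  simp only [stdSimplex_map_apply, Finset.mul_sum]
  rw [Finset.sum_comm]
  refine Finset.sum_congr rfl fun i _ => ?_
  rw [Finset.sum_eq_single (φ i)]
  · simp
  · intro j _ hj
    simp [hj.symm]
  · simp

/-- Discard the vanishing coordinates by passing to a face, then write this face as a degeneracy of
a nondegenerate simplex. Pushing coordinates forward along a surjection of vertices keeps them
positive. -/
theorem exists_pos_nonDegenerate {X : SSet.{u}} (x : SSet.toTop.obj X) :
    ∃ (n : ℕ) (σ : X _⦋n⦌) (t : SimplexPt ⦋n⦌), σ ∈ X.nonDegenerate n ∧ (∀ i, 0 < t i) ∧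
      realPoint σ t = x := by
  classical
  obtain ⟨n, σ, t, rfl⟩ := exists_realPoint x
  let B : Finset (Fin (n + 1)) := {i | t i ≠ 0}
  have hB : ∑ i ∈ B, t i = 1 := by
    rw [← t.2.2]
    exact Finset.sum_filter_ne_zero _
  obtain ⟨b, hb⟩ : ∃ b, B.card = b + 1 := by
    refine ⟨B.card - 1, (Nat.succ_pred_eq_of_pos (Finset.card_pos.2 ?_)).symm⟩
    by_contra h
    rw [Finset.not_nonempty_iff_eq_empty.1 h] at hB
    simp at hB
  let f := B.orderEmbOfFin hb
  have hfB : ∀ i, f i ∈ B := fun i => B.orderEmbOfFin_mem hb i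
  let φ : ⦋b⦌ ⟶ ⦋n⦌ := SimplexCategory.Hom.mk f.toOrderHom
  have hsum : ∀ g : Fin (n + 1) → ℝ, ∑ i, g (f i) = ∑ j ∈ B, g j := by
    intro g
    refine (Finset.sum_map Finset.univ f.toEmbedding g).symm.trans ?_
    congr 1
    exact B.map_orderEmbOfFin_univ hb
  let t' : SimplexPt ⦋b⦌ := ⟨fun i => t (f i), fun i => stdSimplex.zero_le t _,
    (hsum t).trans hB⟩
  have ht' : _root_.stdSimplex.map φ t' = t := by
    ext j
    refine (stdSimplex_map_apply φ t' j).trans ?_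
    refine (hsum fun i => if i = j then t i else 0).trans ?_
    rw [Finset.sum_ite_eq']
    split_ifs with h
    · rfl
    · simpa [B] using (not_not.1 fun h' => h (Finset.mem_filter.2 ⟨Finset.mem_univ _, h'⟩)).symm
  have hpos : ∀ i, 0 < t' i := fun i =>
    lt_of_le_of_ne (stdSimplex.zero_le t' i) (Finset.mem_filter.1 (hfB i)).2.symm
  obtain ⟨m, e, he, y, hy⟩ := X.exists_nonDegenerate (X.map φ.op σ)
  refine ⟨m, y, _root_.stdSimplex.map e t', y.2, fun j => ?_, ?_⟩
  · obtain ⟨i, rfl⟩ := SimplexCategory.epi_iff_surjective.1 he j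
    refine lt_of_lt_of_eq ?_ (stdSimplex_map_apply e t' _).symm
    refine Finset.sum_pos' (fun k _ => ?_) ⟨i, Finset.mem_univ _, ?_⟩
    · split_ifs
      · exact (hpos k).le
      · exact le_rfl
    · exact lt_of_lt_of_eq (hpos i) (if_pos rfl).symm
  · rw [← realPoint_map, ← hy, realPoint_map, ht']

/-- Vertices of the simplices of a simplicial set in a partially ordered set, which determine the
simplices. -/
structure VertexMap (X : SSet.{u}) (P : Type u) [PartialOrder P] where
  /-- The family of vertices of a simplex. -/
  vert {n : SimplexCategory} (σ : X.obj (op n)) : Fin (n.len + 1) → P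
  vert_map {n m : SimplexCategory} (φ : n ⟶ m) (σ : X.obj (op m)) (i : Fin (n.len + 1)) :
    vert (X.map φ.op σ) i = vert σ (φ i)
  monotone {n : SimplexCategory} (σ : X.obj (op n)) : Monotone (vert σ)
  injective (n : SimplexCategory) : Function.Injective (vert (n := n))

namespace VertexMap

variable {X : SSet.{u}} {P : Type u} [PartialOrder P] (v : VertexMap X P)

open Classical in
/-- The barycentric coordinates on the geometric realization. -/
def coord : SSet.toTop.obj X ⟶ TopCat.of (P → ℝ) :=
  realLift (Z := TopCat.of (P → ℝ))
    (fun n σ => ⟨fun t p => ∑ i, if v.vert σ i = p then t i else 0, by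
      refine continuous_pi fun p => continuous_finsetSum _ fun i _ => ?_
      split_ifs
      · exact (continuous_apply i).comp continuous_subtype_val
      · exact continuous_const⟩)
    (by
      intro n m φ σ t
      ext p
      change (∑ i, if v.vert (X.map φ.op σ) i = p then t i else 0) =
        ∑ j, if v.vert σ j = p then _root_.stdSimplex.map φ t j else 0
      have := sum_mul_stdSimplex_map φ t fun j => if v.vert σ j = p then 1 else 0
      simp only [ite_mul, one_mul, zero_mul] at this
      simp only [v.vert_map, this])

open Classical in
theorem coord_realPoint {n : SimplexCategory} (σ : X.obj (op n)) (t : SimplexPt n) (p : P) :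
    (v.coord (realPoint σ t) : P → ℝ) p = ∑ i, if v.vert σ i = p then t i else 0 := by
  exact congrFun (realLift_realPoint (Z := TopCat.of (P → ℝ)) _ _ σ t) p

/-- If the vertices `i` and `i + 1` coincide, then `σ` and the `i`-th degeneracy of its `i`-th face
have the same vertices, so they are equal. -/
theorem strictMono_of_nonDegenerate {n : ℕ} {σ : X _⦋n⦌} (hσ : σ ∈ X.nonDegenerate n) :
    StrictMono (v.vert σ : Fin (n + 1) → P) := by
  obtain _ | n := n
  · exact Subsingleton.strictMono (α := Fin 1) _
  refine Fin.strictMono_iff_lt_succ.2 fun i =>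
    lt_of_le_of_ne (v.monotone σ (Fin.castSucc_lt_succ (i := i)).le) fun h => ?_
  refine ((X.mem_nonDegenerate_iff_notMem_degenerate σ).1 hσ) ?_
  have : X.σ i (X.δ i.castSucc σ) = σ := by
    apply v.injective
    funext j
    refine (v.vert_map _ _ _).trans ((v.vert_map _ _ _).trans ?_)
    change v.vert σ (i.castSucc.succAbove (i.predAbove j)) = v.vert σ j
    by_cases hj : j = i.castSucc
    · subst hj
      rw [Fin.predAbove_castSucc_self, Fin.succAbove_castSucc_self]
      exact h.symm
    · congr 1
      exact Fin.succAbove_predAbove hj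
  rw [← this]
  exact X.σ_mem_degenerate _ _

/-- For a nondegenerate simplex with positive coordinates, the support of `coord` is the set of
vertices. In increasing order the vertices determine the simplex, and the values of `coord` on them
are the coordinates of the point. -/
theorem coord_injective : Function.Injective v.coord := by
  classical
  intro x y hxy
  obtain ⟨n, σ, t, hσ, ht, rfl⟩ := exists_pos_nonDegenerate x
  obtain ⟨m, τ, s, hτ, hs, rfl⟩ := exists_pos_nonDegenerate y
  have key : ∀ (k : ℕ) (ρ : X _⦋k⦌) (r : SimplexPt ⦋k⦌), ρ ∈ X.nonDegenerate k → ∀ i,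
      (v.coord (realPoint ρ r) : P → ℝ) (v.vert ρ i) = r i := by
    intro k ρ r hρ i
    rw [coord_realPoint, Finset.sum_eq_single i]
    · simp
    · intro j _ hj
      exact if_neg fun h => hj ((v.strictMono_of_nonDegenerate hρ).injective h)
    · simp
  have key' : ∀ (k : ℕ) (ρ : X _⦋k⦌) (r : SimplexPt ⦋k⦌), ρ ∈ X.nonDegenerate k →
      (∀ i, 0 < r i) →
      {p | (v.coord (realPoint ρ r) : P → ℝ) p ≠ 0} = Set.range (v.vert ρ) := by
    intro k ρ r hρ hr
    ext p
    constructor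
    · intro hp
      by_contra h
      refine hp ?_
      rw [coord_realPoint]
      exact Finset.sum_eq_zero fun i _ => if_neg fun h' => h ⟨i, h'⟩
    · rintro ⟨i, rfl⟩
      exact (key k ρ r hρ i).trans_ne (hr i).ne'
  have hr : Set.range (v.vert σ) = Set.range (v.vert τ) := by
    rw [← key' n σ t hσ ht, ← key' m τ s hτ hs, hxy]
  have hn : n = m := by
    have h1 := Set.ncard_range_of_injective (v.strictMono_of_nonDegenerate hσ).injective
    have h2 := Set.ncard_range_of_injective (v.strictMono_of_nonDegenerate hτ).injective
    have h3 : (Set.range (v.vert σ)).ncard = (Set.range (v.vert τ)).ncard := by rw [hr]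
    rw [h1, h2] at h3
    simpa using h3
  subst hn
  have h1 : v.vert σ = v.vert τ :=
    ((v.strictMono_of_nonDegenerate hσ).range_inj (v.strictMono_of_nonDegenerate hτ)).1 hr
  obtain rfl := v.injective _ h1
  congr 1
  ext i
  exact (key n σ t hσ i).symm.trans ((congrFun hxy _).trans (key n σ s hσ i))

end VertexMap

end SSet
end Realization

/-! ### Hausdorff realizations, horns, and the Kan property of singular complexes -/

noncomputable section Realization

open Simplicial Limits HomotopicalAlgebra

namespace SSet

instance compactSpace_toTop (X : SSet.{u}) [X.Finite] : CompactSpace (SSet.toTop.obj X) := by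
  constructor
  have : (Set.univ : Set (SSet.toTop.obj X)) =
      ⋃ s : X.N, Set.range (realPoint s.simplex) := by
    symm
    rw [Set.eq_univ_iff_forall]
    intro x
    obtain ⟨n, σ, t, hσ, -, rfl⟩ := exists_pos_nonDegenerate x
    exact Set.mem_iUnion.2 ⟨N.mk σ hσ, t, rfl⟩
  rw [this]
  exact isCompact_iUnion fun s => isCompact_range (continuous_realPoint _)

namespace VertexMap

variable {X : SSet.{u}} {P : Type u} [PartialOrder P] (v : VertexMap X P)

theorem finite [Finite P] (v : VertexMap X P) : X.Finite := by
  have : X.HasDimensionLT (Nat.card P) := by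
    refine ⟨fun n hn => Set.eq_univ_of_forall fun σ => ?_⟩
    by_contra h
    have := Nat.card_le_card_of_injective _ (v.strictMono_of_nonDegenerate
      ((X.mem_nonDegenerate_iff_notMem_degenerate σ).2 h)).injective
    rw [Nat.card_eq_fintype_card, Fintype.card_fin] at this
    exact absurd (this.trans hn) (by simp)
  refine X.finite_of_hasDimensionLT (Nat.card P) fun i _ => ?_
  have : Finite (X _⦋i⦌) := Finite.of_injective _ (v.injective ⦋i⦌)
  infer_instance

theorem t2Space (v : VertexMap X P) : T2Space (SSet.toTop.obj X) :=
  T2Space.of_injective_continuous (f := v.coord) v.coord_injective v.coord.hom.continuous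

/-- The vertices of the simplices of a smaller simplicial set. -/
def comap {A : SSet.{u}} (f : A ⟶ X) [Mono f] : VertexMap A P where
  vert σ := v.vert (f.app _ σ)
  vert_map φ σ i := by
    rw [← v.vert_map]
    congr 1
    exact NatTrans.naturality_apply f φ.op σ
  monotone σ := v.monotone _
  injective n := (v.injective n).comp (injective_of_mono _)

theorem coord_toTop_map {A : SSet.{u}} (f : A ⟶ X) [Mono f] (x : SSet.toTop.obj A) :
    v.coord (SSet.toTop.map f x) = (v.comap f).coord x := by
  obtain ⟨n, σ, t, rfl⟩ := exists_realPoint x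
  ext p
  rw [toTop_map_realPoint, coord_realPoint, coord_realPoint]
  rfl

theorem toTop_map_injective (v : VertexMap X P) {A : SSet.{u}} (f : A ⟶ X) [Mono f] :
    Function.Injective (SSet.toTop.map f) := by
  intro x y h
  apply (v.comap f).coord_injective
  rw [← coord_toTop_map, ← coord_toTop_map, h]

/-- The vertices of the simplices of the nerve of a thin category, which has a conservative functor
to a partially ordered set. -/
def ofNerve {C : Type u} [Category.{u} C] [Quiver.IsThin C] (f : C → P)
    (hf : Function.Injective f) (hf' : ∀ {x y : C}, (x ⟶ y) → f x ≤ f y) : VertexMap (nerve C) P where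
  vert σ := fun i => f (σ.obj i)
  vert_map _ _ _ := rfl
  monotone σ := fun _ _ h => hf' (σ.map (homOfLE h))
  injective n σ τ h := by
    have h' : ∀ i, σ.obj i = τ.obj i := fun i => hf (congrFun h i)
    exact CategoryTheory.Functor.ext h' fun _ _ _ => Subsingleton.elim _ _

/-- The vertices of the simplices of a product. -/
def prod {Y : SSet.{u}} {Q : Type u} [PartialOrder Q] (v : VertexMap X P) (w : VertexMap Y Q) :
    VertexMap (X ⊗ Y) (P × Q) where
  vert σ i := (v.vert σ.1 i, w.vert σ.2 i)
  vert_map φ σ i := Prod.ext (v.vert_map φ σ.1 i) (w.vert_map φ σ.2 i)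
  monotone _ _ _ h := ⟨v.monotone _ h, w.monotone _ h⟩
  injective n _ _ h := Prod.ext
    (v.injective n (funext fun i => congrArg Prod.fst (congrFun h i)))
    (w.injective n (funext fun i => congrArg Prod.snd (congrFun h i)))

/-- The vertices of the simplices of a standard simplex. -/
def stdSimplex (n : SimplexCategory) : VertexMap (SSet.stdSimplex.{u}.obj n)
    (ULift.{u} (Fin (n.len + 1))) where
  vert σ i := ⟨SSet.stdSimplex.objEquiv σ i⟩
  vert_map _ _ _ := rfl
  monotone σ := fun i j h => (SSet.stdSimplex.objEquiv σ).toOrderHom.monotone h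
  injective n σ τ h := by
    apply SSet.stdSimplex.objEquiv.injective
    ext i : 3
    exact congrArg ULift.down (congrFun h i)

end VertexMap

instance t2Space_toTop_stdSimplex (n : SimplexCategory) :
    T2Space (SSet.toTop.obj (SSet.stdSimplex.{u}.obj n)) :=
  (VertexMap.stdSimplex n).t2Space

theorem realPoint_stdSimplex {n m : SimplexCategory} (φ : n ⟶ m) (t : SimplexPt n) :
    realPoint (X := SSet.stdSimplex.{u}.obj m) (stdSimplex.objEquiv.symm φ) t =
      m.toTopHomeo.symm (_root_.stdSimplex.map φ t) := by
  rw [SimplexCategory.toTopHomeo_symm_naturality_apply, ← SSet.yonedaEquiv_map]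
  unfold realPoint
  rw [Equiv.symm_apply_apply]

section Horn

variable {n : ℕ} (i : Fin (n + 2))

/-- The smallest coordinate other than the `i`-th one of a point of the simplex. -/
def minCoord (x : SimplexPt ⦋n + 1⦌) : ℝ :=
  ({i}ᶜ : Finset (Fin (n + 2))).inf' (by
    obtain ⟨j, hj⟩ := exists_ne i
    exact ⟨j, by simpa using hj⟩) fun j => x j

theorem minCoord_le (x : SimplexPt ⦋n + 1⦌) {j : Fin (n + 2)} (hj : j ≠ i) :
    minCoord i x ≤ x j :=
  Finset.inf'_le _ (by simpa using hj)

theorem exists_minCoord (x : SimplexPt ⦋n + 1⦌) : ∃ j ≠ i, minCoord i x = x j := by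
  obtain ⟨j, hj, h⟩ := Finset.exists_mem_eq_inf' (s := ({i}ᶜ : Finset (Fin (n + 2)))) (by
    obtain ⟨j, hj⟩ := exists_ne i
    exact ⟨j, by simpa using hj⟩) fun j => x j
  exact ⟨j, by simpa using hj, h⟩

theorem continuous_minCoord : Continuous (minCoord i) := by
  unfold minCoord
  exact Continuous.finset_inf'_apply _ fun j _ =>
    (continuous_apply j).comp continuous_subtype_val

theorem minCoord_nonneg (x : SimplexPt ⦋n + 1⦌) : 0 ≤ minCoord i x := by
  obtain ⟨j, -, h⟩ := exists_minCoord i x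
  rw [h]
  exact stdSimplex.zero_le x j

/-- The retraction of the simplex onto the horn, moving points away from the vertices other than
the `i`-th one. -/
def hornRetraction (x : SimplexPt ⦋n + 1⦌) : SimplexPt ⦋n + 1⦌ :=
  -- The minimum is subtracted from all `n + 2` coordinates, the `i`-th included; the mass removed
  -- is given back to the `i`-th vertex.
  ⟨fun k => x k - minCoord i x + if k = i then (n + 2) * minCoord i x else 0, by
    refine ⟨fun k => ?_, ?_⟩
    · have := minCoord_nonneg i x
      dsimp only
      split_ifs with h
      · have := stdSimplex.zero_le x k
        nlinarith
      · simpa using minCoord_le i x h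
    · rw [Finset.sum_add_distrib, Finset.sum_sub_distrib, Finset.sum_ite_eq']
      have := stdSimplex.sum_eq_one x
      simp only [Finset.mem_univ, if_true, this, Finset.sum_const, Finset.card_univ,
        Fintype.card_fin, nsmul_eq_mul]
      push_cast
      ring⟩

theorem continuous_hornRetraction : Continuous (hornRetraction i) := by
  refine Continuous.subtype_mk (continuous_pi fun k => ?_) _
  have h := continuous_minCoord i
  have h' : Continuous fun x : SimplexPt ⦋n + 1⦌ => x k :=
    (continuous_apply k).comp continuous_subtype_val
  split_ifs
  · exact (h'.sub h).add (continuous_const.mul h)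
  · exact (h'.sub h).add continuous_const

theorem exists_hornRetraction_eq_zero (x : SimplexPt ⦋n + 1⦌) :
    ∃ j ≠ i, hornRetraction i x j = 0 := by
  obtain ⟨j, hj, h⟩ := exists_minCoord i x
  refine ⟨j, hj, ?_⟩
  change x j - minCoord i x + (if j = i then _ else 0) = 0
  rw [if_neg hj, h]
  simp

theorem hornRetraction_of_eq_zero {x : SimplexPt ⦋n + 1⦌} {j : Fin (n + 2)} (hj : j ≠ i)
    (h : x j = 0) : hornRetraction i x = x := by
  have h0 : minCoord i x = 0 := le_antisymm (h ▸ minCoord_le i x hj) (minCoord_nonneg i x)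
  ext k
  change x k - minCoord i x + (if k = i then (n + 2) * minCoord i x else 0) = x k
  rw [h0]
  simp

theorem mem_range_toTop_horn_ι {x : SimplexPt ⦋n + 1⦌} {j : Fin (n + 2)} (hj : j ≠ i)
    (h : x j = 0) : (⦋n + 1⦌ : SimplexCategory).toTopHomeo.symm x ∈
      Set.range (SSet.toTop.map (Λ[n + 1, i] : SSet.Subcomplex.{u} _).ι) := by
  obtain ⟨t, rfl⟩ : ∃ t : SimplexPt ⦋n⦌, _root_.stdSimplex.map (SimplexCategory.δ j) t = x := by
    refine ⟨⟨fun k => x (j.succAbove k), fun k => stdSimplex.zero_le x _, ?_⟩, ?_⟩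
    · have := stdSimplex.sum_eq_one x
      rw [Fin.sum_univ_succAbove _ j, h, zero_add] at this
      exact this
    · ext k
      refine (stdSimplex_map_apply (SimplexCategory.δ j) _ k).trans ?_
      obtain rfl | ⟨k, rfl⟩ := Fin.eq_self_or_eq_succAbove j k
      · refine Eq.trans ?_ h.symm
        exact Finset.sum_eq_zero fun l _ => if_neg (Fin.succAbove_ne _ l)
      · refine (Finset.sum_eq_single k (fun l _ hl => if_neg fun h' => hl ?_) (by simp)).trans
          (if_pos rfl)
        exact Fin.succAbove_right_injective h'
  rw [← realPoint_stdSimplex]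
  refine ⟨realPoint (X := (Λ[n + 1, i] : SSet.{u}))
    ⟨stdSimplex.objEquiv.symm (SimplexCategory.δ j), ?_⟩ t, ?_⟩
  · rw [mem_horn_iff, Ne, Set.eq_univ_iff_forall, not_forall]
    refine ⟨j, ?_⟩
    rintro (⟨k, hk⟩ | h')
    · exact Fin.succAbove_ne j k hk
    · exact hj h'
  · exact toTop_map_realPoint _ _ _

theorem exists_eq_zero_of_horn (y : SSet.toTop.obj (Λ[n + 1, i] : SSet.{u})) :
    ∃ j ≠ i, (⦋n + 1⦌ : SimplexCategory).toTopHomeo (SSet.toTop.map Λ[n + 1, i].ι y) j = 0 := by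
  obtain ⟨m, σ, t, rfl⟩ := exists_realPoint y
  have hσ := σ.2
  rw [mem_horn_iff, Ne, Set.eq_univ_iff_forall, not_forall] at hσ
  obtain ⟨j, hj⟩ := hσ
  refine ⟨j, fun h => hj (Or.inr h), ?_⟩
  rw [toTop_map_realPoint]
  change (⦋n + 1⦌ : SimplexCategory).toTopHomeo (realPoint σ.1 t) j = 0
  rw [← stdSimplex.objEquiv.symm_apply_apply σ.1, realPoint_stdSimplex,
    Homeomorph.apply_symm_apply]
  refine (stdSimplex_map_apply _ _ _).trans (Finset.sum_eq_zero fun l _ => if_neg fun h => ?_)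
  exact hj (Or.inl ⟨l, h⟩)

/-- The realized horn is compact and injects into a Hausdorff space, so it is closed embedded. A
continuous self-map of the simplex with values in its image therefore factors continuously through
it. -/
theorem exists_retraction_toTop_horn_ι :
    ∃ ρ : SSet.toTop.obj Δ[n + 1] ⟶ SSet.toTop.obj (Λ[n + 1, i] : SSet.{u}),
      SSet.toTop.map Λ[n + 1, i].ι ≫ ρ = 𝟙 _ := by
  have hemb : Topology.IsClosedEmbedding (SSet.toTop.map Λ[n + 1, i].ι) :=
    (SSet.toTop.map Λ[n + 1, i].ι).hom.continuous.isClosedEmbedding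
      ((VertexMap.stdSimplex _).toTop_map_injective _)
  have hR : ∀ x, (⦋n + 1⦌ : SimplexCategory).toTopHomeo.symm (hornRetraction i
      ((⦋n + 1⦌ : SimplexCategory).toTopHomeo x)) ∈
      Set.range (SSet.toTop.map (Λ[n + 1, i] : SSet.Subcomplex.{u} _).ι) := fun x => by
    obtain ⟨j, hj, h⟩ := exists_hornRetraction_eq_zero i
      ((⦋n + 1⦌ : SimplexCategory).toTopHomeo x)
    exact mem_range_toTop_horn_ι i hj h
  let e := hemb.isEmbedding.toHomeomorph
  refine ⟨TopCat.ofHom ⟨fun x => e.symm ⟨_, hR x⟩, e.symm.continuous.comp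
    (Continuous.subtype_mk ?_ _)⟩, ?_⟩
  · exact (Homeomorph.continuous _).comp
      ((continuous_hornRetraction i).comp (Homeomorph.continuous _))
  · ext y
    obtain ⟨j, hj, h⟩ := exists_eq_zero_of_horn i y
    apply e.injective
    apply Subtype.ext
    change (e (e.symm _)).1 = _
    rw [e.apply_symm_apply]
    change (⦋n + 1⦌ : SimplexCategory).toTopHomeo.symm (hornRetraction i
      ((⦋n + 1⦌ : SimplexCategory).toTopHomeo (SSet.toTop.map Λ[n + 1, i].ι y))) = _
    rw [hornRetraction_of_eq_zero i hj h, Homeomorph.symm_apply_apply]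
    rfl

end Horn

open modelCategoryQuillen in
-- By adjunction a horn in the singular complex is a map from the realized horn, which extends to
-- the simplex by composition with a retraction.
instance kanComplex_toSSet (X : TopCat.{u}) : KanComplex (TopCat.toSSet.obj X) := by
  refine (isFibrant_iff _).2 ⟨?_⟩
  rw [fibrations_eq]
  intro _ _ _ hf
  simp only [J, MorphismProperty.iSup_iff] at hf
  obtain ⟨n, ⟨i⟩⟩ := hf
  obtain ⟨ρ, hρ⟩ := exists_retraction_toTop_horn_ι i
  refine ⟨fun {t _} _ ↦ ⟨⟨{
    l := sSetTopAdj.homEquiv _ _ (ρ ≫ (sSetTopAdj.homEquiv _ _).symm t)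
    fac_left := ?_
    fac_right := by subsingleton }⟩⟩⟩
  rw [← Adjunction.homEquiv_naturality_left, reassoc_of% hρ, Equiv.apply_symm_apply]

end SSet
end Realization

/-! ### Geometric realization and products -/

noncomputable section RealizationProduct

open Simplicial Limits CartesianMonoidalCategory

open Classical in
-- Möbius inversion on a finite poset, by induction from the minimal elements upwards.
theorem eq_of_sum_le_eq {P : Type*} [PartialOrder P] [Fintype P] {g g' : P → ℝ}
    (h : ∀ p, ∑ q with q ≤ p, g q = ∑ q with q ≤ p, g' q) : g = g' := by
  funext p
  induction p using WellFoundedLT.induction with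
  | _ p ih =>
    have hp := h p
    have hs : (Finset.univ.filter (· ≤ p)) = insert p (Finset.univ.filter (· < p)) := by
      ext q
      simp [le_iff_eq_or_lt]
    rw [hs, Finset.sum_insert (by simp), Finset.sum_insert (by simp),
      Finset.sum_congr rfl fun q hq => ih q (Finset.mem_filter.1 hq).2] at hp
    exact add_right_cancel hp

open Classical in
theorem sum_le_sum_ite {ι P : Type*} [PartialOrder P] [Fintype P] [Fintype ι] (f : ι → P)
    (t : ι → ℝ) (p : P) :
    (∑ q with q ≤ p, ∑ i, if f i = q then t i else 0) = ∑ i with f i ≤ p, t i := by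
  rw [Finset.sum_comm, Finset.sum_filter]
  refine Finset.sum_congr rfl fun i _ => ?_
  rw [Finset.sum_ite_eq]
  simp

theorem exists_orderHom_snoc {N : ℕ} {α : Type*} [Preorder α] (f : Fin N →o α) (a : α)
    (h : ∀ k, f k ≤ a) :
    ∃ F : Fin (N + 1) →o α, (∀ k, F k.castSucc = f k) ∧ F (Fin.last N) = a := by
  refine ⟨⟨Fin.snoc (α := fun _ => α) f a, ?_⟩, fun k => Fin.snoc_castSucc (α := fun _ => α) a f k,
    Fin.snoc_last (α := fun _ => α) a f⟩
  intro i j hij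
  induction j using Fin.lastCases with
  | last =>
    induction i using Fin.lastCases with
    | last => simp
    | cast i => simpa using h i
  | cast j =>
    induction i using Fin.lastCases with
    | last => exact absurd hij (by simp)
    | cast i => simpa using f.monotone (Fin.castSucc_le_castSucc_iff.1 hij)

/-- Two nonnegative vectors of the same total mass are the marginals of a measure supported on a
chain. -/
theorem exists_chain_marginals (m n : ℕ) (s : Fin (m + 1) → ℝ) (t : Fin (n + 1) → ℝ)
    (hs : ∀ i, 0 ≤ s i) (ht : ∀ j, 0 ≤ t j) (hst : ∑ i, s i = ∑ j, t j) :
    ∃ (N : ℕ) (f : Fin (N + 1) →o Fin (m + 1)) (g : Fin (N + 1) →o Fin (n + 1))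
      (r : Fin (N + 1) → ℝ), (∀ k, 0 ≤ r k) ∧ (∀ i, (∑ k, if f k = i then r k else 0) = s i) ∧
        ∀ j, (∑ k, if g k = j then r k else 0) = t j := by
  induction h : m + n generalizing m n with
  | zero =>
    obtain ⟨rfl, rfl⟩ : m = 0 ∧ n = 0 := by omega
    refine ⟨0, OrderHom.id, OrderHom.id, s, hs, fun i => ?_, fun j => ?_⟩
    · obtain rfl := Subsingleton.elim (α := Fin 1) i 0
      simp
    · obtain rfl := Subsingleton.elim (α := Fin 1) j 0
      simpa using hst
  | succ d ih =>
    -- Greedy transport: the chain ends at the pair of last indices, with the smaller of the two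
    -- last masses. This exhausts one index, and the rest is a problem of smaller size.
    have step : ∀ (m n : ℕ) (s : Fin (m + 2) → ℝ) (t : Fin (n + 1) → ℝ), (∀ i, 0 ≤ s i) →
        (∀ j, 0 ≤ t j) → ∑ i, s i = ∑ j, t j → m + n = d → s (Fin.last _) ≤ t (Fin.last _) →
        ∃ (N : ℕ) (f : Fin (N + 1) →o Fin (m + 2)) (g : Fin (N + 1) →o Fin (n + 1))
          (r : Fin (N + 1) → ℝ), (∀ k, 0 ≤ r k) ∧
          (∀ i, (∑ k, if f k = i then r k else 0) = s i) ∧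
          ∀ j, (∑ k, if g k = j then r k else 0) = t j := by
      intro m n s t hs ht hst hd hle
      obtain ⟨N, f, g, r, hr, hf, hg⟩ := ih m n (fun i => s i.castSucc)
        (fun j => t j - if j = Fin.last _ then s (Fin.last _) else 0) (fun i => hs _)
        (fun j => by
          split_ifs with h
          · rw [h]
            linarith
          · simpa using ht j)
        (by
          rw [Fin.sum_univ_castSucc] at hst
          rw [Finset.sum_sub_distrib, Finset.sum_ite_eq', if_pos (Finset.mem_univ _), ← hst]
          ring) hd
      obtain ⟨F, hF, hF'⟩ := exists_orderHom_snoc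
        (OrderHom.comp ⟨Fin.castSucc, Fin.strictMono_castSucc.monotone⟩ f)
        (Fin.last _) fun k => Fin.le_last _
      obtain ⟨G, hG, hG'⟩ := exists_orderHom_snoc g (Fin.last _) fun k => Fin.le_last _
      refine ⟨N + 1, F, G, Fin.snoc (α := fun _ => ℝ) r (s (Fin.last _)), fun k => ?_, fun i => ?_,
        fun j => ?_⟩
      · induction k using Fin.lastCases with
        | last => simpa using hs _
        | cast k => simpa using hr k
      · rw [Fin.sum_univ_castSucc]
        simp only [hF, hF', Fin.snoc_castSucc, Fin.snoc_last, OrderHom.comp_coe, Function.comp_apply,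
          OrderHom.coe_mk]
        induction i using Fin.lastCases with
        | last => simp [Fin.castSucc_ne_last]
        | cast i => simpa [(Fin.castSucc_ne_last i).symm] using hf i
      · rw [Fin.sum_univ_castSucc]
        simp only [hG, hG', Fin.snoc_castSucc, Fin.snoc_last, hg j]
        simp only [eq_comm (a := j), sub_add_cancel]
    have hlast : ∀ {k : ℕ} (a : Fin (k + 1) → ℝ), (∀ i, 0 ≤ a i) → a (Fin.last k) ≤ ∑ i, a i :=
      fun a ha => Finset.single_le_sum (fun i _ => ha i) (Finset.mem_univ _)
    by_cases h₁ : ∃ m', m = m' + 1 ∧ s (Fin.last _) ≤ t (Fin.last _)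
    · obtain ⟨m, rfl, hle⟩ := h₁
      exact step m n s t hs ht hst (by omega) hle
    by_cases h₂ : ∃ n', n = n' + 1 ∧ t (Fin.last _) ≤ s (Fin.last _)
    · obtain ⟨n, rfl, hle⟩ := h₂
      obtain ⟨N, f, g, r, hr, hf, hg⟩ := step n m t s ht hs hst.symm (by omega) hle
      exact ⟨N, g, f, r, hr, hg, hf⟩
    -- If one vector has a single entry, this entry is the total mass, which dominates the last
    -- entry of the other vector. So some step always applies.
    exfalso
    obtain _ | m := m
    · obtain _ | n := n
      · omega
      · refine h₂ ⟨n, rfl, (hlast t ht).trans ?_⟩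
        rw [← hst]
        simp
    · obtain _ | n := n
      · refine h₁ ⟨m, rfl, (hlast s hs).trans ?_⟩
        rw [hst]
        simp
      · obtain h' | h' := le_total (s (Fin.last _)) (t (Fin.last _))
        · exact h₁ ⟨m, rfl, h'⟩
        · exact h₂ ⟨n, rfl, h'⟩

namespace SSet

open Classical in
theorem VertexMap.sum_coord_realPoint {X : SSet.{u}} {P : Type u} [PartialOrder P] [Fintype P]
    (v : VertexMap X P) {n : SimplexCategory} (σ : X.obj (op n)) (t : SimplexPt n) (p : P) :
    ∑ q with q ≤ p, (v.coord (realPoint σ t) : P → ℝ) q = ∑ i with v.vert σ i ≤ p, t i := by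
  refine Eq.trans ?_ (sum_le_sum_ite (v.vert σ) t p)
  exact Finset.sum_congr rfl fun q _ => v.coord_realPoint σ t q

variable (X Y : SSet.{u}) in
/-- The comparison map for the realization of a product. -/
def toTopProd : C(SSet.toTop.obj (X ⊗ Y), SSet.toTop.obj X × SSet.toTop.obj Y) :=
  ⟨fun z => (SSet.toTop.map (fst X Y) z, SSet.toTop.map (snd X Y) z),
    (SSet.toTop.map _).hom.continuous.prodMk (SSet.toTop.map _).hom.continuous⟩

theorem toTopProd_realPoint {X Y : SSet.{u}} {n : SimplexCategory} (σ : (X ⊗ Y).obj (op n))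
    (t : SimplexPt n) : toTopProd X Y (realPoint σ t) = (realPoint σ.1 t, realPoint σ.2 t) :=
  Prod.ext (toTop_map_realPoint _ _ _) (toTop_map_realPoint _ _ _)

theorem toTopProd_map {X Y X' Y' : SSet.{u}} (f : X ⟶ X') (g : Y ⟶ Y')
    (z : SSet.toTop.obj (X ⊗ Y)) : toTopProd X' Y' (SSet.toTop.map (f ⊗ₘ g) z) =
      (SSet.toTop.map f (toTopProd X Y z).1, SSet.toTop.map g (toTopProd X Y z).2) := by
  obtain ⟨n, σ, t, rfl⟩ := exists_realPoint z
  refine (congrArg _ (toTop_map_realPoint _ _ _)).trans ((toTopProd_realPoint _ _).trans ?_)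
  rw [toTopProd_realPoint]
  exact Prod.ext (toTop_map_realPoint _ _ _).symm (toTop_map_realPoint _ _ _).symm

open Classical in
-- Along a simplex the vertices below a given element form an initial segment. Of two initial
-- segments one contains the other, so the mass of the intersection is the minimum of the two
-- masses. Thus the coordinates of a point of the product are computed from those of its
-- projections.
theorem VertexMap.sum_coord_prod {X Y : SSet.{u}} {P Q : Type u} [PartialOrder P] [PartialOrder Q]
    [Fintype P] [Fintype Q] (v : VertexMap X P) (w : VertexMap Y Q) (z : SSet.toTop.obj (X ⊗ Y))
    (p : P × Q) :
    ∑ q with q ≤ p, ((v.prod w).coord z : P × Q → ℝ) q =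
      min (∑ a with a ≤ p.1, (v.coord (toTopProd X Y z).1 : P → ℝ) a)
        (∑ b with b ≤ p.2, (w.coord (toTopProd X Y z).2 : Q → ℝ) b) := by
  obtain ⟨n, σ, t, rfl⟩ := exists_realPoint z
  rw [toTopProd_realPoint, v.sum_coord_realPoint, w.sum_coord_realPoint]
  trans ∑ i with (v.prod w).vert σ i ≤ p, t i
  · convert (v.prod w).sum_coord_realPoint σ t p
  have hA : IsLowerSet {i | v.vert σ.1 i ≤ p.1} := fun i j hij hi => (v.monotone _ hij).trans hi
  have hB : IsLowerSet {i | w.vert σ.2 i ≤ p.2} := fun i j hij hi => (w.monotone _ hij).trans hi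
  have hp : ∀ i, (v.prod w).vert σ i ≤ p ↔ v.vert σ.1 i ≤ p.1 ∧ w.vert σ.2 i ≤ p.2 :=
    fun i => Iff.rfl
  have hmono : ∀ {A B : Fin (n + 1) → Prop}, (∀ i, A i → B i) →
      ∑ i with A i, t i ≤ ∑ i with B i, t i := fun h =>
    Finset.sum_le_sum_of_subset_of_nonneg (fun i hi => by
      simp only [Finset.mem_filter, Finset.mem_univ, true_and] at hi ⊢
      exact h i hi) fun i _ _ => stdSimplex.zero_le t i
  obtain h | h := hA.total hB
  · refine Eq.trans ?_ (min_eq_left (hmono h)).symm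
    congr 1
    ext i
    simp only [Finset.mem_filter, Finset.mem_univ, true_and, hp]
    exact ⟨fun h => h.1, fun h' => ⟨h', h h'⟩⟩
  · refine Eq.trans ?_ (min_eq_right (hmono h)).symm
    congr 1
    ext i
    simp only [Finset.mem_filter, Finset.mem_univ, true_and, hp]
    exact ⟨fun h => h.2, fun h' => ⟨h h', h'⟩⟩

/-- The projections determine the sums of the coordinates over all principal lower sets, hence the
coordinates. -/
theorem VertexMap.toTopProd_injective {X Y : SSet.{u}} {P Q : Type u} [PartialOrder P]
    [PartialOrder Q] [Finite P] [Finite Q] (v : VertexMap X P) (w : VertexMap Y Q) :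
    Function.Injective (toTopProd X Y) := by
  intro z z' h
  have := Fintype.ofFinite P
  have := Fintype.ofFinite Q
  apply (v.prod w).coord_injective
  apply eq_of_sum_le_eq
  intro p
  have h₁ := v.sum_coord_prod w z p
  rw [h, ← v.sum_coord_prod w z' p] at h₁
  convert h₁

/-- The comparison map for the realization of a product of two simplices. -/
def simplexProdMap (m n : SimplexCategory) :
    C(SSet.toTop.obj (stdSimplex.{u}.obj m ⊗ stdSimplex.{u}.obj n), SimplexPt m × SimplexPt n) :=
  ContinuousMap.comp ⟨_, (m.toTopHomeo.prodCongr n.toTopHomeo).continuous⟩ (toTopProd _ _)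

theorem simplexProdMap_realPoint {m n N : SimplexCategory} (f : N ⟶ m) (g : N ⟶ n)
    (t : SimplexPt N) :
    simplexProdMap.{u} m n (realPoint (X := stdSimplex.{u}.obj m ⊗ stdSimplex.{u}.obj n)
      (stdSimplex.objEquiv.symm f, stdSimplex.objEquiv.symm g) t) =
      (_root_.stdSimplex.map f t, _root_.stdSimplex.map g t) := by
  refine (congrArg (m.toTopHomeo.prodCongr n.toTopHomeo) (toTopProd_realPoint _ _)).trans ?_
  refine (m.toTopHomeo.prodCongr n.toTopHomeo).eq_symm_apply.1 ?_
  exact Prod.ext (realPoint_stdSimplex f t) (realPoint_stdSimplex g t)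

/-- Surjectivity is a coupling problem: the two coordinate vectors have to be the marginals of
masses on a chain of pairs of vertices, which `exists_chain_marginals` provides. -/
theorem simplexProdMap_bijective (m n : SimplexCategory) :
    Function.Bijective (simplexProdMap.{u} m n) := by
  constructor
  · intro z z' h
    exact (VertexMap.stdSimplex m).toTopProd_injective (VertexMap.stdSimplex n)
      ((m.toTopHomeo.prodCongr n.toTopHomeo).injective h)
  · rintro ⟨s, t⟩
    obtain ⟨N, f, g, r, hr, hf, hg⟩ := exists_chain_marginals m.len n.len s t
      (stdSimplex.zero_le s) (stdSimplex.zero_le t)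
      ((stdSimplex.sum_eq_one s).trans (stdSimplex.sum_eq_one t).symm)
    refine ⟨realPoint (n := ⦋N⦌) (stdSimplex.objEquiv.symm (SimplexCategory.Hom.mk f),
      stdSimplex.objEquiv.symm (SimplexCategory.Hom.mk g)) ⟨r, hr, ?_⟩, ?_⟩
    · rw [← stdSimplex.sum_eq_one s]
      simp only [← hf]
      rw [Finset.sum_comm]
      simp
    · rw [simplexProdMap_realPoint]
      refine Prod.ext ?_ ?_
      · ext i
        exact (stdSimplex_map_apply _ _ _).trans (hf i)
      · ext j
        exact (stdSimplex_map_apply _ _ _).trans (hg j)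

/-- The realization of a product of two simplices is the product of the realizations. -/
def simplexProdHomeo (m n : SimplexCategory) :
    SSet.toTop.obj (stdSimplex.{u}.obj m ⊗ stdSimplex.{u}.obj n) ≃ₜ SimplexPt m × SimplexPt n :=
  (simplexProdMap m n).continuous.homeoOfEquivCompactToT2
    (f := Equiv.ofBijective _ (simplexProdMap_bijective m n))

variable {X Y : SSet.{u}}

/-- The point of `|X ⊗ Y|` given by points of a simplex of `X` and of a simplex of `Y`. -/
def prodPoint {m n : SimplexCategory} (σ : X.obj (op m)) (τ : Y.obj (op n)) :
    C(SimplexPt m × SimplexPt n, SSet.toTop.obj (X ⊗ Y)) :=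
  (SSet.toTop.map (yonedaEquiv.symm σ ⊗ₘ yonedaEquiv.symm τ)).hom.comp
    ⟨(simplexProdHomeo m n).symm, (simplexProdHomeo m n).symm.continuous⟩

/-- Every pair of points comes from one point of a common simplex. This reduces identities about
pairs to naturality of `realPoint`. -/
theorem exists_realPoint_prodPoint {m n : SimplexCategory} (p : SimplexPt m × SimplexPt n) :
    ∃ (N : SimplexCategory) (f : N ⟶ m) (g : N ⟶ n) (t : SimplexPt N),
      p = (_root_.stdSimplex.map f t, _root_.stdSimplex.map g t) := by
  obtain ⟨z, rfl⟩ := (simplexProdMap_bijective.{0} m n).2 p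
  obtain ⟨N, σ, t, rfl⟩ := exists_realPoint z
  exact ⟨_, stdSimplex.objEquiv σ.1, stdSimplex.objEquiv σ.2, t, simplexProdMap_realPoint _ _ _⟩

theorem prodPoint_map {m n N : SimplexCategory} (f : N ⟶ m) (g : N ⟶ n) (σ : X.obj (op m))
    (τ : Y.obj (op n)) (t : SimplexPt N) :
    prodPoint σ τ (_root_.stdSimplex.map f t, _root_.stdSimplex.map g t) =
      realPoint (X := X ⊗ Y) (X.map f.op σ, Y.map g.op τ) t := by
  have : (simplexProdHomeo.{u} m n).symm
      (_root_.stdSimplex.map f t, _root_.stdSimplex.map g t) = _ :=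
    (simplexProdHomeo.{u} m n).symm_apply_eq.2 (simplexProdMap_realPoint f g t).symm
  change SSet.toTop.map _ ((simplexProdHomeo m n).symm _) = _
  rw [this]
  exact toTop_map_realPoint _ _ _

theorem prodPoint_map_map {m n m' n' : SimplexCategory} (f : m' ⟶ m) (g : n' ⟶ n)
    (σ : X.obj (op m)) (τ : Y.obj (op n)) (s : SimplexPt m') (t : SimplexPt n') :
    prodPoint (X.map f.op σ) (Y.map g.op τ) (s, t) =
      prodPoint σ τ (_root_.stdSimplex.map f s, _root_.stdSimplex.map g t) := by
  obtain ⟨N, f', g', r, h⟩ := exists_realPoint_prodPoint (s, t)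
  obtain ⟨rfl, rfl⟩ := Prod.ext_iff.1 h
  rw [prodPoint_map]
  have h₁ : _root_.stdSimplex.map f (_root_.stdSimplex.map f' r) =
      _root_.stdSimplex.map (f' ≫ f) r := _root_.stdSimplex.map_comp_apply f' f r
  have h₂ : _root_.stdSimplex.map g (_root_.stdSimplex.map g' r) =
      _root_.stdSimplex.map (g' ≫ g) r := _root_.stdSimplex.map_comp_apply g' g r
  rw [h₁, h₂, prodPoint_map, op_comp, op_comp, Functor.map_comp, Functor.map_comp]
  rfl

/-- The partial inverse of the comparison map over a simplex of the second factor. -/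
def prodSimplexInv {n : SimplexCategory} (τ : Y.obj (op n)) :
    SSet.toTop.obj X ⟶ TopCat.of C(SimplexPt n, SSet.toTop.obj (X ⊗ Y)) :=
  realLift (Z := TopCat.of C(SimplexPt n, SSet.toTop.obj (X ⊗ Y)))
    (fun _ σ => (prodPoint σ τ).curry) (by
      intro m m' φ σ t
      ext s
      have := prodPoint_map_map φ (𝟙 n) σ τ t s
      rw [op_id, Functor.map_id_apply] at this
      exact this.trans (congrArg (fun s => prodPoint σ τ (_, s))
        (_root_.stdSimplex.map_id_apply s)))

theorem prodSimplexInv_realPoint {m n : SimplexCategory} (σ : X.obj (op m)) (τ : Y.obj (op n))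
    (s : SimplexPt m) (t : SimplexPt n) :
    (prodSimplexInv τ (realPoint σ s) : C(SimplexPt n, SSet.toTop.obj (X ⊗ Y))) t =
      prodPoint σ τ (s, t) :=
  congrArg (fun f : C(SimplexPt n, SSet.toTop.obj (X ⊗ Y)) => f t)
    (realLift_realPoint (Z := TopCat.of C(SimplexPt n, SSet.toTop.obj (X ⊗ Y))) _ _ σ s)

/-- The curried inverse of the comparison map. -/
def prodInv : SSet.toTop.obj Y ⟶ TopCat.of C(SSet.toTop.obj X, SSet.toTop.obj (X ⊗ Y)) :=
  realLift (Z := TopCat.of C(SSet.toTop.obj X, SSet.toTop.obj (X ⊗ Y)))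
    -- Uncurrying over the compact simplex allows the order of the two variables to be exchanged.
    (fun n τ => ContinuousMap.curry
      ((ContinuousMap.uncurry
        (prodSimplexInv τ).hom).comp ⟨Prod.swap, continuous_swap⟩)) (by
      intro n n' φ τ t
      ext x
      obtain ⟨m, σ, s, rfl⟩ := exists_realPoint x
      refine (prodSimplexInv_realPoint _ _ _ _).trans
        (Eq.trans ?_ (prodSimplexInv_realPoint _ _ _ _).symm)
      have := prodPoint_map_map (𝟙 ⦋m⦌) φ σ τ s t
      rw [op_id, Functor.map_id_apply] at this
      exact this.trans (congrArg (fun s => prodPoint σ τ (s, _))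
        (_root_.stdSimplex.map_id_apply s)))

theorem prodInv_realPoint {m n : SimplexCategory} (σ : X.obj (op m)) (τ : Y.obj (op n))
    (s : SimplexPt m) (t : SimplexPt n) :
    (prodInv (realPoint τ t) : C(SSet.toTop.obj X, SSet.toTop.obj (X ⊗ Y))) (realPoint σ s) =
      prodPoint σ τ (s, t) := by
  refine (congrArg (fun f : C(SSet.toTop.obj X, SSet.toTop.obj (X ⊗ Y)) => f (realPoint σ s))
    (realLift_realPoint (Z := TopCat.of C(SSet.toTop.obj X, SSet.toTop.obj (X ⊗ Y)))
      _ _ τ t)).trans ?_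
  exact prodSimplexInv_realPoint _ _ _ _

variable (X Y) in
/-- If the realization of `X` is locally compact, then geometric realization commutes with the
product with `X`. -/
def toTopProdHomeo [LocallyCompactSpace (SSet.toTop.obj X)] :
    SSet.toTop.obj (X ⊗ Y) ≃ₜ SSet.toTop.obj X × SSet.toTop.obj Y where
  toFun := toTopProd X Y
  -- Joint continuity of the uncurried map is what requires `|X|` to be locally compact.
  invFun := (ContinuousMap.uncurry (prodInv (X := X) (Y := Y)).hom).comp
    ⟨Prod.swap, continuous_swap⟩
  left_inv z := by
    obtain ⟨n, σ, t, rfl⟩ := exists_realPoint z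
    change (prodInv (SSet.toTop.map (snd X Y) _) : C(SSet.toTop.obj X, SSet.toTop.obj (X ⊗ Y)))
      (SSet.toTop.map (fst X Y) _) = _
    rw [toTop_map_realPoint, toTop_map_realPoint, prodInv_realPoint]
    have := prodPoint_map (𝟙 _) (𝟙 _) σ.1 σ.2 t
    rw [op_id, Functor.map_id_apply, Functor.map_id_apply] at this
    exact (congrArg (prodPoint σ.1 σ.2) (Prod.ext (_root_.stdSimplex.map_id_apply t).symm
      (_root_.stdSimplex.map_id_apply t).symm)).trans this
  right_inv := by
    rintro ⟨x, y⟩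
    obtain ⟨m, σ, s, rfl⟩ := exists_realPoint x
    obtain ⟨n, τ, t, rfl⟩ := exists_realPoint y
    change toTopProd X Y ((prodInv (realPoint τ t) :
      C(SSet.toTop.obj X, SSet.toTop.obj (X ⊗ Y))) (realPoint σ s)) = _
    rw [prodInv_realPoint]
    obtain ⟨N, f', g', r, h⟩ := exists_realPoint_prodPoint (s, t)
    obtain ⟨rfl, rfl⟩ := Prod.ext_iff.1 h
    refine (congrArg _ (prodPoint_map f' g' σ τ r)).trans ((toTopProd_realPoint _ _).trans ?_)
    exact Prod.ext (realPoint_map _ _ _) (realPoint_map _ _ _)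
  continuous_toFun := (toTopProd X Y).continuous
  continuous_invFun := ContinuousMap.continuous _

end SSet
end RealizationProduct

/-! ### Realizations of anodyne inclusions -/

noncomputable section AnodyneRealization

open Simplicial Limits CartesianMonoidalCategory HomotopicalAlgebra

namespace SSet

/-- The simplices of the interval `Δ[1]` which are constant at a vertex. -/
def constSimplex (n : SimplexCategory) (e : Fin 2) : Δ[1].obj (op n) :=
  stdSimplex.objEquiv.symm (SimplexCategory.const n ⦋1⦌ e)

/-- The identification of the unit interval with the topological 1-simplex. -/
def edgePoint (s : unitInterval) : SimplexPt ⦋1⦌ :=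
  ⟨![1 - s, s], by
    refine ⟨fun i => ?_, by simp [Fin.sum_univ_two]⟩
    have : i = 0 ∨ i = 1 := Fin.exists_fin_two.1 ⟨i, rfl⟩
    obtain rfl | rfl := this
    · exact sub_nonneg.2 s.2.2
    · exact s.2.1⟩

theorem edgePoint_apply_zero (s : unitInterval) : edgePoint s 0 = 1 - s := rfl

theorem edgePoint_apply_one (s : unitInterval) : edgePoint s 1 = s := rfl

theorem constSimplex_mem_boundary (n : SimplexCategory) (e : Fin 2) :
    constSimplex.{u} n e ∈ (∂Δ[1] : SSet.Subcomplex.{u} _).obj (op n) := by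
  intro h
  obtain ⟨a, ha⟩ := h 0
  obtain ⟨b, hb⟩ := h 1
  exact Fin.zero_ne_one (ha.symm.trans hb)

theorem continuous_edgePoint : Continuous edgePoint := by
  refine Continuous.subtype_mk (continuous_pi fun i => ?_) _
  have : i = 0 ∨ i = 1 := Fin.exists_fin_two.1 ⟨i, rfl⟩
  obtain rfl | rfl := this
  · exact continuous_const.sub continuous_subtype_val
  · exact continuous_subtype_val

theorem stdSimplex_map_const {n : SimplexCategory} (t : SimplexPt n) (e : Fin 2) (s : unitInterval)
    (hs : ∀ i, edgePoint s i = if e = i then 1 else 0) :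
    _root_.stdSimplex.map (SimplexCategory.const n ⦋1⦌ e) t = edgePoint s := by
  ext i
  refine (stdSimplex_map_apply _ _ _).trans (Eq.trans ?_ (hs i).symm)
  rw [← stdSimplex.sum_eq_one t]
  by_cases h : e = i
  · exact (Finset.sum_congr rfl fun k _ => if_pos h).trans (if_pos h).symm
  · exact (Finset.sum_eq_zero fun k _ => if_neg h).trans (if_neg h).symm

instance locallyCompactSpace_toTop_stdSimplex (n : ℕ) :
    LocallyCompactSpace (SSet.toTop.obj Δ[n]) :=
  have := t2Space_toTop_stdSimplex ⦋n⦌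
  inferInstance

/-- A map out of the realization of `Δ[1] ⊗ X` as a homotopy. -/
def cylinderHomotopy {X : SSet.{u}} {Z : TopCat.{u}} (G : SSet.toTop.obj (Δ[1] ⊗ X) ⟶ Z) :
    C(unitInterval × SSet.toTop.obj X, Z) :=
  ⟨fun p => G ((toTopProdHomeo Δ[1] X).symm
      ((⦋1⦌ : SimplexCategory).toTopHomeo.symm (edgePoint p.1), p.2)),
    G.hom.continuous.comp ((toTopProdHomeo Δ[1] X).symm.continuous.comp
      (((Homeomorph.continuous _).comp (continuous_edgePoint.comp continuous_fst)).prodMk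
        continuous_snd))⟩

theorem cylinderHomotopy_const {X : SSet.{u}} {Z : TopCat.{u}}
    (G : SSet.toTop.obj (Δ[1] ⊗ X) ⟶ Z) {n : SimplexCategory} (σ : X.obj (op n)) (t : SimplexPt n)
    (e : Fin 2) (s : unitInterval) (hs : ∀ i, edgePoint s i = if e = i then 1 else 0) :
    cylinderHomotopy G (s, realPoint σ t) =
      G (realPoint (X := Δ[1] ⊗ X) (constSimplex n e, σ) t) := by
  refine congrArg G ((toTopProdHomeo Δ[1] X).symm_apply_eq.2 ?_)
  refine Eq.trans ?_ (toTopProd_realPoint _ _).symm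
  refine Prod.ext (Eq.trans ?_ (realPoint_stdSimplex _ _).symm) rfl
  rw [stdSimplex_map_const t e s hs]

theorem cylinderHomotopy_zero {X : SSet.{u}} {Z : TopCat.{u}}
    (G : SSet.toTop.obj (Δ[1] ⊗ X) ⟶ Z) {n : SimplexCategory} (σ : X.obj (op n)) (t : SimplexPt n) :
    cylinderHomotopy G (0, realPoint σ t) =
      G (realPoint (X := Δ[1] ⊗ X) (constSimplex n 0, σ) t) := by
  refine cylinderHomotopy_const G σ t 0 0 fun i => ?_
  obtain rfl | rfl := Fin.exists_fin_two.1 ⟨i, rfl⟩ <;> simp [edgePoint_apply_zero, edgePoint_apply_one]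

theorem cylinderHomotopy_one {X : SSet.{u}} {Z : TopCat.{u}}
    (G : SSet.toTop.obj (Δ[1] ⊗ X) ⟶ Z) {n : SimplexCategory} (σ : X.obj (op n)) (t : SimplexPt n) :
    cylinderHomotopy G (1, realPoint σ t) =
      G (realPoint (X := Δ[1] ⊗ X) (constSimplex n 1, σ) t) := by
  refine cylinderHomotopy_const G σ t 1 1 fun i => ?_
  obtain rfl | rfl := Fin.exists_fin_two.1 ⟨i, rfl⟩ <;> simp [edgePoint_apply_zero, edgePoint_apply_one]

theorem cylinderHomotopy_eq {X : SSet.{u}} {Z : TopCat.{u}} (G : SSet.toTop.obj (Δ[1] ⊗ X) ⟶ Z)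
    (h : SSet.toTop.obj X → Z) (hG : ∀ (n : ℕ) (σ : (Δ[1] ⊗ X : SSet.{u}) _⦋n⦌)
      (t : SimplexPt ⦋n⦌), G (realPoint σ t) = h (realPoint σ.2 t)) (s : unitInterval) (x : SSet.toTop.obj X) :
    cylinderHomotopy G (s, x) = h x := by
  obtain ⟨n, σ, t, hz⟩ := exists_realPoint ((toTopProdHomeo Δ[1] X).symm
      ((⦋1⦌ : SimplexCategory).toTopHomeo.symm (edgePoint s), x))
  have hx : x = realPoint σ.2 t := by
    have := congrArg Prod.snd ((toTopProdHomeo Δ[1] X).symm_apply_eq.1 hz.symm)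
    exact this.trans (congrArg Prod.snd (toTopProd_realPoint _ _))
  rw [hx, ← hG, hz, ← hx]
  rfl

theorem cylinderHomotopy_map {A X : SSet.{u}} (f : A ⟶ X) {Z : TopCat.{u}}
    (G : SSet.toTop.obj (Δ[1] ⊗ X) ⟶ Z) (s : unitInterval) (a : SSet.toTop.obj A) :
    cylinderHomotopy G (s, SSet.toTop.map f a) =
      cylinderHomotopy (SSet.toTop.map (𝟙 Δ[1] ⊗ₘ f) ≫ G) (s, a) := by
  refine congrArg G ((toTopProdHomeo Δ[1] X).symm_apply_eq.2 ?_)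
  refine Eq.trans ?_ (toTopProd_map _ _ _).symm
  have : toTopProd Δ[1] A ((toTopProdHomeo Δ[1] A).symm
      ((⦋1⦌ : SimplexCategory).toTopHomeo.symm (edgePoint s), a)) = _ :=
    (toTopProdHomeo Δ[1] A).apply_symm_apply _
  rw [this, CategoryTheory.Functor.map_id]
  rfl

theorem homEquiv_symm_apply {X : SSet.{u}} {Z : TopCat.{u}} (F : X ⟶ TopCat.toSSet.obj Z)
    {n : SimplexCategory} (σ : X.obj (op n)) (t : SimplexPt n) :
    (sSetTopAdj.homEquiv X Z).symm F (realPoint σ t) = Z.toSSetObjEquiv _ (F.app _ σ) t := by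
  rw [← homEquiv_apply, Equiv.apply_symm_apply]

open modelCategoryQuillen in
-- The transpose is an extension problem into the singular complex of `Z`, which is Kan.
theorem exists_toTop_extension {K L : SSet.{u}} {i : K ⟶ L} (hi : anodyneExtensions i)
    {Z : TopCat.{u}} (f : SSet.toTop.obj K ⟶ Z) :
    ∃ g : SSet.toTop.obj L ⟶ Z, SSet.toTop.map i ≫ g = f := by
  have hZ := (isFibrant_iff (TopCat.toSSet.obj Z)).1 inferInstance
  have := hi _ ((fibration_iff _).1 hZ)
  have sq : CommSq (sSetTopAdj.homEquiv _ _ f) i (terminal.from _) (terminal.from _) :=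
    ⟨by subsingleton⟩
  refine ⟨(sSetTopAdj.homEquiv _ _).symm sq.lift, ?_⟩
  rw [← Adjunction.homEquiv_naturality_left_symm, sq.fac_left, Equiv.symm_apply_apply]

open Classical in
theorem exists_boundary_glue {X Z : SSet.{u}} (A : X.Subcomplex) (a b : X ⟶ Z)
    (hab : ∀ (n : SimplexCategoryᵒᵖ), ∀ x ∈ A.obj n, a.app n x = b.app n x) :
    ∃ F : (((∂Δ[1] : SSet.Subcomplex.{u} _).unionProd A : (Δ[1] ⊗ X).Subcomplex) : SSet.{u}) ⟶ Z,
      (∀ n x h, F.app (op n) ⟨(constSimplex n 0, x), h⟩ = a.app _ x) ∧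
      (∀ n x h, F.app (op n) ⟨(constSimplex n 1, x), h⟩ = b.app _ x) ∧
      ∀ n x, x.1.2 ∈ A.obj n → F.app n x = a.app n x.1.2 := by
  -- A simplex of the union either is constant in the direction of `Δ[1]` or lies over `A`, where
  -- `a` and `b` agree. So testing for constancy at `1` suffices.
  refine ⟨{ app := fun n => TypeCat.ofHom fun x =>
              if x.1.1 = constSimplex n.unop 1 then b.app n x.1.2 else a.app n x.1.2
            naturality := ?_ }, ?_, ?_, ?_⟩
  · intro n m φ
    ext x
    change (if Δ[1].map φ x.1.1 = _ then b.app m (X.map φ x.1.2) else a.app m (X.map φ x.1.2)) =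
      Z.map φ (if _ then _ else _)
    by_cases h : x.1.1 = constSimplex n.unop 1
    · rw [if_pos h, if_pos (by rw [h]; rfl), NatTrans.naturality_apply]
    · rw [if_neg h, ← NatTrans.naturality_apply]
      split_ifs with h'
      · refine (hab _ _ ?_).symm
        apply A.map φ
        obtain hx | hx := (Subcomplex.mem_unionProd_iff _ _ _).1 x.2
        · exact hx
        · exfalso
          apply h
          apply stdSimplex.objEquiv.injective
          ext k : 3
          by_contra hk
          refine hx fun j => ?_
          obtain rfl | rfl := Fin.exists_fin_two.1 ⟨j, rfl⟩
          · exact ⟨k, (Fin.exists_fin_two.1 ⟨_, rfl⟩).resolve_right hk⟩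
          · exact ⟨φ.unop 0, congrArg (fun y => stdSimplex.objEquiv y 0) h'⟩
      · rfl
  · intro n x h
    refine if_neg fun h' => ?_
    have := congrArg (fun y => stdSimplex.objEquiv y 0) h'
    exact Fin.zero_ne_one this
  · intro n x h
    exact if_pos rfl
  · intro n x hx
    change (if _ then _ else _) = _
    split_ifs
    · exact (hab _ _ hx).symm
    · rfl

/-- The realization of an anodyne inclusion is the inclusion of a strong deformation retract. -/
theorem hasRelCubeLift_of_anodyneExtensions {X : SSet.{u}} (A : X.Subcomplex)
    (hA : anodyneExtensions A.ι) : HasRelCubeLift (SSet.toTop.map A.ι).hom := by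
  -- The retraction extends the identity of `|A|`.
  obtain ⟨r, hr⟩ := exists_toTop_extension hA (𝟙 _)
  have hr' : ∀ x, r (SSet.toTop.map A.ι x) = x := fun x => congrArg (fun f => f x) hr
  let η := sSetTopAdj.homEquiv X (SSet.toTop.obj X)
  obtain ⟨F, hF0, hF1, hFA⟩ := exists_boundary_glue A (η (𝟙 _)) (η (r ≫ SSet.toTop.map A.ι))
    (fun n x hx => by
      apply (TopCat.toSSetObjEquiv _ n).injective
      ext t
      refine (homEquiv_apply _ _ _).trans (Eq.trans ?_ (homEquiv_apply _ _ _).symm)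
      have hx' : realPoint x t = SSet.toTop.map A.ι (realPoint (X := A) ⟨x, hx⟩ t) :=
        (toTop_map_realPoint (n := n.unop) A.ι ⟨x, hx⟩ t).symm
      change realPoint x t = SSet.toTop.map A.ι (r (realPoint x t))
      rw [hx', hr'])
  -- The identity at `0`, the retraction at `1` and the constant homotopy on `A` are defined on a
  -- subcomplex of the cylinder whose inclusion is again anodyne. An extension is the deformation.
  obtain ⟨G, hG⟩ := exists_toTop_extension (anodyneExtensions_unionProd_ι ∂Δ[1] A hA)
    ((sSetTopAdj.homEquiv _ _).symm F)
  have key : ∀ {n : SimplexCategory} (σ) (hσ : σ ∈ (Subcomplex.unionProd ∂Δ[1] A).obj (op n)) 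
      (t : SimplexPt n) (f : SSet.toTop.obj X ⟶ SSet.toTop.obj X),
      F.app _ ⟨σ, hσ⟩ = (η f).app _ σ.2 → G (realPoint σ t) = f (realPoint σ.2 t) := by
    intro n σ hσ t f h
    have h₁ := congrArg (fun k => k (realPoint (X := (∂Δ[1].unionProd A : SSet.{u})) ⟨σ, hσ⟩ t)) hG
    refine (congrArg G (toTop_map_realPoint _ _ _)).symm.trans (h₁.trans ?_)
    refine (homEquiv_symm_apply F _ t).trans (Eq.trans ?_ (homEquiv_apply f σ.2 t))
    rw [h]
  refine HasRelCubeLift.of_deformationRetract _ r.hom hr' ⟨⟨⟨cylinderHomotopy G, ?_, ?_⟩, ?_⟩⟩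
  · intro x
    obtain ⟨n, σ, t, rfl⟩ := exists_realPoint x
    refine (cylinderHomotopy_zero _ _ _).trans ?_
    exact key _ ((Subcomplex.mem_unionProd_iff _ _ _).2 (Or.inr (constSimplex_mem_boundary _ _))) t _ (hF0 _ _ _)
  · intro x
    obtain ⟨n, σ, t, rfl⟩ := exists_realPoint x
    refine (cylinderHomotopy_one _ _ _).trans ?_
    exact key _ ((Subcomplex.mem_unionProd_iff _ _ _).2 (Or.inr (constSimplex_mem_boundary _ _))) t _ (hF1 _ _ _)
  · rintro s _ ⟨x, rfl⟩
    refine (cylinderHomotopy_map _ _ _ _).trans ?_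
    refine cylinderHomotopy_eq _ (SSet.toTop.map A.ι) (fun n σ t => ?_) s x
    refine (congrArg G (toTop_map_realPoint _ _ _)).trans
      (Eq.trans ?_ (toTop_map_realPoint _ _ _).symm)
    exact key _ ((Subcomplex.mem_unionProd_iff _ _ _).2 (Or.inl σ.2.2)) t (𝟙 _) (hFA _ _ σ.2.2)

end SSet
end AnodyneRealization

/-! ### The coset complex and the homotopy colimit -/

noncomputable section CosetComplex

open Simplicial Limits CartesianMonoidalCategory

namespace SSet

section

variable {α : Type u} {H : Type u} [Group H] (Γ : Set α → Subgroup H)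

/-- The simplicial set of pairs consisting of a chain of subsets `c` and a simplex of the classifying
space of `H`, such that all the parts of it before the first index `j` with `c j = univ` are in the
subgroups indexed by the members of the chain. -/
def cosetComplex : (nerve (Set α) ⊗ nerve (SingleObj H)).Subcomplex where
  obj n := {σ | ∀ (h i j : Fin (n.unop.len + 1)) (_ : h ≤ i) (hij : i ≤ j),
    σ.1.obj j ≠ Set.univ → (show H from σ.2.map (homOfLE hij)) ∈ Γ (σ.1.obj h)}
  map φ _ hσ _ _ _ hhi hij hj := hσ _ _ _ (φ.unop.toOrderHom.monotone hhi)
    (φ.unop.toOrderHom.monotone hij) hj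

/-- The part of the coset complex where the chain consists of proper subsets. -/
def properCosetComplex : (cosetComplex Γ : SSet.{u}).Subcomplex where
  obj n := {σ | σ.1.1.obj (Fin.last n.unop.len) ≠ Set.univ}
  map _ σ hσ h := hσ (Set.univ_subset_iff.1 (h.symm.subset.trans
    (leOfHom (σ.1.1.map (homOfLE (Fin.le_last _))))))

/-- The projection of the coset complex to the classifying space. -/
def cosetComplexProj : (cosetComplex Γ : SSet.{u}) ⟶ nerve (SingleObj H) :=
  (cosetComplex Γ).ι ≫ snd _ _

/-- The section of the projection given by the chains with all members equal to `univ`. -/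
def cosetComplexSection : nerve (SingleObj H) ⟶ (cosetComplex Γ : SSet.{u}) where
  app n := TypeCat.ofHom fun F => ⟨((CategoryTheory.Functor.const _).obj Set.univ, F),
    fun _ _ _ _ _ h => absurd rfl h⟩

open Classical in
/-- The homotopy which moves the members of a chain to `univ`. -/
def cosetComplexHomotopy : Δ[1] ⊗ (cosetComplex Γ : SSet.{u}) ⟶ (cosetComplex Γ : SSet.{u}) where
  app n := TypeCat.ofHom fun σ => ⟨(Monotone.functor
      (f := fun i => if stdSimplex.objEquiv σ.1 i = 0 then σ.2.1.1.obj i else Set.univ)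
      (fun i j hij => by
        have hm := (stdSimplex.objEquiv σ.1).toOrderHom.monotone hij
        dsimp only
        split_ifs with h₁ h₂ h₂
        · exact leOfHom (σ.2.1.1.map (homOfLE hij))
        · exact Set.subset_univ _
        · exact absurd (le_antisymm (hm.trans_eq h₂) (Fin.zero_le _)) h₁
        · exact le_rfl), σ.2.1.2),
    fun h i j hhi hij hj => by
      have h₁ : stdSimplex.objEquiv σ.1 j = 0 := by
        by_contra h₁
        exact hj (if_neg h₁)
      have h₂ : stdSimplex.objEquiv σ.1 h = 0 := le_antisymm
        (((stdSimplex.objEquiv σ.1).toOrderHom.monotone (hhi.trans hij)).trans_eq h₁)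
        (Fin.zero_le _)
      have := σ.2.2 h i j hhi hij (fun h => hj ((if_pos h₁).trans h))
      exact (congrArg Γ (if_pos h₂)).symm ▸ this⟩
  naturality _ _ _ := rfl

/-- `cosetComplexHomotopy` changes only the chain, not the simplex of the classifying space, so it
deforms the fibres onto the section. -/
theorem hasRelCubeLift_cosetComplexProj :
    HasRelCubeLift (SSet.toTop.map (cosetComplexProj Γ)).hom := by
  refine HasRelCubeLift.of_fibrewise_retraction _ (SSet.toTop.map (cosetComplexSection Γ)).hom
    (cylinderHomotopy (SSet.toTop.map (cosetComplexHomotopy Γ))) ?_ ?_ ?_ ?_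
  · intro y
    obtain ⟨n, σ, t, rfl⟩ := exists_realPoint y
    exact (congrArg _ (toTop_map_realPoint _ _ _)).trans (toTop_map_realPoint _ _ _)
  · intro x
    obtain ⟨n, σ, t, rfl⟩ := exists_realPoint x
    refine (cylinderHomotopy_zero _ _ _).trans ((toTop_map_realPoint _ _ _).trans ?_)
    rfl
  · intro x
    obtain ⟨n, σ, t, rfl⟩ := exists_realPoint x
    refine (cylinderHomotopy_one _ _ _).trans ((toTop_map_realPoint _ _ _).trans (Eq.trans ?_
      (congrArg _ (toTop_map_realPoint _ _ _)).symm))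
    refine Eq.trans ?_ (toTop_map_realPoint _ _ _).symm
    rfl
  · intro s x
    refine cylinderHomotopy_eq (SSet.toTop.map (cosetComplexHomotopy Γ) ≫
      SSet.toTop.map (cosetComplexProj Γ)) (SSet.toTop.map (cosetComplexProj Γ))
      (fun n σ t => ?_) s x
    exact (congrArg _ (toTop_map_realPoint _ _ _)).trans ((toTop_map_realPoint _ _ _).trans
      (toTop_map_realPoint (cosetComplexProj Γ) σ.2 t).symm)

end

section

variable {α : Type u} {G : Type u} [Group G] (Γ : Set α → Subgroup G) (hΓ : Monotone Γ)

/-- A monotone family of subgroups indexed by the power set of `α` as a functor to groups. -/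
def subgroupFunctor : Set α ⥤ GrpCat.{u} where
  obj I := GrpCat.of (Γ I)
  map f := GrpCat.ofHom (Subgroup.inclusion (hΓ (leOfHom f)))

/-- The subgroups indexed by subsets of `α`, as subgroups of the largest one. -/
def relSubgroup (I : Set α) : Subgroup (Γ Set.univ) := (Γ I).subgroupOf (Γ Set.univ)

/-- A constituent of the Bousfield-Kan formula for the homotopy colimit. -/
abbrev cubeIntegrand : (ProperSubset α)ᵒᵖ ⥤ ProperSubset α ⥤ TopCat.{u} :=
  hocolimIntegrand (ProperSubset.incl α ⋙ subgroupFunctor Γ hΓ ⋙ classifyingSpace)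

/-- The legs of the identification of the homotopy colimit with a coset complex. -/
def cosetComplexLeg (j : ProperSubset α) :
    nerve (Under j) ⊗ nerve (SingleObj (Γ j.1)) ⟶
      (properCosetComplex (relSubgroup Γ) : SSet.{u}) where
  app n := TypeCat.ofHom fun σ => ⟨⟨(σ.1 ⋙ Under.forget j ⋙ ProperSubset.incl α,
    σ.2 ⋙ SingleObj.mapHom _ _ (Subgroup.inclusion (hΓ (Set.subset_univ j.1)))),
    fun h i k _ hij _ => hΓ (leOfHom (σ.1.obj h).hom) (σ.2.map (homOfLE hij)).2⟩,
    (σ.1.obj (Fin.last _)).right.2⟩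

instance isThin_under (j : ProperSubset α) : Quiver.IsThin (Under j) := fun _ _ =>
  ⟨fun _ _ => Under.UnderMorphism.ext (Subsingleton.elim _ _)⟩

/-- The vertices of the simplices of the nerve of the poset of proper subsets above `j`. -/
def underVertexMap (j : ProperSubset α) : VertexMap (nerve (Under j)) (Set α) :=
  VertexMap.ofNerve (fun x => x.right.1) (fun x y h => by
    have h : x.right = y.right := Subtype.ext h
    obtain ⟨⟨⟨⟩⟩, x, f⟩ := x
    obtain ⟨⟨⟨⟩⟩, y, g⟩ := y
    obtain rfl : x = y := h
    obtain rfl : f = g := Subsingleton.elim (α := j ⟶ x) f g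
    rfl) (fun f => leOfHom f.right)

/-- Together with the Hausdorff property this makes the realization locally compact, so that it can
be multiplied with a classifying space before or after realization. -/
instance finite_nerve_under [Finite α] (j : ProperSubset α) : (nerve (Under j)).Finite :=
  (underVertexMap j).finite

instance t2Space_nerve_under [Finite α] (j : ProperSubset α) :
    T2Space (SSet.toTop.obj (nerve (Under j))) :=
  (underVertexMap j).t2Space

/-- The realization of the legs. -/
def realLeg [Finite α] (j : ProperSubset α) : ((cubeIntegrand Γ hΓ).obj (op j)).obj j ⟶
    SSet.toTop.obj (properCosetComplex (relSubgroup Γ) : SSet.{u}) :=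
  TopCat.ofHom ⟨_, (toTopProdHomeo (nerve (Under j)) (nerve (SingleObj (Γ j.1)))).symm.continuous⟩ ≫
    SSet.toTop.map (cosetComplexLeg Γ hΓ j)

theorem realLeg_realPoint [Finite α] (j : ProperSubset α) {n : SimplexCategory}
    (χ : (nerve (Under j)).obj (op n)) (F : (nerve (SingleObj (Γ j.1))).obj (op n))
    (t : SimplexPt n) :
    realLeg Γ hΓ j (realPoint χ t, realPoint F t) =
      realPoint ((cosetComplexLeg Γ hΓ j).app _ (χ, F)) t := by
  refine Eq.trans (congrArg (SSet.toTop.map (cosetComplexLeg Γ hΓ j)) ?_)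
    (toTop_map_realPoint _ _ _)
  exact (Homeomorph.symm_apply_eq _).2 (toTopProd_realPoint (X := nerve (Under j)) (χ, F) t).symm

/-- A point of a constituent of the homotopy colimit. -/
def cubePoint {i j : ProperSubset α} {n : SimplexCategory} (χ : (nerve (Under j)).obj (op n))
    (F : (nerve (SingleObj (Γ i.1))).obj (op n)) (t : SimplexPt n) :
    ((cubeIntegrand Γ hΓ).obj (op j)).obj i :=
  (realPoint χ t, realPoint F t)

theorem exists_cubePoint [Finite α] {i j : ProperSubset α} (x : ((cubeIntegrand Γ hΓ).obj (op j)).obj i) :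
    ∃ (n : ℕ) (χ : (nerve (Under j)) _⦋n⦌) (F : (nerve (SingleObj (Γ i.1))) _⦋n⦌)
      (t : SimplexPt ⦋n⦌), x = cubePoint Γ hΓ χ F t := by
  obtain ⟨z, rfl⟩ := (toTopProdHomeo (nerve (Under j)) (nerve (SingleObj (Γ i.1)))).surjective x
  obtain ⟨n, σ, t, rfl⟩ := exists_realPoint z
  exact ⟨n, σ.1, σ.2, t, toTopProd_realPoint _ _⟩

theorem cubeIntegrand_map_app {i j : ProperSubset α} (f : i ⟶ j) {n : SimplexCategory}
    (χ : (nerve (Under j)).obj (op n)) (F : (nerve (SingleObj (Γ i.1))).obj (op n))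
    (t : SimplexPt n) :
    ((cubeIntegrand Γ hΓ).map f.op).app i (cubePoint Γ hΓ χ F t) =
      cubePoint Γ hΓ (j := i) ((nerveMap (Under.map f)).app _ χ) F t :=
  Prod.ext (toTop_map_realPoint _ _ _) rfl

theorem cubeIntegrand_obj_map {i j : ProperSubset α} (f : i ⟶ j) {n : SimplexCategory}
    (χ : (nerve (Under j)).obj (op n)) (F : (nerve (SingleObj (Γ i.1))).obj (op n))
    (t : SimplexPt n) :
    ((cubeIntegrand Γ hΓ).obj (op j)).map f (cubePoint Γ hΓ χ F t) =
      cubePoint Γ hΓ (i := j) χ ((nerveMap (SingleObj.mapHom _ _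
        (Subgroup.inclusion (hΓ (leOfHom f))))).app _ F) t :=
  Prod.ext rfl (toTop_map_realPoint _ _ _)

theorem cosetComplexLeg_condition {i j : ProperSubset α} (f : i ⟶ j) {n : SimplexCategory}
    (χ : (nerve (Under j)).obj (op n)) (F : (nerve (SingleObj (Γ i.1))).obj (op n)) :
    (cosetComplexLeg Γ hΓ i).app (op n) ((nerveMap (Under.map f)).app _ χ, F) =
      (cosetComplexLeg Γ hΓ j).app (op n) (χ, (nerveMap (SingleObj.mapHom _ _
        (Subgroup.inclusion (hΓ (leOfHom f))))).app _ F) :=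
  rfl

theorem realLeg_condition [Finite α] ⦃i j : ProperSubset α⦄ (f : i ⟶ j) :
    ((cubeIntegrand Γ hΓ).map f.op).app i ≫ realLeg Γ hΓ i =
      ((cubeIntegrand Γ hΓ).obj (op j)).map f ≫ realLeg Γ hΓ j := by
  ext x
  obtain ⟨n, χ, F, t, rfl⟩ := exists_cubePoint Γ hΓ x
  refine (congrArg (realLeg Γ hΓ i) (cubeIntegrand_map_app Γ hΓ f χ F t)).trans
    (Eq.trans ?_ (congrArg (realLeg Γ hΓ j) (cubeIntegrand_obj_map Γ hΓ f χ F t)).symm)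
  refine (realLeg_realPoint Γ hΓ i _ _ t).trans (Eq.trans ?_ (realLeg_realPoint Γ hΓ j _ _ t).symm)
  rw [cosetComplexLeg_condition]

/-- The comparison map from the homotopy colimit to the realization of the coset complex. -/
def hocolimToCosetComplex [Finite α] :
    hocolim (ProperSubset.incl α ⋙ subgroupFunctor Γ hΓ ⋙ classifyingSpace) ⟶
      SSet.toTop.obj (properCosetComplex (relSubgroup Γ) : SSet.{u}) :=
  coend.desc (realLeg Γ hΓ) (realLeg_condition Γ hΓ)

theorem ι_hocolimToCosetComplex [Finite α] (j : ProperSubset α) :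
    coend.ι (cubeIntegrand Γ hΓ) j ≫ hocolimToCosetComplex Γ hΓ = realLeg Γ hΓ j :=
  coend.ι_desc _ _ _

variable {Γ hΓ}

theorem coend_ι_cubePoint {i j : ProperSubset α} (f : i ⟶ j) {n : SimplexCategory}
    (χ : (nerve (Under j)).obj (op n)) (F : (nerve (SingleObj (Γ i.1))).obj (op n))
    (t : SimplexPt n) :
    coend.ι (cubeIntegrand Γ hΓ) i (cubePoint Γ hΓ ((nerveMap (Under.map f)).app _ χ) F t) =
      coend.ι (cubeIntegrand Γ hΓ) j (cubePoint Γ hΓ χ ((nerveMap (SingleObj.mapHom _ _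
        (Subgroup.inclusion (hΓ (leOfHom f))))).app _ F) t) := by
  rw [← cubeIntegrand_map_app, ← cubeIntegrand_obj_map]
  exact congrArg (fun k => k (cubePoint Γ hΓ χ F t)) (coend.condition (cubeIntegrand Γ hΓ) f)

section Inverse

variable {n : SimplexCategory} (σ : (properCosetComplex (relSubgroup Γ) : SSet.{u}).obj (op n))

/-- The members of the chain of a simplex. -/
def properMember (i : Fin (n.len + 1)) : ProperSubset α :=
  ⟨σ.1.1.1.obj i, fun h => σ.2 (Set.univ_subset_iff.1 (h.symm.subset.trans
    (leOfHom (σ.1.1.1.map (homOfLE (Fin.le_last i))))))⟩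

theorem properMember_mono {i j : Fin (n.len + 1)} (h : i ≤ j) :
    properMember σ i ≤ properMember σ j :=
  leOfHom (σ.1.1.1.map (homOfLE h))

/-- The chain of a simplex, as a chain of subsets larger than its least element. -/
def underChain : (nerve (Under (properMember σ 0))).obj (op n) where
  obj (i : Fin (n.len + 1)) := Under.mk (homOfLE (properMember_mono σ (Fin.zero_le i)))
  map f := Under.homMk (homOfLE (properMember_mono σ (leOfHom f))) (Subsingleton.elim _ _)
  map_id _ := Subsingleton.elim _ _
  map_comp _ _ := Subsingleton.elim _ _

/-- The values of the cocycle of a simplex. -/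
def cocycleMap {i j : Fin (n.len + 1)} (f : i ⟶ j) : G :=
  ((show Γ Set.univ from σ.1.1.2.map f) : Γ Set.univ).1

/-- The second component of a simplex, as a simplex of the classifying space of the smallest
subgroup. -/
def restrictCocycle : (nerve (SingleObj (Γ (properMember σ 0).1))).obj (op n) where
  obj _ := SingleObj.star _
  map f := ⟨cocycleMap σ f,
    σ.1.2 0 _ _ (Fin.zero_le _) (leOfHom f) (properMember σ _).2⟩
  map_id i := Subtype.ext (congrArg (fun g : Γ Set.univ => (g : G)) (σ.1.1.2.map_id i))
  map_comp f g := Subtype.ext (congrArg (fun g : Γ Set.univ => (g : G)) (σ.1.1.2.map_comp f g))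

end Inverse

variable (Γ hΓ) in
/-- The inverse of the comparison map. -/
def cosetComplexToHocolim : SSet.toTop.obj (properCosetComplex (relSubgroup Γ) : SSet.{u}) ⟶
    hocolim (ProperSubset.incl α ⋙ subgroupFunctor Γ hΓ ⋙ classifyingSpace) :=
  realLift (fun n σ => ⟨fun t => coend.ι (cubeIntegrand Γ hΓ) (properMember σ 0)
      (cubePoint Γ hΓ (underChain σ) (restrictCocycle σ) t),
    (coend.ι (cubeIntegrand Γ hΓ) (properMember σ 0)).hom.continuous.comp
      ((continuous_realPoint _).prodMk (continuous_realPoint _))⟩) (by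
    intro n m φ σ t
    change coend.ι (cubeIntegrand Γ hΓ) _ _ = coend.ι (cubeIntegrand Γ hΓ) _ _
    -- Passing to a face can enlarge the least member of the chain. The coend relation along `f`
    -- compensates for the change of index.
    let f : properMember σ 0 ⟶ properMember σ (φ 0) := homOfLE (properMember_mono σ (Fin.zero_le _))
    refine (coend_ι_cubePoint f (underChain ((properCosetComplex (relSubgroup Γ) :
      SSet.{u}).map φ.op σ)) ((nerve (SingleObj (Γ (properMember σ 0).1))).map φ.op
        (restrictCocycle σ)) t).symm.trans ?_
    refine congrArg _ (Prod.ext (realPoint_map φ (underChain σ) t)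
      (realPoint_map φ (restrictCocycle σ) t)))

theorem cosetComplexToHocolim_realPoint {n : SimplexCategory}
    (σ : (properCosetComplex (relSubgroup Γ) : SSet.{u}).obj (op n)) (t : SimplexPt n) :
    cosetComplexToHocolim Γ hΓ (realPoint σ t) = coend.ι (cubeIntegrand Γ hΓ) (properMember σ 0)
      (cubePoint Γ hΓ (underChain σ) (restrictCocycle σ) t) :=
  realLift_realPoint _ _ σ t

variable (Γ hΓ) in
/-- The homotopy colimit is the realization of the coset complex. -/
def hocolimIso [Finite α] : hocolim (ProperSubset.incl α ⋙ subgroupFunctor Γ hΓ ⋙ classifyingSpace) ≅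
    SSet.toTop.obj (properCosetComplex (relSubgroup Γ) : SSet.{u}) where
  hom := hocolimToCosetComplex Γ hΓ
  inv := cosetComplexToHocolim Γ hΓ
  hom_inv_id := by
    refine coend.hom_ext fun j => ?_
    refine (Category.assoc _ _ _).symm.trans ?_
    refine (congrArg (· ≫ _) (ι_hocolimToCosetComplex Γ hΓ j)).trans ?_
    refine Eq.trans ?_ (Category.comp_id (coend.ι (cubeIntegrand Γ hΓ) j)).symm
    ext x
    obtain ⟨n, χ, F, t, rfl⟩ := exists_cubePoint Γ hΓ x
    refine (congrArg (cosetComplexToHocolim Γ hΓ) (realLeg_realPoint Γ hΓ j χ F t)).trans ?_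
    refine (cosetComplexToHocolim_realPoint _ _).trans ?_
    let σ := (cosetComplexLeg Γ hΓ j).app (op ⦋n⦌) (χ, F)
    -- The inverse places a point at the least member of its chain, which may be larger than `j`;
    -- the coend relation identifies the two.
    let f : j ⟶ properMember σ 0 := (χ.obj 0).hom
    refine (coend_ι_cubePoint f (underChain σ) F t).symm.trans ?_
    congr 2
  inv_hom_id := by
    refine toTop_hom_ext fun n σ t => ?_
    refine (congrArg (hocolimToCosetComplex Γ hΓ) (cosetComplexToHocolim_realPoint σ t)).trans ?_
    refine (congrArg (fun k => k (cubePoint Γ hΓ (underChain σ) (restrictCocycle σ) t))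
      (ι_hocolimToCosetComplex Γ hΓ (properMember σ 0))).trans ?_
    exact realLeg_realPoint Γ hΓ _ _ _ t

variable (Γ hΓ) in
/-- The canonical map from the homotopy colimit is the composite of an inclusion of coset complexes
and of the projection to the classifying space. -/
theorem hocolimDesc_eq [Finite α] :
    hocolimDesc (powerSetCocone (subgroupFunctor Γ hΓ ⋙ classifyingSpace)) =
      (hocolimIso Γ hΓ).hom ≫ SSet.toTop.map (properCosetComplex (relSubgroup Γ)).ι ≫
        SSet.toTop.map (cosetComplexProj (relSubgroup Γ)) := by
  refine coend.hom_ext fun j => ?_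
  refine (coend.ι_desc _ _ j).trans (Eq.trans ?_ (Category.assoc _ _ _))
  refine Eq.trans ?_ (congrArg (· ≫ _) (ι_hocolimToCosetComplex Γ hΓ j)).symm
  ext x
  obtain ⟨n, χ, F, t, rfl⟩ := exists_cubePoint Γ hΓ x
  refine (toTop_map_realPoint (nerveMap (SingleObj.mapHom _ _
    (Subgroup.inclusion (hΓ (Set.subset_univ j.1))))) F t).trans ?_
  have := realLeg_realPoint Γ hΓ j χ F t
  refine Eq.trans ?_ (congrArg (SSet.toTop.map (properCosetComplex (relSubgroup Γ)).ι ≫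
    SSet.toTop.map (cosetComplexProj (relSubgroup Γ))) this).symm
  have h₁ := toTop_map_realPoint (properCosetComplex (relSubgroup Γ)).ι
    ((cosetComplexLeg Γ hΓ j).app _ (χ, F)) t
  have h₂ := toTop_map_realPoint (cosetComplexProj (relSubgroup Γ))
    ((cosetComplexLeg Γ hΓ j).app _ (χ, F)).1 t
  exact ((congrArg (SSet.toTop.map (cosetComplexProj (relSubgroup Γ))) h₁).trans h₂).symm

variable (Γ hΓ) in
/-- If the part of the coset complex where the chains consist of proper subsets is an anodyne
subcomplex, then the subgroups form a homotopy colimit diagram. -/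
theorem isHomotopyColimitDiagram_of_anodyneExtensions [Finite α]
    (h : anodyneExtensions (properCosetComplex (relSubgroup Γ)).ι) :
    IsHomotopyColimitDiagram (subgroupFunctor Γ hΓ ⋙ classifyingSpace) := by
  unfold IsHomotopyColimitDiagram IsHomotopyColimitCocone
  rw [hocolimDesc_eq]
  apply HasRelCubeLift.isWeakHomotopyEquiv
  exact ((hasRelCubeLift_cosetComplexProj _).comp (hasRelCubeLift_of_anodyneExtensions _ h)).comp
    (HasRelCubeLift.of_homeomorph (TopCat.homeoOfIso (hocolimIso Γ hΓ)))

end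

end SSet
end CosetComplex

/-! ### Ranked pairings, and simplices of the coset complex as lists of vertices -/

section AnodynePairing

open Simplicial

namespace SSet

/-- Regularity of a pairing need only be tested between simplices of equal dimension, where the
ancestral relation says that the distinguished face of `s` is another codimension one face of `t`.
-/
theorem Subcomplex.PairingCore.anodyneExtensions_of_rank {X : SSet.{u}} {A : X.Subcomplex}
    (h : A.PairingCore) {β : Type w} [PartialOrder β] [WellFoundedLT β] (rank : h.ι → β)
    (hproper : ∀ (s : h.ι) (i : Fin (h.dim s + 2)),
      X.δ i (h.simplex s) = X.δ (h.index s) (h.simplex s) → i = h.index s)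
    (hrank : ∀ (s t : h.ι) (i : Fin (h.dim t + 2)), i ≠ h.index t →
      S.mk (X.δ (h.index s) (h.simplex s)) = S.mk (X.δ i (h.simplex t)) → rank s < rank t) :
    SSet.anodyneExtensions A.ι := by
  have : h.IsProper := ⟨fun s => (S.IsUniquelyCodimOneFace.iff _ _).2
    ⟨h.index s, rfl, fun i hi => hproper s i hi⟩⟩
  have hf : h.WeakRankFunction β :=
    { rank := rank
      lt := by
        rintro s t ⟨hst, hlt⟩ hd
        have hle : (h.type₂ s).toN ≤ (h.type₁ t).toN := hlt.le
        obtain ⟨f, hf, hf'⟩ := SSet.N.le_iff_exists_mono.1 hle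
        change ⦋h.dim s⦌ ⟶ ⦋h.dim t + 1⦌ at f
        change X.map f.op (h.simplex t) = X.δ (h.index s) (h.simplex s) at hf'
        -- The dimension is generalized so that the equality of dimensions can be substituted; the
        -- injection is then a coface map.
        have key : ∀ (d : ℕ) (f : ⦋d⦌ ⟶ ⦋h.dim t + 1⦌) (_ : Mono f) (x : X _⦋d⦌),
            d = h.dim t → X.map f.op (h.simplex t) = x →
            ∃ i, S.mk x = S.mk (X.δ i (h.simplex t)) := by
          rintro d f hf x rfl rfl
          obtain ⟨i, rfl⟩ := SimplexCategory.eq_δ_of_mono f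
          exact ⟨i, rfl⟩
        obtain ⟨i, hi⟩ := key _ f hf _ hd hf'
        refine hrank s t i ?_ hi
        rintro rfl
        exact hst (h.injective_type₂' hi) }
  have := hf.isRegular
  exact h.pairing.anodyneExtensions

variable {α : Type u} {H : Type u} [Group H] {Γ : Set α → Subgroup H}

/-- The members of the chain of a simplex of the coset complex. -/
def cosetMember {n : ℕ} (x : (cosetComplex Γ : SSet.{u}) _⦋n⦌) (i : Fin (n + 1)) : Set α :=
  x.1.1.obj i

/-- The values of the cocycle of a simplex of the coset complex. -/
def cosetCocycle {n : ℕ} (x : (cosetComplex Γ : SSet.{u}) _⦋n⦌) {i j : Fin (n + 1)} (h : i ≤ j) : H :=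
  x.1.2.map (homOfLE h)

theorem cosetCocycle_trans {n : ℕ} (x : (cosetComplex Γ : SSet.{u}) _⦋n⦌) {i j k : Fin (n + 1)}
    (h : i ≤ j) (h' : j ≤ k) :
    cosetCocycle x (h.trans h') = cosetCocycle x h' * cosetCocycle x h :=
  x.1.2.map_comp (homOfLE h) (homOfLE h')

theorem cosetCocycle_eq_one {n : ℕ} (x : (cosetComplex Γ : SSet.{u}) _⦋n⦌) {i j : Fin (n + 1)}
    (h : i ≤ j) (hij : i = j) : cosetCocycle x h = 1 := by
  subst hij
  exact x.1.2.map_id i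

theorem cosetComplex_ext {n : ℕ} {x y : (cosetComplex Γ : SSet.{u}) _⦋n⦌}
    (h₁ : ∀ i, cosetMember x i = cosetMember y i)
    (h₂ : ∀ {i j : Fin (n + 1)} (h : i ≤ j), cosetCocycle x h = cosetCocycle y h) : x = y := by
  refine Subtype.ext (Prod.ext ?_ ?_)
  · exact CategoryTheory.Functor.ext h₁ fun _ _ _ => Subsingleton.elim _ _
  · refine CategoryTheory.Functor.ext (fun _ => rfl) fun i j f => ?_
    exact (h₂ (leOfHom f)).trans ((Category.id_comp _).trans (Category.comp_id _)).symm

/-- The simplex of the coset complex with given members and vertices. -/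
def cosetMk {n : ℕ} (w : Fin (n + 1) → Set α × H) (hw : Monotone fun i => (w i).1)
    (hw' : ∀ h i j, h ≤ i → i ≤ j → (w j).1 ≠ Set.univ → (w j).2 * (w i).2⁻¹ ∈ Γ (w h).1) :
    (cosetComplex Γ : SSet.{u}) _⦋n⦌ :=
  ⟨(hw.functor,
    { obj := fun _ => SingleObj.star H
      map := fun {i j} _ => (w j).2 * (w i).2⁻¹
      map_id := fun _ => mul_inv_cancel _
      map_comp := fun _ _ => by
        change _ = (_ * _) * (_ * _)
        group }), fun h i j hhi hij => hw' h i j hhi hij⟩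

/-- The cocycle records only the quotients `(w j).2 * (w i).2⁻¹`, which leaves a common right
translation undetermined. -/
theorem eq_of_cosetMk_eq {n : ℕ} {w w' : Fin (n + 1) → Set α × H} {hw hw' hv hv'}
    (h : (cosetMk w hw hw' : (cosetComplex Γ : SSet.{u}) _⦋n⦌) = cosetMk w' hv hv') :
    ∃ g : H, ∀ i, w' i = ((w i).1, (w i).2 * g) := by
  refine ⟨(w 0).2⁻¹ * (w' 0).2, fun i => Prod.ext ?_ ?_⟩
  · exact congrArg (cosetMember · i) h.symm
  · have : (w i).2 * (w 0).2⁻¹ = (w' i).2 * (w' 0).2⁻¹ :=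
      congrArg (cosetCocycle · (Fin.zero_le i)) h
    simp [← mul_assoc, this]

theorem exists_eq_cosetMk {n : ℕ} (x : (cosetComplex Γ : SSet.{u}) _⦋n⦌) (k : Fin (n + 1)) :
    ∃ w hw hw', x = cosetMk w hw hw' ∧ (w k).2 = 1 := by
  have hx : ∀ {i j : Fin (n + 1)} (h : i ≤ j), cosetCocycle x h =
      (cosetCocycle x (Fin.zero_le j) * (cosetCocycle x (Fin.zero_le k))⁻¹) *
        (cosetCocycle x (Fin.zero_le i) * (cosetCocycle x (Fin.zero_le k))⁻¹)⁻¹ := by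
    intro i j h
    rw [cosetCocycle_trans x (Fin.zero_le i) h]
    group
  refine ⟨fun i => (cosetMember x i,
    cosetCocycle x (Fin.zero_le i) * (cosetCocycle x (Fin.zero_le k))⁻¹), ?_, ?_, ?_, ?_⟩
  · exact fun i j h => leOfHom (x.1.1.map (homOfLE h))
  · intro h i j hhi hij hj
    have := x.2 h i j hhi hij hj
    exact (hx hij).symm ▸ this
  · exact cosetComplex_ext (fun _ => rfl) fun h => hx h
  · exact mul_inv_cancel _

/-- A repeated vertex makes the simplex a degeneracy of one of its faces; conversely the `i`-th
degeneracy repeats the `i`-th vertex. -/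
theorem cosetMk_mem_degenerate_iff {n : ℕ} (w : Fin (n + 1) → Set α × H) (hw hw') :
    (cosetMk w hw hw' : (cosetComplex Γ : SSet.{u}) _⦋n⦌) ∈ (cosetComplex Γ : SSet.{u}).degenerate n ↔
      ∃ (k : ℕ) (hk : k + 1 < n + 1), w ⟨k, by omega⟩ = w ⟨k + 1, hk⟩ := by
  constructor
  · intro h
    obtain _ | n := n
    · simp at h
    rw [SSet.degenerate_eq_iUnion_range_σ] at h
    obtain ⟨i, y, hy⟩ := Set.mem_iUnion.1 h
    have hi : i.castSucc ≤ i.succ := Fin.castSucc_lt_succ.le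
    have h₀ : i.predAbove i.castSucc = i.predAbove i.succ := by simp
    have h₁ : cosetMember (cosetMk w hw hw') i.castSucc = cosetMember (cosetMk w hw hw') i.succ := by
      rw [← hy]
      exact congrArg (cosetMember y) h₀
    have h₂ : cosetCocycle (cosetMk w hw hw') hi = 1 := by
      rw [← hy]
      exact cosetCocycle_eq_one y (Fin.predAbove_right_monotone i hi) h₀
    exact ⟨i, by have := i.2; omega, Prod.ext h₁ (mul_inv_eq_one.1 h₂).symm⟩
  · rintro ⟨k, hk, h⟩
    obtain _ | n := n
    · omega
    let i : Fin (n + 1) := ⟨k, by omega⟩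
    have : (cosetComplex Γ : SSet.{u}).σ i ((cosetComplex Γ : SSet.{u}).δ i.castSucc
        (cosetMk w hw hw')) = cosetMk w hw hw' := by
      have key : ∀ j, w (i.castSucc.succAbove (i.predAbove j)) = w j := by
        intro j
        by_cases hj : j = i.castSucc
        · subst hj
          rw [Fin.predAbove_castSucc_self, Fin.succAbove_castSucc_self]
          exact h.symm
        · congr 1
          exact Fin.succAbove_predAbove hj
      refine cosetComplex_ext (fun j => congrArg Prod.fst (key j)) fun {j k} hjk => ?_
      change (w _).2 * (w _).2⁻¹ = (w k).2 * (w j).2⁻¹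
      rw [← key j, ← key k]
      rfl
    rw [← this]
    exact SSet.σ_mem_degenerate _ _ _

/-- Lists of vertices of simplices of the coset complex. -/
def IsCosetList (Γ : Set α → Subgroup H) (l : List (Set α × H)) : Prop :=
  (∀ (i j : ℕ) (_ : i ≤ j) (hj : j < l.length), l[i].1 ⊆ l[j].1) ∧
    ∀ (h i j : ℕ) (_ : h ≤ i) (_ : i ≤ j) (hj : j < l.length), l[j].1 ≠ Set.univ →
      l[j].2 * l[i].2⁻¹ ∈ Γ l[h].1

theorem IsCosetList.eraseIdx {l : List (Set α × H)} (hl : IsCosetList Γ l) (k : ℕ) :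
    IsCosetList Γ (l.eraseIdx k) := by
  have hk : ∀ i (hi : i < (l.eraseIdx k).length), (if i < k then i else i + 1) < l.length := by
    intro i hi
    rw [List.length_eraseIdx] at hi
    split_ifs at hi ⊢ <;> omega
  have key : ∀ i (hi : i < (l.eraseIdx k).length),
      (l.eraseIdx k)[i] = l[if i < k then i else i + 1]'(hk i hi) := by
    intro i hi
    rw [List.getElem_eraseIdx]
    split_ifs <;> rfl
  refine ⟨fun i j hij hj => ?_, fun h i j hhi hij hj hne => ?_⟩
  · rw [key i (hij.trans_lt hj), key j hj]
    exact hl.1 _ _ (by split_ifs <;> omega) _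
  · rw [key h (hhi.trans_lt (hij.trans_lt hj)), key i (hij.trans_lt hj), key j hj]
    rw [key j hj] at hne
    exact hl.2 _ _ _ (by split_ifs <;> omega) (by split_ifs <;> omega) _ hne

/-- The simplex of the coset complex with a given list of vertices. -/
def ofList (l : List (Set α × H)) (hl : IsCosetList Γ l) {n : ℕ} (hn : l.length = n + 1) :
    (cosetComplex Γ : SSet.{u}) _⦋n⦌ :=
  cosetMk (fun i => l[i.1]'(by omega)) (fun i j hij => hl.1 i j hij _)
    (fun h i j hhi hij => hl.2 h i j hhi hij _)

theorem δ_ofList (l : List (Set α × H)) (hl : IsCosetList Γ l) {n : ℕ} (hn : l.length = n + 1 + 1)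
    (k : Fin (n + 2)) : (cosetComplex Γ : SSet.{u}).δ k (ofList l hl hn) =
      ofList (l.eraseIdx k) (hl.eraseIdx k)
        (by rw [List.length_eraseIdx_of_lt (by omega)]; omega) := by
  have key : ∀ i : Fin (n + 1), l[(k.succAbove i).1]'(by omega) =
      (l.eraseIdx k)[i.1]'(by rw [List.length_eraseIdx_of_lt (by omega)]; omega) := by
    intro i
    rw [List.getElem_eraseIdx]
    by_cases h : i.castSucc < k
    · have h' : i.1 < k.1 := h
      simp only [Fin.succAbove_of_castSucc_lt k i h, h', dif_pos, Fin.val_castSucc]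
    · have h' : ¬ i.1 < k.1 := h
      simp only [Fin.succAbove_of_le_castSucc k i (not_lt.1 h), h', dif_neg, not_false_eq_true,
        Fin.val_succ]
  refine cosetComplex_ext (fun i => congrArg Prod.fst (key i)) fun {i j} hij => ?_
  exact congrArg₂ (fun a b : Set α × H => b.2 * a.2⁻¹) (key i) (key j)

theorem ofList_mem_nonDegenerate_iff (l : List (Set α × H)) (hl : IsCosetList Γ l) {n : ℕ}
    (hn : l.length = n + 1) :
    ofList l hl hn ∈ (cosetComplex Γ : SSet.{u}).nonDegenerate n ↔ l.IsChain (· ≠ ·) := by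
  refine (SSet.mem_nonDegenerate_iff_notMem_degenerate _ _).trans
    ((not_congr (cosetMk_mem_degenerate_iff _ _ _)).trans ?_)
  rw [List.isChain_iff_getElem]
  push Not
  exact forall_congr' fun k => ⟨fun h hk => h (by omega), fun h hk => h (by omega)⟩

theorem ofList_mem_iff (l : List (Set α × H)) (hl : IsCosetList Γ l) {n : ℕ}
    (hn : l.length = n + 1) : ofList l hl hn ∈ (properCosetComplex Γ).obj (op ⦋n⦌) ↔
      (l[n]'(by omega)).1 ≠ Set.univ :=
  Iff.rfl

theorem eq_of_mk_ofList_eq {l l' : List (Set α × H)} {hl : IsCosetList Γ l}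
    {hl' : IsCosetList Γ l'} {n n' : ℕ} {hn : l.length = n + 1} {hn' : l'.length = n' + 1}
    (h : S.mk (ofList l hl hn) = S.mk (ofList l' hl' hn')) :
    ∃ g : H, l' = l.map fun e => (e.1, e.2 * g) := by
  obtain rfl := S.dim_eq_of_mk_eq h
  obtain ⟨g, hg⟩ := eq_of_cosetMk_eq ((S.ext_iff _ _).1 h)
  refine ⟨g, List.ext_getElem (by simp [hn, hn']) fun i h₁ h₂ => ?_⟩
  rw [List.getElem_map]
  exact hg ⟨i, by omega⟩

theorem exists_eq_ofList {n : ℕ} (x : (cosetComplex Γ : SSet.{u}) _⦋n⦌) (k : ℕ) (hk : k < n + 1) :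
    ∃ (l : List (Set α × H)) (hl : IsCosetList Γ l) (hn : l.length = n + 1),
      x = ofList l hl hn ∧ (l[k]'(by omega)).2 = 1 := by
  obtain ⟨w, hw, hw', rfl, h1⟩ := exists_eq_cosetMk x ⟨k, hk⟩
  refine ⟨List.ofFn w, ⟨fun i j hij hj => ?_, fun h i j hhi hij hj => ?_⟩, List.length_ofFn, ?_, ?_⟩
  · simp only [List.getElem_ofFn]
    exact hw hij
  · simp only [List.getElem_ofFn]
    exact hw' _ _ _ hhi hij
  · refine cosetComplex_ext (fun i => ?_) fun {i j} hij => ?_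
    · exact congrArg Prod.fst (List.getElem_ofFn (f := w) (i := i) (by rw [List.length_ofFn]; omega)).symm
    · exact congrArg₂ (fun a b : Set α × H => b.2 * a.2⁻¹)
        (List.getElem_ofFn (f := w) (i := i) (by rw [List.length_ofFn]; omega)).symm
        (List.getElem_ofFn (f := w) (i := j) (by rw [List.length_ofFn]; omega)).symm
  · rw [List.getElem_ofFn]
    exact h1

end SSet
end AnodynePairing

/-! ### The descent matching -/

section DescentPairing

open Simplicial

namespace SSet

variable {α : Type u} {H : Type u} [Group H]

/-- Minimal coset representatives and descent sets for a family of subgroups of `H`. -/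
structure DescentSystem (Γ : Set α → Subgroup H) where
  /-- The length function. -/
  len : H → ℕ
  /-- The descent sets. -/
  desc : H → Set α
  mono : Monotone Γ
  -- The model is the shortest element `m` of the coset `Γ c * v`, with `desc` the left descent set.
  exists_min (c : Set α) (v : H) : ∃ m, v * m⁻¹ ∈ Γ c ∧ Disjoint (desc m) c
  len_lt (c : Set α) (m v : H) : v * m⁻¹ ∈ Γ c → Disjoint (desc m) c → v ≠ m → len m < len v
  desc_one : desc 1 = ∅
  eq_one (m : H) : desc m = ∅ → m = 1
  -- In a finite Coxeter group the longest element violates this.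
  desc_ne_univ (m : H) : desc m ≠ Set.univ

theorem _root_.List.exists_eraseIdx_eq {E : Type*} {l : List E} {i : ℕ} (hi : i < l.length) :
    ∃ L₁ e L₂, l = L₁ ++ e :: L₂ ∧ L₁.length = i ∧ l.eraseIdx i = L₁ ++ L₂ := by
  refine ⟨l.take i, l[i], l.drop (i + 1), by simp, by simp; omega, ?_⟩
  exact List.eraseIdx_eq_take_drop_succ l i

theorem _root_.List.IsChain.eraseIdx_injective {E : Type*} {l : List E} (hl : l.IsChain (· ≠ ·))
    {i j : ℕ} (hi : i < l.length) (hj : j < l.length) (h : l.eraseIdx i = l.eraseIdx j) :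
    i = j := by
  wlog hij : i < j generalizing i j
  · obtain h' | h' := (not_lt.1 hij).eq_or_lt
    · exact h'.symm
    · exact (this hj hi h.symm h').symm
  exfalso
  have h₁ : i < (l.eraseIdx i).length := by
    rw [List.length_eraseIdx_of_lt hi]
    omega
  have h₂ : i < (l.eraseIdx j).length := h ▸ h₁
  have : (l.eraseIdx i)[i] = (l.eraseIdx j)[i] := by simp only [h]
  rw [List.getElem_eraseIdx, List.getElem_eraseIdx] at this
  simp only [lt_irrefl, hij, dite_true, dite_false] at this
  exact List.isChain_iff_getElem.1 hl i (by omega) this.symm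

theorem _root_.List.exists_append_of_pred {E : Type*} (p : E → Prop) (l : List E) :
    ∃ P Q, l = P ++ Q ∧ (∀ e ∈ P, p e) ∧ (Q = [] ∨ ∃ q Q', Q = q :: Q' ∧ ¬ p q) := by
  induction l with
  | nil => exact ⟨[], [], rfl, by simp, Or.inl rfl⟩
  | cons e l ih =>
    by_cases he : p e
    · obtain ⟨P, Q, rfl, hP, hQ⟩ := ih
      exact ⟨e :: P, Q, rfl, by simpa [he] using hP, hQ⟩
    · exact ⟨[], e :: l, rfl, by simp, Or.inr ⟨e, l, rfl, he⟩⟩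

/-- The list of vertices of a simplex, normalized such that the first vertex where the chain is
`univ` corresponds to the unit. -/
def fullList (σ : List (Set α × H)) (τ : List H) : List (Set α × H) :=
  σ ++ (Set.univ, 1) :: τ.map fun v => (Set.univ, v)

theorem fullList_eq (σ : List (Set α × H)) (τ : List H) :
    fullList σ τ = σ ++ (1 :: τ).map fun v => (Set.univ, v) :=
  rfl

theorem length_fullList (σ : List (Set α × H)) (τ : List H) :
    (fullList σ τ).length = σ.length + τ.length + 1 := by
  simp [fullList, add_assoc]

/-- The first vertex with subset `univ` has second entry `1` in both lists, so the translation is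
trivial. -/
theorem fullList_eq_map {σ σ' : List (Set α × H)} {τ τ' : List H} {g : H}
    (hσ : ∀ e ∈ σ, e.1 ≠ Set.univ) (hσ' : ∀ e ∈ σ', e.1 ≠ Set.univ)
    (h : fullList σ' τ' = (fullList σ τ).map fun e => (e.1, e.2 * g)) : σ' = σ ∧ τ' = τ := by
  have key : ∀ (σ σ' l l' : List (Set α × H)) (x x' : Set α × H), (∀ e ∈ σ, e.1 ≠ Set.univ) →
      (∀ e ∈ σ', e.1 ≠ Set.univ) → x.1 = Set.univ → x'.1 = Set.univ →
      σ ++ x :: l = σ' ++ x' :: l' → σ = σ' ∧ x :: l = x' :: l' := by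
    intro σ
    induction σ with
    | nil =>
      rintro (_ | ⟨e, σ'⟩) l l' x x' - h' hx hx' h
      · exact ⟨rfl, h⟩
      · obtain ⟨rfl, -⟩ := List.cons.inj h
        exact absurd hx (h' _ (by simp))
    | cons e σ ih =>
      rintro (_ | ⟨e', σ'⟩) l l' x x' h₀ h' hx hx' h
      · obtain ⟨rfl, -⟩ := List.cons.inj h
        exact absurd hx' (h₀ _ (by simp))
      · rw [List.cons_append, List.cons_append] at h
        obtain ⟨rfl, h₁⟩ := List.cons.inj h
        obtain ⟨rfl, h₂⟩ := ih σ' l l' x x' (fun e he => h₀ e (by simp [he]))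
          (fun e he => h' e (by simp [he])) hx hx' h₁
        exact ⟨rfl, h₂⟩
  rw [fullList, fullList, List.map_append, List.map_cons] at h
  obtain ⟨h₁, h₂⟩ := key _ _ _ _ _ _ hσ' (by
    intro e he
    obtain ⟨f, hf, rfl⟩ := List.mem_map.1 he
    exact hσ f hf) rfl rfl h
  obtain ⟨h₂, h₃⟩ := List.cons.inj h₂
  have hg : g = 1 := by simpa using (congrArg Prod.snd h₂).symm
  subst hg
  refine ⟨by simpa using h₁, ?_⟩
  have := congrArg (List.map Prod.snd) h₃
  simpa [Function.comp_def] using this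

namespace DescentSystem

variable {Γ : Set α → Subgroup H} (𝒟 : DescentSystem Γ)

theorem min_unique {c : Set α} {m m' : H} (h : m' * m⁻¹ ∈ Γ c) (hm : Disjoint (𝒟.desc m) c)
    (hm' : Disjoint (𝒟.desc m') c) : m' = m := by
  by_contra hne
  have h₁ := 𝒟.len_lt c m m' h hm hne
  have h₂ := 𝒟.len_lt c m' m (by simpa using inv_mem h) hm' (Ne.symm hne)
  omega

/-- `m` is the minimal representative of the coset that contains the second components of `σ`. -/
def IsBase (m : H) (σ : List (Set α × H)) : Prop :=
  (σ = [] → m = 1) ∧ ∀ e l, σ = e :: l → Disjoint (𝒟.desc m) e.1 ∧ ∀ f ∈ σ, f.2 * m⁻¹ ∈ Γ e.1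

theorem isBase_nil {m : H} : 𝒟.IsBase m [] ↔ m = 1 := by simp [IsBase]

theorem isBase_cons {m : H} {e : Set α × H} {l : List (Set α × H)} : 𝒟.IsBase m (e :: l) ↔
    Disjoint (𝒟.desc m) e.1 ∧ ∀ f ∈ e :: l, f.2 * m⁻¹ ∈ Γ e.1 := by
  constructor
  · exact fun h => h.2 e l rfl
  · refine fun h => ⟨by simp, fun e' l' h' => ?_⟩
    obtain ⟨rfl, rfl⟩ := List.cons.inj h'
    exact h

variable {𝒟}

theorem IsBase.unique {m m' : H} {σ : List (Set α × H)} (h : 𝒟.IsBase m σ) (h' : 𝒟.IsBase m' σ) :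
    m' = m := by
  cases σ with
  | nil => exact (isBase_nil 𝒟 |>.1 h').trans ((isBase_nil 𝒟).1 h).symm
  | cons e l =>
    rw [isBase_cons] at h h'
    refine 𝒟.min_unique ?_ h.1 h'.1
    have := mul_mem (inv_mem (h'.2 e (by simp))) (h.2 e (by simp))
    simpa using this

variable (𝒟) in
/-- The conditions on the list of vertices of a nondegenerate simplex. -/
structure IsGood (m : H) (σ : List (Set α × H)) (τ : List H) : Prop where
  pairwise : σ.Pairwise fun e f => e.1 ⊆ f.1
  ne_univ : ∀ e ∈ σ, e.1 ≠ Set.univ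
  isChain : σ.IsChain (· ≠ ·)
  isBase : 𝒟.IsBase m σ
  isChain' : (1 :: τ).IsChain (· ≠ ·)

theorem IsGood.isCosetList {m : H} {σ : List (Set α × H)} {τ : List H} (h : 𝒟.IsGood m σ τ) :
    IsCosetList Γ (fullList σ τ) := by
  have hp : (fullList σ τ).Pairwise fun e f => e.1 ⊆ f.1 := by
    rw [fullList_eq, List.pairwise_append]
    refine ⟨h.pairwise, List.pairwise_map.2 (List.pairwise_of_forall fun _ _ => subset_rfl), ?_⟩
    intro e _ f hf
    obtain ⟨v, -, rfl⟩ := List.mem_map.1 hf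
    exact Set.subset_univ _
  have hp' : ∀ (i j : ℕ) (_ : i ≤ j) (hj : j < (fullList σ τ).length),
      (fullList σ τ)[i].1 ⊆ (fullList σ τ)[j].1 := by
    intro i j hij hj
    obtain rfl | hij := hij.eq_or_lt
    · exact subset_rfl
    · exact List.pairwise_iff_getElem.1 hp i j _ hj hij
  refine ⟨hp', fun k i j hki hij hj hne => ?_⟩
  have hjσ : j < σ.length := by
    by_contra hjσ
    simp only [fullList_eq] at hne
    rw [List.getElem_append_right (not_lt.1 hjσ), List.getElem_map] at hne
    exact hne rfl
  have key : ∀ i (hi : i < σ.length), (fullList σ τ)[i]'(by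
      rw [length_fullList]; omega) = σ[i] := fun i hi => List.getElem_append_left hi
  have h0 := hp' 0 k (Nat.zero_le _) (by omega)
  rw [key 0 (by omega), key k (by omega)] at h0
  rw [key i (by omega), key j hjσ, key k (by omega)]
  obtain _ | ⟨e, l⟩ := σ
  · simp at hjσ
  have hb := ((isBase_cons 𝒟).1 h.isBase).2
  have := mul_mem (hb _ (List.getElem_mem hjσ))
    (inv_mem (hb _ (List.getElem_mem (hij.trans_lt hjσ))))
  exact 𝒟.mono h0 (by simpa using this)

theorem IsGood.isChain_fullList {m : H} {σ : List (Set α × H)} {τ : List H}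
    (h : 𝒟.IsGood m σ τ) : (fullList σ τ).IsChain (· ≠ ·) := by
  rw [fullList_eq, List.isChain_append]
  refine ⟨h.isChain, (List.isChain_map _).2 (h.isChain'.imp fun v w h h' =>
    h (congrArg Prod.snd h')), fun e he f hf hef => ?_⟩
  obtain rfl : (Set.univ, 1) = f := by simpa using hf
  exact h.ne_univ e (List.mem_of_getLast? he) (by rw [hef])

variable (𝒟) in
/-- The list `P ++ Q` is paired with the list `P ++ a :: Q`. -/
def IsPivot (m : H) (P Q : List (Set α × H)) (a : Set α × H) : Prop :=
  -- The chain of group elements leaves `m` at `q`: a copy of `q` with second entry `m` goes in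
  -- front of it.
  ((∀ e ∈ P, e.2 = m) ∧ ∃ q Q', Q = q :: Q' ∧ q.2 ≠ m ∧ a = (q.1, m)) ∨
  -- All second entries are `m`: the subsets leave `desc m` at `q`, or never do, in which case `desc
  -- m` itself is appended.
  ((∀ e ∈ P ++ Q, e.2 = m) ∧ (∀ e ∈ P, e.1 ⊆ 𝒟.desc m) ∧
    ((Q = [] ∧ a = (𝒟.desc m, m)) ∨
      ∃ q Q', Q = q :: Q' ∧ ¬ q.1 ⊆ 𝒟.desc m ∧ a = (q.1 ∩ 𝒟.desc m, m)))

variable (𝒟) in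
theorem exists_isPivot (m : H) (σ : List (Set α × H)) :
    ∃ P Q a, σ = P ++ Q ∧ 𝒟.IsPivot m P Q a := by
  obtain ⟨P, Q, rfl, hP, hQ⟩ := List.exists_append_of_pred (fun e : Set α × H => e.2 = m) σ
  obtain rfl | ⟨q, Q, rfl, hq⟩ := hQ
  · obtain ⟨P', Q', rfl, hP', hQ'⟩ := List.exists_append_of_pred
      (fun e : Set α × H => e.1 ⊆ 𝒟.desc m) P
    obtain rfl | ⟨q, Q', rfl, hq⟩ := hQ'
    · exact ⟨P', [], _, by simp, Or.inr ⟨by simpa using hP, hP', Or.inl ⟨rfl, rfl⟩⟩⟩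
    · exact ⟨P', q :: Q', _, by simp, Or.inr ⟨hP, hP', Or.inr ⟨q, Q', rfl, hq, rfl⟩⟩⟩
  · exact ⟨P, q :: Q, _, rfl, Or.inl ⟨hP, q, Q, rfl, hq, rfl⟩⟩

namespace IsPivot

variable {m : H} {P Q P' Q' : List (Set α × H)} {a a' : Set α × H}

theorem snd_eq (h : 𝒟.IsPivot m P Q a) {e : Set α × H} (he : e ∈ P ++ [a]) : e.2 = m := by
  rw [List.mem_append, List.mem_singleton] at he
  obtain he | rfl := he
  · obtain h | h := h
    · exact h.1 e he
    · exact h.1 e (List.mem_append_left _ he)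
  · obtain ⟨-, q, Q', -, -, rfl⟩ | ⟨-, -, ⟨-, rfl⟩ | ⟨q, Q', -, -, rfl⟩⟩ := h <;> rfl

/-- At the earlier position `x` is the first vertex violating the condition on the initial part; at
the later position it belongs to the initial part and must satisfy it. So a list has only one pivot
position. -/
theorem false_of_prefix {x : Set α × H} (h : 𝒟.IsPivot m P (x :: Q) a)
    (h' : 𝒟.IsPivot m (P ++ x :: Q') P' a') (hQ : Q = Q' ++ P') : False := by
  subst hQ
  obtain ⟨-, q, _, hq, hq', -⟩ | ⟨h₁, -, ⟨h₂, -⟩ | ⟨q, _, hq, hq', -⟩⟩ := h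
  · obtain ⟨rfl, -⟩ := List.cons.inj hq
    exact hq' (h'.snd_eq (by simp))
  · cases h₂
  · obtain ⟨rfl, -⟩ := List.cons.inj hq
    obtain ⟨-, r, R, rfl, hr, -⟩ | ⟨-, h₃, -⟩ := h'
    · exact hr (h₁ r (by simp))
    · exact hq' (h₃ x (by simp))

theorem right_unique (h : 𝒟.IsPivot m P Q a) (h' : 𝒟.IsPivot m P Q a') : a = a' := by
  obtain ⟨h₁, q, Q, rfl, hq, rfl⟩ | ⟨h₁, -, ⟨rfl, rfl⟩ | ⟨q, Q, rfl, -, rfl⟩⟩ := h <;>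
  obtain ⟨h₂, r, R, hr, hr', rfl⟩ | ⟨h₂, -, ⟨hr, rfl⟩ | ⟨r, R, hr, -, rfl⟩⟩ := h' <;>
  simp_all only [List.cons.injEq, reduceCtorEq] <;>
  grind

theorem unique (h : 𝒟.IsPivot m P Q a) (h' : 𝒟.IsPivot m P' Q' a') (heq : P ++ Q = P' ++ Q') :
    P = P' ∧ Q = Q' ∧ a = a' := by
  obtain ⟨X, rfl, rfl⟩ | ⟨X, rfl, rfl⟩ := List.append_eq_append_iff.1 heq
  · cases X with
    | nil =>
      rw [List.append_nil] at h' ⊢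
      exact ⟨rfl, rfl, h.right_unique h'⟩
    | cons x X => exact (h.false_of_prefix h' rfl).elim
  · cases X with
    | nil =>
      rw [List.append_nil] at h ⊢
      exact ⟨rfl, rfl, h.right_unique h'⟩
    | cons x X => exact (h'.false_of_prefix h rfl).elim

theorem fst_subset (h : 𝒟.IsPivot m P Q a) (hPQ : (P ++ Q).Pairwise fun e f => e.1 ⊆ f.1) :
    ∀ e ∈ P, e.1 ⊆ a.1 := by
  intro e he
  have := List.pairwise_append.1 hPQ
  obtain ⟨-, q, Q', rfl, -, rfl⟩ | ⟨-, h₁, ⟨-, rfl⟩ | ⟨q, Q', rfl, -, rfl⟩⟩ := h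
  · exact this.2.2 e he q (by simp)
  · exact h₁ e he
  · exact Set.subset_inter (this.2.2 e he q (by simp)) (h₁ e he)

/-- The pivot condition is not affected by changes to the first part which preserve the
properties of its members. -/
theorem of_subset (h : 𝒟.IsPivot m P Q a) (hP : P' ⊆ P ++ [a]) : 𝒟.IsPivot m P' Q a := by
  have h₀ : ∀ e ∈ P', e.2 = m := fun e he => h.snd_eq (hP he)
  obtain ⟨-, h⟩ | ⟨h₁, h₂, h₃⟩ := h
  · exact Or.inl ⟨h₀, h⟩
  · refine Or.inr ⟨fun e he => ?_, fun e he => ?_, h₃⟩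
    · obtain he | he := List.mem_append.1 he
      · exact h₀ e he
      · exact h₁ e (List.mem_append_right _ he)
    · obtain he | he := List.mem_append.1 (hP he)
      · exact h₂ e he
      · obtain rfl := List.mem_singleton.1 he
        obtain ⟨-, rfl⟩ | ⟨q, Q', -, -, rfl⟩ := h₃
        · exact subset_rfl
        · exact Set.inter_subset_right

/-- The pivot condition is not affected by the removal of elements from the second part other than
its head. -/
theorem of_erase {q e : Set α × H} {Q₁ Q₂ : List (Set α × H)}
    (h : 𝒟.IsPivot m P (q :: (Q₁ ++ e :: Q₂)) a) : 𝒟.IsPivot m P (q :: (Q₁ ++ Q₂)) a := by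
  obtain ⟨h, q', Q', hq, hq', rfl⟩ | ⟨h₁, h₂, ⟨h₃, -⟩ | ⟨q', Q', hq, hq', rfl⟩⟩ := h
  · obtain ⟨rfl, -⟩ := List.cons.inj hq
    exact Or.inl ⟨h, q, _, rfl, hq', rfl⟩
  · cases h₃
  · obtain ⟨rfl, -⟩ := List.cons.inj hq
    refine Or.inr ⟨fun f hf => h₁ f ?_, h₂, Or.inr ⟨q, _, rfl, hq', rfl⟩⟩
    simp only [List.mem_append, List.mem_cons] at hf ⊢
    tauto

theorem ne_head {q : Set α × H} (h : 𝒟.IsPivot m P (q :: Q) a) : a ≠ q := by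
  rintro rfl
  obtain ⟨-, q', Q', hq, hq', -⟩ | ⟨-, -, ⟨hq, -⟩ | ⟨q', Q', hq, hq', ha⟩⟩ := id h
  · obtain ⟨rfl, -⟩ := List.cons.inj hq
    exact hq' (h.snd_eq (by simp))
  · cases hq
  · obtain ⟨rfl, -⟩ := List.cons.inj hq
    exact hq' (Set.inter_eq_left.1 (congrArg Prod.fst ha).symm)

theorem last_ne_head {p q : Set α × H} (h : 𝒟.IsPivot m P (q :: Q) a) (hp : p ∈ P) : p ≠ q := by
  rintro rfl
  obtain ⟨h₁, q', Q', hq, hq', -⟩ | ⟨-, h₂, ⟨hq, -⟩ | ⟨q', Q', hq, hq', ha⟩⟩ := h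
  · obtain ⟨rfl, -⟩ := List.cons.inj hq
    exact hq' (h₁ _ hp)
  · cases hq
  · obtain ⟨rfl, -⟩ := List.cons.inj hq
    exact hq' (h₂ _ hp)

theorem subset_fst (h : 𝒟.IsPivot m P Q a) (hQ : Q.Pairwise fun e f => e.1 ⊆ f.1) :
    ∀ f ∈ Q, a.1 ⊆ f.1 := by
  obtain ⟨-, q, Q', rfl, -, rfl⟩ | ⟨-, -, ⟨rfl, rfl⟩ | ⟨q, Q', rfl, -, rfl⟩⟩ := h
  · intro f hf
    obtain rfl | hf := List.mem_cons.1 hf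
    · exact subset_rfl
    · exact (List.pairwise_cons.1 hQ).1 f hf
  · simp
  · intro f hf
    refine Set.inter_subset_left.trans ?_
    obtain rfl | hf := List.mem_cons.1 hf
    · exact subset_rfl
    · exact (List.pairwise_cons.1 hQ).1 f hf

theorem fst_ne_univ (h : 𝒟.IsPivot m P Q a) (hQ : ∀ q ∈ Q, q.1 ≠ Set.univ) : a.1 ≠ Set.univ := by
  obtain ⟨-, q, Q', rfl, -, rfl⟩ | ⟨-, -, ⟨rfl, rfl⟩ | ⟨q, Q', rfl, -, rfl⟩⟩ := h
  · exact hQ q (by simp)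
  · exact 𝒟.desc_ne_univ m
  · exact fun h => 𝒟.desc_ne_univ m (Set.univ_subset_iff.1 (h ▸ Set.inter_subset_right))

end IsPivot

theorem IsBase.insert {m : H} {P Q : List (Set α × H)} {a : Set α × H}
    (h : 𝒟.IsBase m (P ++ Q)) (ha : 𝒟.IsPivot m P Q a) : 𝒟.IsBase m (P ++ a :: Q) := by
  have ham : a.2 * m⁻¹ = 1 := by rw [ha.snd_eq (by simp), mul_inv_cancel]
  obtain _ | ⟨e, P⟩ := P
  · rw [List.nil_append] at h ⊢
    rw [isBase_cons]
    obtain ⟨-, q, Q', rfl, -, rfl⟩ | ⟨h₁, -, ⟨rfl, rfl⟩ | ⟨q, Q', rfl, -, rfl⟩⟩ := id ha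
    · rw [isBase_cons] at h
      refine ⟨h.1, fun f hf => ?_⟩
      obtain rfl | hf := List.mem_cons.1 hf
      · rw [ham]
        exact one_mem _
      · exact h.2 f hf
    -- With no proper vertices the base is `1` by convention, and the inserted vertex is `(∅, 1)`.
    · obtain rfl := (isBase_nil 𝒟).1 h
      simp [𝒟.desc_one]
    · rw [isBase_cons] at h
      refine ⟨h.1.mono_right Set.inter_subset_left, fun f hf => ?_⟩
      obtain rfl | hf := List.mem_cons.1 hf
      · rw [ham]
        exact one_mem _
      · rw [h₁ f hf, mul_inv_cancel]
        exact one_mem _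
  · rw [List.cons_append, isBase_cons] at h ⊢
    refine ⟨h.1, fun f hf => ?_⟩
    by_cases hfa : f = a
    · rw [hfa, ham]
      exact one_mem _
    · refine h.2 f ?_
      simp only [List.mem_append, List.mem_cons] at hf ⊢
      tauto

theorem IsBase.erase {m : H} {P Q : List (Set α × H)} {a : Set α × H}
    (h : 𝒟.IsBase m (P ++ a :: Q)) (ha : 𝒟.IsPivot m P Q a) : 𝒟.IsBase m (P ++ Q) := by
  obtain _ | ⟨e, P⟩ := P
  · rw [List.nil_append] at h ⊢
    rw [isBase_cons] at h
    obtain ⟨-, q, Q', rfl, -, rfl⟩ | ⟨h₁, -, ⟨rfl, rfl⟩ | ⟨q, Q', rfl, -, rfl⟩⟩ := id ha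
    · exact (isBase_cons 𝒟).2 ⟨h.1, fun f hf => h.2 f (List.mem_cons_of_mem _ hf)⟩
    -- As head, `desc m` is disjoint from itself, so it is empty and `m = 1`, as the convention for
    -- the empty list demands.
    · exact (isBase_nil 𝒟).2 (𝒟.eq_one m (disjoint_self.1 h.1))
    · refine (isBase_cons 𝒟).2 ⟨?_, fun f hf => ?_⟩
      -- The head `q.1 ∩ desc m` is disjoint from `desc m`, so it is empty and `q.1` is disjoint
      -- from `desc m` as well.
      · have := h.1
        rw [Set.disjoint_left] at this ⊢
        exact fun x hx hx' => this hx ⟨hx', hx⟩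
      · rw [h₁ f hf, mul_inv_cancel]
        exact one_mem _
  · rw [List.cons_append, isBase_cons] at h ⊢
    refine ⟨h.1, fun f hf => h.2 f ?_⟩
    simp only [List.mem_append, List.mem_cons] at hf ⊢
    tauto

theorem IsGood.insert {m : H} {P Q : List (Set α × H)} {a : Set α × H} {τ : List H}
    (h : 𝒟.IsGood m (P ++ Q) τ) (ha : 𝒟.IsPivot m P Q a) (hne : ∀ P₀, P ≠ P₀ ++ [a]) :
    𝒟.IsGood m (P ++ a :: Q) τ where
  pairwise := by
    obtain ⟨h₁, h₂, h₃⟩ := List.pairwise_append.1 h.pairwise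
    refine List.pairwise_append.2 ⟨h₁, List.pairwise_cons.2 ⟨ha.subset_fst h₂, h₂⟩, ?_⟩
    intro e he f hf
    obtain rfl | hf := List.mem_cons.1 hf
    · exact ha.fst_subset h.pairwise e he
    · exact h₃ e he f hf
  ne_univ e he := by
    by_cases hea : e = a
    · rw [hea]
      exact ha.fst_ne_univ fun q hq => h.ne_univ q (List.mem_append_right _ hq)
    · refine h.ne_univ e ?_
      simp only [List.mem_append, List.mem_cons] at he ⊢
      tauto
  isChain := by
    obtain ⟨h₁, h₂, h₃⟩ := List.isChain_append.1 h.isChain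
    refine List.isChain_append.2 ⟨h₁, ?_, fun x hx y hy hxy => ?_⟩
    · cases Q with
      | nil => exact List.isChain_singleton _
      | cons q Q => exact List.isChain_cons_cons.2 ⟨ha.ne_head, h₂⟩
    · obtain rfl : a = y := by simpa using hy
      subst hxy
      obtain ⟨P₀, rfl⟩ := List.getLast?_eq_some_iff.1 hx
      exact hne P₀ rfl
  isBase := h.isBase.insert ha
  isChain' := h.isChain'

theorem IsGood.erase {m : H} {P Q : List (Set α × H)} {a : Set α × H} {τ : List H}
    (h : 𝒟.IsGood m (P ++ a :: Q) τ) (ha : 𝒟.IsPivot m P Q a) : 𝒟.IsGood m (P ++ Q) τ where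
  pairwise := h.pairwise.sublist (by simp)
  ne_univ e he := by
    refine h.ne_univ e ?_
    simp only [List.mem_append, List.mem_cons] at he ⊢
    tauto
  isChain := by
    obtain ⟨h₁, h₂, -⟩ := List.isChain_append.1 h.isChain
    refine List.isChain_append.2 ⟨h₁, h₂.tail, fun x hx y hy => ?_⟩
    obtain _ | ⟨q, Q⟩ := Q
    · simp at hy
    · obtain rfl : q = y := by simpa using hy
      exact ha.last_ne_head (List.mem_of_getLast? hx)
  isBase := h.isBase.erase ha
  isChain' := h.isChain'

theorem IsGood.ne_append {m : H} {P Q : List (Set α × H)} {a : Set α × H} {τ : List H}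
    (h : 𝒟.IsGood m (P ++ a :: Q) τ) (P₀ : List (Set α × H)) : P ≠ P₀ ++ [a] := by
  rintro rfl
  exact (List.isChain_append.1 h.isChain).2.2 a (by simp) a (by simp) rfl

end DescentSystem

end SSet
end DescentPairing

/-! ### Acyclicity of the matching -/

section DescentAnodyne

open Simplicial

namespace SSet

variable {α : Type u} {H : Type u} [Group H]

theorem mk_ofList_congr {Γ : Set α → Subgroup H} {l l' : List (Set α × H)} (h : l = l') {n n' : ℕ}
    (hl : IsCosetList Γ l) (hl' : IsCosetList Γ l') (hn : l.length = n + 1)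
    (hn' : l'.length = n' + 1) : S.mk (ofList l hl hn) = S.mk (ofList l' hl' hn') := by
  subst h
  obtain rfl : n = n' := by omega
  rfl

theorem eraseIdx_fullList_of_lt {σ : List (Set α × H)} {τ : List H} {i : ℕ} (hi : i < σ.length) :
    (fullList σ τ).eraseIdx i = fullList (σ.eraseIdx i) τ :=
  List.eraseIdx_append_of_lt_length hi _

theorem eraseIdx_fullList_append (P Q : List (Set α × H)) (a : Set α × H) (τ : List H) :
    (fullList (P ++ a :: Q) τ).eraseIdx P.length = fullList (P ++ Q) τ := by
  rw [eraseIdx_fullList_of_lt (by simp), List.eraseIdx_append_of_length_le le_rfl]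
  simp

/-- Translation does not affect the number of vertices with subset `univ`, and the deletion lowers
it by one. This also covers deletion of the normalizing vertex. -/
theorem length_lt_of_eraseIdx_fullList {σ σ' : List (Set α × H)} {τ τ' : List H} {g : H} {i : ℕ}
    (hσ : ∀ e ∈ σ, e.1 ≠ Set.univ) (hσ' : ∀ e ∈ σ', e.1 ≠ Set.univ) (hi : σ.length ≤ i)
    (hi' : i < (fullList σ τ).length)
    (h : (fullList σ τ).eraseIdx i = (fullList σ' τ').map fun e => (e.1, e.2 * g)) :
    τ'.length < τ.length := by
  classical
  have h₁ := congrArg (List.countP fun e => decide (e.1 = Set.univ)) h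
  have h₂ : (fullList σ' τ').countP (fun e => decide (e.1 = Set.univ)) = τ'.length + 1 := by
    rw [fullList, List.countP_append, List.countP_eq_zero.2 (by simpa using hσ')]
    simp [List.countP_map, Function.comp_def]
  rw [List.countP_map, show ((fun e : Set α × H => decide (e.1 = Set.univ)) ∘
    fun e : Set α × H => (e.1, e.2 * g)) = fun e => decide (e.1 = Set.univ) from rfl, h₂, fullList,
    List.eraseIdx_append_of_length_le hi, List.countP_append,
    List.countP_eq_zero.2 (by simpa using hσ), zero_add] at h₁
  rw [length_fullList] at hi'
  have h₃ := List.countP_le_length (p := fun e : Set α × H => decide (e.1 = Set.univ))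
    (l := (((Set.univ : Set α), (1 : H)) :: τ.map fun v => (Set.univ, v)).eraseIdx (i - σ.length))
  rw [List.length_eraseIdx_of_lt (by simp; omega)] at h₃
  simp at h₃
  omega

namespace DescentSystem

variable {Γ : Set α → Subgroup H} (𝒟 : DescentSystem Γ)

theorem exists_isGood {l : List (Set α × H)} (hl : IsCosetList Γ l) (hc : l.IsChain (· ≠ ·))
    {k : ℕ} (hk : k < l.length) (hk₁ : l[k].1 = Set.univ) (hk₂ : l[k].2 = 1)
    (hk₃ : ∀ i (hi : i < k), l[i].1 ≠ Set.univ) :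
    ∃ m σ τ, l = fullList σ τ ∧ 𝒟.IsGood m σ τ := by
  have hτ : l.drop (k + 1) = ((l.drop (k + 1)).map Prod.snd).map fun v => (Set.univ, v) := by
    refine List.ext_getElem (by simp) fun i h₁ h₂ => ?_
    simp only [List.getElem_map, List.getElem_drop]
    refine Prod.ext ?_ rfl
    refine Set.eq_univ_of_univ_subset ?_
    rw [← hk₁]
    exact hl.1 _ _ (by omega) _
  have heq : l = fullList (l.take k) ((l.drop (k + 1)).map Prod.snd) := by
    rw [fullList, ← hτ]
    conv_lhs => rw [← List.take_append_drop k l, List.drop_eq_getElem_cons hk]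
    rw [← hk₁, ← hk₂]
  -- All proper vertices lie in the coset of the first one, whose minimal representative serves as
  -- base.
  have hbase : ∃ m, 𝒟.IsBase m (l.take k) := by
    by_cases hk0 : k = 0
    · exact ⟨1, by simp [hk0, isBase_nil]⟩
    · have hl0 : 0 < l.length := by omega
      obtain ⟨m, hm, hm'⟩ := 𝒟.exists_min l[0].1 l[0].2
      refine ⟨m, ?_⟩
      have hmem : ∀ f ∈ l.take k, f.2 * l[0].2⁻¹ ∈ Γ l[0].1 := by
        intro f hf
        obtain ⟨j, hj, rfl⟩ := List.mem_iff_getElem.1 hf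
        rw [List.length_take] at hj
        rw [List.getElem_take]
        exact hl.2 0 0 j le_rfl (Nat.zero_le _) (by omega) (hk₃ j (by omega))
      obtain ⟨e, l', hel⟩ := List.exists_cons_of_ne_nil (l := l.take k) (by
        intro h
        rcases List.take_eq_nil_iff.1 h with h | h
        · exact hk0 h
        · simp [h] at hl0)
      have he : e = l[0] := by
        have : (l.take k)[0]'(by simp [hel]) = e := by simp [hel]
        rw [← this, List.getElem_take]
      rw [hel, isBase_cons, ← hel, he]
      refine ⟨hm', fun f hf => ?_⟩
      simpa using mul_mem (hmem f hf) hm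
  obtain ⟨m, hm⟩ := hbase
  refine ⟨m, _, _, heq, ?_, ?_, ?_, hm, ?_⟩
  · refine List.Pairwise.sublist (List.take_sublist _ _) (List.pairwise_iff_getElem.2 ?_)
    exact fun i j hi hj hij => hl.1 i j hij.le hj
  · intro e he
    obtain ⟨j, hj, rfl⟩ := List.mem_iff_getElem.1 he
    rw [List.length_take] at hj
    rw [List.getElem_take]
    exact hk₃ j (by omega)
  · exact hc.take k
  · rw [heq, fullList_eq, List.isChain_append] at hc
    exact ((List.isChain_map _).1 hc.2.1).imp fun a b h h' => h (by rw [h'])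

/-- The pairs of a simplex and its distinguished face. -/
structure PairIndex where
  m : H
  P : List (Set α × H)
  Q : List (Set α × H)
  a : Set α × H
  τ : List H
  good : 𝒟.IsGood m (P ++ Q) τ
  pivot : 𝒟.IsPivot m P Q a
  ne_append : ∀ P₀, P ≠ P₀ ++ [a]

namespace PairIndex

variable {𝒟} (s t : 𝒟.PairIndex)

theorem good₁ : 𝒟.IsGood s.m (s.P ++ s.a :: s.Q) s.τ :=
  s.good.insert s.pivot s.ne_append

theorem pivot₁ : 𝒟.IsPivot s.m (s.P ++ [s.a]) s.Q s.a :=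
  s.pivot.of_subset fun _ => id

variable {s t}

theorem ext_of_eq (hm : s.m = t.m) (hP : s.P = t.P) (hQ : s.Q = t.Q) (ha : s.a = t.a)
    (hτ : s.τ = t.τ) : s = t := by
  cases s
  cases t
  cases hm
  cases hP
  cases hQ
  cases ha
  cases hτ
  rfl

variable (s) in
/-- The list of vertices of the simplex of a pair. -/
def list : List (Set α × H) := fullList (s.P ++ s.a :: s.Q) s.τ

variable (s) in
/-- The dimension of the face of a pair. -/
def dim : ℕ := (s.P ++ s.Q).length + s.τ.length

theorem length_list : s.list.length = s.dim + 1 + 1 := by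
  simp [list, dim, length_fullList]
  omega

variable (s) in
/-- The position of the vertex that is omitted by the face of a pair. -/
def index : Fin (s.dim + 2) := ⟨s.P.length, by simp [dim]; omega⟩

variable (s) in
/-- The simplex of a pair. -/
def simplex : (cosetComplex Γ : SSet.{u}) _⦋s.dim + 1⦌ :=
  ofList s.list s.good₁.isCosetList length_list

theorem δ_index_simplex : (cosetComplex Γ : SSet.{u}).δ s.index s.simplex =
    ofList (fullList (s.P ++ s.Q) s.τ) s.good.isCosetList (by simp [length_fullList, dim]) := by
  refine (δ_ofList _ _ _ _).trans ?_
  congr 1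
  exact eraseIdx_fullList_append _ _ _ _

theorem notMem_of_fullList {σ : List (Set α × H)} {τ : List H} {n : ℕ}
    (hl : IsCosetList Γ (fullList σ τ)) (hn : (fullList σ τ).length = n + 1) :
    ofList (fullList σ τ) hl hn ∉ (properCosetComplex Γ).obj (op ⦋n⦌) := by
  rw [ofList_mem_iff, not_not]
  have h := length_fullList σ τ
  simp only [fullList_eq]
  rw [List.getElem_append_right (by omega), List.getElem_map]

theorem eq_of_eraseIdx {i : Fin (t.dim + 2)}
    (h : S.mk ((cosetComplex Γ : SSet.{u}).δ s.index s.simplex) =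
      S.mk ((cosetComplex Γ : SSet.{u}).δ i t.simplex)) :
    s.τ.length < t.τ.length ∨ (i.1 < (t.P ++ t.a :: t.Q).length ∧
      s.P ++ s.Q = (t.P ++ t.a :: t.Q).eraseIdx i ∧ s.τ = t.τ) := by
  rw [δ_index_simplex] at h
  obtain ⟨g, hg⟩ := eq_of_mk_ofList_eq (h.trans (congrArg S.mk (δ_ofList _ _ _ _)))
  by_cases hi : i.1 < (t.P ++ t.a :: t.Q).length
  · right
    rw [list, eraseIdx_fullList_of_lt hi] at hg
    obtain ⟨h₁, h₂⟩ := fullList_eq_map s.good.ne_univ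
      (fun e he => t.good₁.ne_univ e (List.mem_of_mem_eraseIdx he)) hg
    exact ⟨hi, h₁.symm, h₂.symm⟩
  · left
    refine length_lt_of_eraseIdx_fullList t.good₁.ne_univ s.good.ne_univ (not_lt.1 hi) ?_ hg
    have := i.2
    have := length_list (s := t)
    unfold list at this
    omega

/-- Consecutive vertices are distinct, so deletions at different positions give different lists. -/
theorem index_eq {i : Fin (s.dim + 2)} (h : (cosetComplex Γ : SSet.{u}).δ i s.simplex =
    (cosetComplex Γ : SSet.{u}).δ s.index s.simplex) : i = s.index := by
  obtain h | ⟨hi, h, -⟩ := eq_of_eraseIdx (congrArg S.mk h.symm)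
  · exact absurd h (lt_irrefl _)
  · refine Fin.ext (List.IsChain.eraseIdx_injective s.good₁.isChain hi
      (show s.P.length < _ by simp) (h.symm.trans ?_))
    change _ = (s.P ++ s.a :: s.Q).eraseIdx s.P.length
    rw [List.eraseIdx_append_of_length_le le_rfl]
    simp

/-- The list of the face of a pair does not contain its pivot at the distinguished position. -/
theorem false_of_eq (hm : s.m = t.m) {P Q : List (Set α × H)} {a : Set α × H}
    (h : 𝒟.IsPivot t.m (P ++ [a]) Q a) (heq : s.P ++ s.Q = P ++ a :: Q) : False := by
  have := s.pivot
  rw [hm] at this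
  obtain ⟨h₁, -, h₂⟩ := this.unique h (by simpa using heq)
  exact s.ne_append P (h₂ ▸ h₁)

open scoped Classical in
variable (s) in
/-- The rank of a pair. -/
noncomputable def rank : ℕ ×ₗ ℕ ×ₗ ℕ ×ₗ ℕ :=
  -- The entries drop, in this order, when a vertex with subset `univ` is deleted, when the base
  -- gets shorter, when `q` with second entry different from `m` is replaced by the pivot, and when
  -- `q` outside `desc m` is.
  toLex (s.τ.length, toLex (𝒟.len s.m, toLex ((s.P ++ s.Q).countP fun e => decide (e.2 ≠ s.m),
    (s.P ++ s.Q).countP fun e => decide (¬ e.1 ⊆ 𝒟.desc s.m))))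

/-- The face of `t` is assumed to be the smaller member of the pair `s`. This excludes all deletions
of proper vertices that keep the base and the pivot, since such faces are the larger members of
their pairs. -/
theorem rank_lt {i : Fin (t.dim + 2)} (hi : i ≠ t.index)
    (h : S.mk ((cosetComplex Γ : SSet.{u}).δ s.index s.simplex) =
      S.mk ((cosetComplex Γ : SSet.{u}).δ i t.simplex)) : s.rank < t.rank := by
  classical
  have hi' : i.1 ≠ t.P.length := fun h' => hi (Fin.ext h')
  obtain h | ⟨hit, h, hτ⟩ := eq_of_eraseIdx h
  · exact Prod.Lex.toLex_lt_toLex.2 (Or.inl h)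
  refine Prod.Lex.toLex_lt_toLex.2 (Or.inr ⟨congrArg List.length hτ, ?_⟩)
  rw [Prod.Lex.toLex_lt_toLex]
  -- Deleting the first vertex can only enlarge the coset, and the minimal representative of a
  -- larger coset is equal or shorter.
  have hm : 𝒟.len s.m < 𝒟.len t.m ∨ s.m = t.m := by
    have hbs := s.good.isBase
    have hbt := t.good₁.isBase
    have hpt := t.good₁.pairwise
    obtain h₀ | ⟨e, l, hel⟩ : s.P ++ s.Q = [] ∨ ∃ e l, s.P ++ s.Q = e :: l := by
      cases s.P ++ s.Q <;> simp
    · exfalso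
      have := congrArg List.length h
      rw [h₀, List.length_eraseIdx_of_lt hit] at this
      simp at this hit
      omega
    · have he : e ∈ t.P ++ t.a :: t.Q := List.mem_of_mem_eraseIdx (i := i.1) (by rw [← h, hel]; simp)
      rw [hel, isBase_cons] at hbs
      obtain ⟨e', l', hel'⟩ := List.exists_cons_of_ne_nil (l := t.P ++ t.a :: t.Q) (by simp)
      rw [hel'] at he hpt hbt
      rw [isBase_cons] at hbt
      have hee : e'.1 ⊆ e.1 := by
        obtain rfl | he := List.mem_cons.1 he
        · exact subset_rfl
        · exact (List.pairwise_cons.1 hpt).1 e he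
      by_cases hne : t.m = s.m
      · exact Or.inr hne.symm
      · refine Or.inl (𝒟.len_lt e.1 s.m t.m ?_ hbs.1 hne)
        have := mul_mem (inv_mem (𝒟.mono hee (hbt.2 e he))) (hbs.2 e (by simp))
        simpa using this
  obtain hm | hm := hm
  · exact Or.inl hm
  refine Or.inr ⟨congrArg 𝒟.len hm, ?_⟩
  obtain hlt | hlt := lt_or_gt_of_ne hi'
  · exfalso
    obtain ⟨A, x, B, hAB, -, hAB'⟩ := List.exists_eraseIdx_eq hlt
    rw [List.eraseIdx_append_of_lt_length hlt, hAB'] at h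
    refine false_of_eq hm (t.pivot.of_subset ?_) h
    rw [hAB]
    simp
  · rw [List.eraseIdx_append_of_length_le hlt.le] at h
    obtain ⟨j, hj⟩ : ∃ j, i.1 - t.P.length = j + 1 := ⟨i.1 - t.P.length - 1, by omega⟩
    rw [hj, List.eraseIdx_cons_succ] at h
    obtain ⟨A, x, B, hAB, -, hAB'⟩ := List.exists_eraseIdx_eq (l := t.Q) (i := j) (by
      simp at hit
      omega)
    rw [hAB'] at h
    have hp := t.pivot₁
    rw [hAB] at hp
    -- Only the deletion of the vertex right after the pivot changes the pivot; the counts then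
    -- compare this vertex with the pivot, which remains.
    obtain _ | ⟨q, A⟩ := A
    · rw [List.nil_append] at h hp hAB
      rw [Prod.Lex.toLex_lt_toLex, h, hm, hAB]
      simp only [List.countP_append, List.countP_cons]
      obtain ⟨h₁, q, Q', hq, hq', ha⟩ | ⟨h₁, h₂, ⟨h₃, -⟩ | ⟨q, Q', hq, hq', ha⟩⟩ := hp
      · obtain ⟨rfl, -⟩ := List.cons.inj hq
        left
        simp [h₁ t.a (by simp), hq']
      · cases h₃
      · obtain ⟨rfl, -⟩ := List.cons.inj hq
        right
        simp [h₁ t.a (by simp), h₁ x (by simp), h₂ t.a (by simp), hq']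
    · exact (false_of_eq hm hp.of_erase h).elim

end PairIndex

/-- After normalization at the first index where the chain is `univ`, the simplex is the larger
member of its pair exactly if the pivot already ends the initial part. -/
theorem exists_pairIndex {n : ℕ} (x : (cosetComplex Γ : SSet.{u}) _⦋n⦌)
    (hx : x ∈ (cosetComplex Γ : SSet.{u}).nonDegenerate n)
    (hx' : x ∉ (properCosetComplex Γ).obj (op ⦋n⦌)) :
    ∃ s : 𝒟.PairIndex, S.mk x = S.mk s.simplex ∨
      S.mk x = S.mk ((cosetComplex Γ : SSet.{u}).δ s.index s.simplex) := by
  classical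
  have hex : ∃ k, ∃ hk : k < n + 1, cosetMember x ⟨k, hk⟩ = Set.univ :=
    ⟨n, Nat.lt_succ_self n, by_contra hx'⟩
  obtain ⟨hk, hk₁⟩ := Nat.find_spec hex
  obtain ⟨l, hl, hn, rfl, h1⟩ := exists_eq_ofList x (Nat.find hex) hk
  obtain ⟨m, σ, τ, rfl, hg⟩ := 𝒟.exists_isGood hl ((ofList_mem_nonDegenerate_iff _ _ _).1 hx)
    (hn.symm ▸ hk) hk₁ h1 fun i hi h => Nat.find_min hex hi ⟨by omega, h⟩
  rw [length_fullList] at hn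
  obtain rfl : n = σ.length + τ.length := by omega
  obtain ⟨P, Q, a, rfl, hp⟩ := 𝒟.exists_isPivot m σ
  by_cases hP : ∃ P₀, P = P₀ ++ [a]
  · obtain ⟨P₀, rfl⟩ := hP
    have hp' : 𝒟.IsPivot m P₀ Q a := hp.of_subset (by simp)
    have hg' : 𝒟.IsGood m (P₀ ++ a :: Q) τ := by simpa using hg
    refine ⟨⟨m, P₀, Q, a, τ, hg'.erase hp', hp', hg'.ne_append⟩, Or.inl ?_⟩
    exact mk_ofList_congr (by simp [PairIndex.list]) _ _ _ _
  · refine ⟨⟨m, P, Q, a, τ, hg, hp, fun P₀ h => hP ⟨P₀, h⟩⟩, Or.inr ?_⟩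
    rw [PairIndex.δ_index_simplex]
    exact mk_ofList_congr rfl _ _ _ _

/-- The pairing of the simplices which do not belong to `properCosetComplex Γ`. -/
def pairingCore : (properCosetComplex Γ : (cosetComplex Γ : SSet.{u}).Subcomplex).PairingCore where
  ι := 𝒟.PairIndex
  dim := PairIndex.dim
  simplex := PairIndex.simplex
  index := PairIndex.index
  nonDegenerate₁ s := (ofList_mem_nonDegenerate_iff _ _ _).2 s.good₁.isChain_fullList
  nonDegenerate₂ s := by
    rw [PairIndex.δ_index_simplex]
    exact (ofList_mem_nonDegenerate_iff _ _ _).2 s.good.isChain_fullList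
  notMem₁ s := PairIndex.notMem_of_fullList _ _
  notMem₂ s := by
    rw [PairIndex.δ_index_simplex]
    exact PairIndex.notMem_of_fullList _ _
  injective_type₁' {s t} h := by
    obtain ⟨g, hg⟩ := eq_of_mk_ofList_eq h
    obtain ⟨h₁, h₂⟩ := fullList_eq_map s.good₁.ne_univ t.good₁.ne_univ hg
    have hb := t.good₁.isBase
    rw [h₁] at hb
    have hm := s.good₁.isBase.unique hb
    have hp := t.pivot₁
    rw [hm] at hp
    obtain ⟨h₃, h₄, h₅⟩ := s.pivot₁.unique hp (by simpa using h₁.symm)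
    rw [h₅] at h₃
    exact PairIndex.ext_of_eq hm.symm (List.append_cancel_right h₃) h₄ h₅ h₂.symm
  injective_type₂' {s t} h := by
    rw [PairIndex.δ_index_simplex, PairIndex.δ_index_simplex] at h
    obtain ⟨g, hg⟩ := eq_of_mk_ofList_eq h
    obtain ⟨h₁, h₂⟩ := fullList_eq_map s.good.ne_univ t.good.ne_univ hg
    have hb := t.good.isBase
    rw [h₁] at hb
    have hm := s.good.isBase.unique hb
    have hp := t.pivot
    rw [hm] at hp
    obtain ⟨h₃, h₄, h₅⟩ := s.pivot.unique hp h₁.symm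
    exact PairIndex.ext_of_eq hm.symm h₃ h₄ h₅ h₂.symm
  type₁_ne_type₂' s t h := by
    rw [PairIndex.δ_index_simplex] at h
    obtain ⟨g, hg⟩ := eq_of_mk_ofList_eq h
    obtain ⟨h₁, h₂⟩ := fullList_eq_map s.good₁.ne_univ t.good.ne_univ hg
    have hb := t.good.isBase
    rw [h₁] at hb
    exact PairIndex.false_of_eq (s.good₁.isBase.unique hb) s.pivot₁ h₁
  surjective' x := by
    obtain ⟨y, hy, rfl⟩ := x.mk'_surjective
    obtain ⟨z, hz, rfl⟩ := y.mk'_surjective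
    exact 𝒟.exists_pairIndex z.simplex hz hy

theorem anodyneExtensions (𝒟 : DescentSystem Γ) :
    SSet.anodyneExtensions (properCosetComplex Γ).ι :=
  𝒟.pairingCore.anodyneExtensions_of_rank PairIndex.rank (fun _ _ => PairIndex.index_eq)
    fun _ _ _ => PairIndex.rank_lt

end DescentSystem

end SSet
end DescentAnodyne

/-! ### Exchange property and minimal coset representatives -/

section ReflectionCocycle

/-- A group with generating involutions and a reflection cocycle. -/
structure ReflectionCocycle {G : Type u} [Group G] {α : Type v} (s : α → G) (N : G → Set G) :
    Prop where
  mul_self (a : α) : s a * s a = 1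
  eq_singleton (a : α) : N (s a) = {s a}
  mem_mul_iff (u v t : G) : t ∈ N (u * v) ↔ Xor (t ∈ N u) (u⁻¹ * t * u ∈ N v)

namespace ReflectionCocycle

variable {G : Type u} [Group G] {α : Type v} {s : α → G} {N : G → Set G}
  (h : ReflectionCocycle s N)

variable (s) in
/-- The product of a word in the generators. -/
def word (l : List α) : G := (l.map s).prod

theorem word_cons (a : α) (l : List α) : word s (a :: l) = s a * word s l := by
  simp [word]

theorem word_append (l l' : List α) : word s (l ++ l') = word s l * word s l' := by
  simp [word]

include h

theorem notMem_one (t : G) : t ∉ N 1 := by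
  have := h.mem_mul_iff 1 1 t
  simp [Xor] at this
  exact this

/-- The strong exchange property. By the cocycle rule `t` either is the first letter, which cancels,
or is conjugated by it to a member of `N` of the remaining word. -/
theorem exists_eraseIdx {t : G} {l : List α} (ht : t ∈ N (word s l)) :
    ∃ i < l.length, t * word s l = word s (l.eraseIdx i) := by
  induction l generalizing t with
  | nil => exact (h.notMem_one t ht).elim
  | cons a l ih =>
    rw [word_cons, h.mem_mul_iff, h.eq_singleton] at ht
    obtain ⟨rfl, -⟩ | ⟨ht, -⟩ := ht
    · refine ⟨0, by simp, ?_⟩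
      rw [word_cons, ← mul_assoc, h.mul_self, one_mul]
      rfl
    · obtain ⟨i, hi, hi'⟩ := ih ht
      refine ⟨i + 1, by simpa using hi, ?_⟩
      rw [List.eraseIdx_cons_succ, word_cons, word_cons, ← hi']
      group

theorem mem_mul_left_iff (a : α) (m : G) : s a ∈ N (s a * m) ↔ s a ∉ N m := by
  rw [h.mem_mul_iff, h.eq_singleton, inv_mul_cancel, one_mul]
  simp [Xor]

theorem exists_word_of_mem_closure {c : Set α} {g : G} (hg : g ∈ Subgroup.closure (s '' c)) :
    ∃ l : List α, (∀ a ∈ l, a ∈ c) ∧ word s l = g := by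
  induction hg using Subgroup.closure_induction_left with
  | one => exact ⟨[], by simp, rfl⟩
  | mul_left x hx y hy ih =>
    obtain ⟨a, ha, rfl⟩ := hx
    obtain ⟨l, hl, rfl⟩ := ih
    exact ⟨a :: l, by simpa [ha] using hl, word_cons a l⟩
  | inv_mul_cancel x hx y hy ih =>
    obtain ⟨a, ha, rfl⟩ := hx
    obtain ⟨l, hl, rfl⟩ := ih
    refine ⟨a :: l, by simpa [ha] using hl, ?_⟩
    rw [word_cons, inv_eq_of_mul_eq_one_right (h.mul_self a)]

omit h in
theorem word_mem_closure {c : Set α} {l : List α} (hl : ∀ a ∈ l, a ∈ c) :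
    word s l ∈ Subgroup.closure (s '' c) := by
  refine list_prod_mem fun x hx => ?_
  obtain ⟨a, ha, rfl⟩ := List.mem_map.1 hx
  exact Subgroup.subset_closure ⟨a, hl a ha, rfl⟩

/-- A nontrivial element of the subgroup generated by `c` has a descent in `c`. -/
theorem exists_mem_of_mem_closure {c : Set α} {g : G} (hg : g ∈ Subgroup.closure (s '' c))
    (hg' : g ≠ 1) : ∃ a ∈ c, s a ∈ N g := by
  classical
  have hex : ∃ n, ∃ l : List α, l.length = n ∧ (∀ a ∈ l, a ∈ c) ∧ word s l = g := by
    obtain ⟨l, hl⟩ := h.exists_word_of_mem_closure hg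
    exact ⟨_, l, rfl, hl⟩
  obtain ⟨l, hl, hlc, hlg⟩ := Nat.find_spec hex
  -- The first letter of a shortest word in `c` is a descent: otherwise it is a descent of the
  -- remaining word, and exchange yields a shorter word in `c`.
  obtain _ | ⟨a, l⟩ := l
  · exact (hg' hlg.symm).elim
  refine ⟨a, hlc a (by simp), ?_⟩
  by_contra ha
  rw [← hlg, word_cons, h.mem_mul_left_iff, not_not] at ha
  obtain ⟨i, hi, hi'⟩ := h.exists_eraseIdx ha
  refine Nat.find_min hex (m := (l.eraseIdx i).length) ?_ ⟨_, rfl, fun b hb => ?_, ?_⟩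
  · rw [← hl, List.length_eraseIdx_of_lt hi, List.length_cons]
    omega
  · exact hlc b (List.mem_cons_of_mem _ (List.mem_of_mem_eraseIdx hb))
  · rw [← hi', ← word_cons, hlg]

/-- The simple reflections generate the group if it is generated by reflections. -/
theorem closure_range_eq_top (hfin : ∀ w, (N w).Finite)
    (hne : ∀ w, (N w).Nonempty → ∃ a, s a ∈ N w) (hgen : Subgroup.closure {t | t ∈ N t} = ⊤) :
    Subgroup.closure (Set.range s) = ⊤ := by
  have key : ∀ (n : ℕ) (w : G), (N w).ncard = n →
      ∃ u ∈ Subgroup.closure (Set.range s), N (u * w) = ∅ := by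
    intro n
    induction n using Nat.strong_induction_on with
    | _ n ih =>
      rintro w rfl
      obtain hw | hw := (N w).eq_empty_or_nonempty
      · exact ⟨1, one_mem _, by rwa [one_mul]⟩
      obtain ⟨a, ha⟩ := hne w hw
      -- Conjugation by `s a` maps `N (s a * w)` injectively to `N w` and misses `s a`.
      have hlt : (N (s a * w)).ncard < (N w).ncard := by
        refine (Set.ncard_le_ncard_of_injOn (t := N w \ {s a}) (fun t => (s a)⁻¹ * t * s a) ?_ ?_
          (hfin w).sdiff).trans_lt (Set.ncard_sdiff_singleton_lt_of_mem ha (hfin w))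
        · intro t ht
          have hta : t ≠ s a := by
            rintro rfl
            exact (h.mem_mul_left_iff a w).1 ht ha
          rw [h.mem_mul_iff, h.eq_singleton] at ht
          refine ⟨(ht.resolve_left fun h' => hta h'.1).1, fun h' => hta ?_⟩
          have h'' : (s a)⁻¹ * t * s a = s a := h'
          rwa [mul_assoc, inv_mul_eq_iff_eq_mul, mul_left_inj] at h''
        · exact fun t _ t' _ h' => by simpa using h'
      obtain ⟨u, hu, hu'⟩ := ih _ hlt (s a * w) rfl
      exact ⟨u * s a, mul_mem hu (Subgroup.subset_closure ⟨a, rfl⟩), by rwa [mul_assoc]⟩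
  rw [eq_top_iff, ← hgen, Subgroup.closure_le]
  intro t ht
  -- `N (u * t) = ∅` need not mean `u * t = 1`. But it puts `t` into `N u⁻¹`, and exchange in a word
  -- for `u⁻¹` writes `t` in simple reflections.
  obtain ⟨u, hu, hu'⟩ := key _ t rfl
  have ht' : t ∈ N (u⁻¹ * (u * t)) := by rwa [inv_mul_cancel_left]
  rw [h.mem_mul_iff, hu'] at ht'
  obtain ⟨ht', -⟩ | ⟨ht', -⟩ := ht'
  · rw [← Set.image_univ] at hu ⊢
    obtain ⟨l, hl, hl'⟩ := h.exists_word_of_mem_closure (inv_mem hu)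
    rw [← hl'] at ht'
    obtain ⟨i, hi, hi'⟩ := h.exists_eraseIdx ht'
    rw [← eq_mul_inv_iff_mul_eq] at hi'
    rw [hi']
    exact mul_mem (word_mem_closure (by simp)) (inv_mem (word_mem_closure (by simp)))
  · exact ht'.elim

omit h

variable (hgen : Subgroup.closure (Set.range s) = ⊤)

variable (s) in
/-- The word length. -/
noncomputable def wordLength (g : G) : ℕ := sInf {n | ∃ l : List α, l.length = n ∧ word s l = g}

theorem wordLength_le (l : List α) : wordLength s (word s l) ≤ l.length :=
  Nat.sInf_le ⟨l, rfl, rfl⟩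

include h hgen

theorem exists_length_eq (g : G) : ∃ l : List α, l.length = wordLength s g ∧ word s l = g := by
  refine Nat.sInf_mem (s := {n | ∃ l : List α, l.length = n ∧ word s l = g}) ?_
  obtain ⟨l, -, hl⟩ := h.exists_word_of_mem_closure (c := Set.univ) (g := g) (by
    rw [Set.image_univ, hgen]
    trivial)
  exact ⟨_, l, rfl, hl⟩

theorem wordLength_mul_lt {t g : G} (ht : t ∈ N g) : wordLength s (t * g) < wordLength s g := by
  obtain ⟨l, hl, rfl⟩ := h.exists_length_eq hgen g
  obtain ⟨i, hi, hi'⟩ := h.exists_eraseIdx ht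
  rw [hi', ← hl]
  refine (wordLength_le _).trans_lt ?_
  rw [List.length_eraseIdx_of_lt hi]
  omega

omit h hgen in
theorem exists_minimal (c : Set α) (v : G) : ∃ m, v * m⁻¹ ∈ Subgroup.closure (s '' c) ∧
    ∀ m', v * m'⁻¹ ∈ Subgroup.closure (s '' c) → wordLength s m ≤ wordLength s m' := by
  obtain ⟨m, hm, hm'⟩ := (measure (wordLength s)).wf.has_min
    {m | v * m⁻¹ ∈ Subgroup.closure (s '' c)} ⟨v, by simp [one_mem]⟩
  exact ⟨m, hm, fun m' h' => not_lt.1 (hm' m' h')⟩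

/-- An element of minimal length in its coset is the only element of the coset without descents
in `c`. -/
theorem minimal_iff {c : Set α} {m v : G} (hv : v * m⁻¹ ∈ Subgroup.closure (s '' c))
    (hm : ∀ m', v * m'⁻¹ ∈ Subgroup.closure (s '' c) → wordLength s m ≤ wordLength s m') :
    (∀ a ∈ c, s a ∉ N v) ↔ v = m := by
  -- Otherwise `t * m` would be a shorter element of the same coset.
  have hmt : ∀ t ∈ Subgroup.closure (s '' c), t ∉ N m := by
    intro t ht htm
    refine (hm (t * m) ?_).not_gt (h.wordLength_mul_lt hgen htm)
    rw [mul_inv_rev, ← mul_assoc]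
    exact mul_mem hv (inv_mem ht)
  constructor
  · intro hd
    by_contra hne
    obtain ⟨a, ha, hau⟩ := h.exists_mem_of_mem_closure hv fun h' => hne (mul_inv_eq_one.1 h')
    refine hd a ha ?_
    have ha' := Subgroup.subset_closure (Set.mem_image_of_mem s ha)
    have := (h.mem_mul_iff (v * m⁻¹) m (s a)).2 (Or.inl ⟨hau,
      hmt _ (mul_mem (mul_mem (inv_mem hv) ha') hv)⟩)
    simpa using this
  · rintro rfl a ha
    exact hmt _ (Subgroup.subset_closure (Set.mem_image_of_mem s ha))

/-- An element whose descents are all generators has maximal length. -/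
theorem wordLength_le_of_forall_mem {m : G} (hm : ∀ a, s a ∈ N m) (g : G) :
    wordLength s g ≤ wordLength s m := by
  obtain ⟨l, hl, rfl⟩ := h.exists_length_eq hgen g
  -- Every reduced word is a prefix of a reduced word of `m`. To prepend `a`, exchange a letter of
  -- `l ++ l'` for it; the letter cannot come from `l`, because `a :: l` is reduced.
  suffices ∃ l', word s (l ++ l') = m ∧ (l ++ l').length ≤ wordLength s m by
    obtain ⟨l', -, h'⟩ := this
    rw [List.length_append] at h'
    omega
  induction l with
  | nil =>
    obtain ⟨l', hl', rfl⟩ := h.exists_length_eq hgen m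
    exact ⟨l', rfl, hl'.le⟩
  | cons a l ih =>
    have hred : l.length = wordLength s (word s l) := by
      refine le_antisymm ?_ (wordLength_le l)
      obtain ⟨l₁, h₁, h₂⟩ := h.exists_length_eq hgen (word s l)
      have := wordLength_le (s := s) (a :: l₁)
      rw [word_cons, h₂, ← word_cons, ← hl, List.length_cons, List.length_cons, h₁] at this
      omega
    obtain ⟨l', rfl, hle⟩ := ih hred
    obtain ⟨i, hi, hi'⟩ := h.exists_eraseIdx (hm a)
    by_cases hil : i < l.length
    · exfalso
      rw [List.eraseIdx_append_of_lt_length hil, word_append, word_append, ← mul_assoc] at hi'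
      have := wordLength_le (s := s) (l.eraseIdx i)
      rw [← mul_right_cancel hi', ← word_cons, ← hl, List.length_eraseIdx_of_lt hil,
        List.length_cons] at this
      omega
    · rw [List.length_append] at hi hle
      refine ⟨l'.eraseIdx (i - l.length), ?_, ?_⟩
      · rw [List.cons_append, word_cons, ← List.eraseIdx_append_of_length_le (not_lt.1 hil), ← hi',
          ← mul_assoc, h.mul_self, one_mul]
      · rw [List.length_append, List.length_eraseIdx_of_lt (by omega), List.length_cons]
        omega

end ReflectionCocycle

/-- The descent system of a reflection cocycle. -/
noncomputable def ReflectionCocycle.descentSystem {G : Type u} [Group G] {α : Type u} {s : α → G}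
    {N : G → Set G} (h : ReflectionCocycle s N) (hgen : Subgroup.closure (Set.range s) = ⊤)
    [Finite α] [Infinite G] : SSet.DescentSystem fun c : Set α => Subgroup.closure (s '' c) where
  len := wordLength s
  desc m := {a | s a ∈ N m}
  mono _ _ hc := Subgroup.closure_mono (Set.image_mono hc)
  exists_min c v := by
    obtain ⟨m, hm, hm'⟩ := ReflectionCocycle.exists_minimal c v
    refine ⟨m, hm, Set.disjoint_right.2 ((h.minimal_iff hgen (v := m) (by simp [one_mem]) ?_).2 rfl)⟩
    intro m' h'
    refine hm' m' ?_
    simpa using mul_mem hm h'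
  len_lt c m v hvm hm hne := by
    obtain ⟨m₀, h₀, h₀'⟩ := ReflectionCocycle.exists_minimal c v
    have hmin : ∀ w, v * w⁻¹ ∈ Subgroup.closure (s '' c) →
        ((∀ a ∈ c, s a ∉ N w) ↔ w = m₀) := by
      intro w hw
      refine h.minimal_iff hgen ?_ fun m' h' => h₀' m' ?_
      · simpa using mul_mem (inv_mem hw) h₀
      · simpa using mul_mem hw h'
    obtain rfl := (hmin m hvm).1 (Set.disjoint_right.1 hm)
    refine lt_of_le_of_ne (h₀' v (by simp [one_mem])) fun heq => hne ?_
    refine (h.minimal_iff hgen (m := v) (v := m) (by simpa using inv_mem hvm) ?_).1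
      (Set.disjoint_right.1 hm) |>.symm
    intro m' h'
    rw [← heq]
    exact h₀' m' (by simpa using mul_mem hvm h')
  desc_one := Set.eq_empty_of_forall_notMem fun a => h.notMem_one (s a)
  eq_one m hm := by
    by_contra hne
    obtain ⟨a, -, ha⟩ := h.exists_mem_of_mem_closure (c := Set.univ) (g := m) (by
      rw [Set.image_univ, hgen]
      trivial) hne
    exact Set.eq_empty_iff_forall_notMem.1 hm a ha
  -- An element with all generators as descents bounds the length of all others, and there are only
  -- finitely many words of bounded length.
  desc_ne_univ m hm := by
    have hle := h.wordLength_le_of_forall_mem hgen (m := m) fun a => Set.eq_univ_iff_forall.1 hm a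
    have hfin : (Set.univ : Set G).Finite := by
      refine ((List.finite_length_le α (wordLength s m)).image (word s)).subset fun g _ => ?_
      obtain ⟨l, hl, hl'⟩ := h.exists_length_eq hgen g
      exact ⟨l, hl.trans_le (hle g), hl'⟩
    exact Set.infinite_univ hfin

end ReflectionCocycle

/-! ### Affine hyperplanes, reflections and separation -/

noncomputable section HyperplaneGeometry

set_option linter.unusedSectionVars false

open Topology Set

variable {V P : Type u} [NormedAddCommGroup V] [InnerProductSpace ℝ V] [FiniteDimensional ℝ V]
  [MetricSpace P] [NormedAddTorsor V P]

namespace AffineHyperplane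

theorem exists_normal (K : AffineHyperplane V P) :
    ∃ n : V, ‖n‖ = 1 ∧ K.space.directionᗮ = Submodule.span ℝ {n} := by
  obtain ⟨⟨v, hv⟩, hv', h⟩ := finrank_eq_one_iff'.1 K.finrank_normal
  have hv₀ : v ≠ 0 := fun h => hv' (Subtype.ext h)
  refine ⟨‖v‖⁻¹ • v, by rw [norm_smul, norm_inv, norm_norm, inv_mul_cancel₀ (by simpa using hv₀)], ?_⟩
  rw [Submodule.span_singleton_smul_eq (by simpa using hv₀)]
  refine le_antisymm (fun w hw => ?_) ((Submodule.span_singleton_le_iff_mem _ _).2 hv)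
  obtain ⟨c, hc⟩ := h ⟨w, hw⟩
  exact Submodule.mem_span_singleton.2 ⟨c, congrArg Subtype.val hc⟩

/-- A unit normal vector. -/
def normal (K : AffineHyperplane V P) : V := K.exists_normal.choose

theorem norm_normal (K : AffineHyperplane V P) : ‖K.normal‖ = 1 := K.exists_normal.choose_spec.1

theorem orthogonal_direction (K : AffineHyperplane V P) :
    K.space.directionᗮ = Submodule.span ℝ {K.normal} := K.exists_normal.choose_spec.2

theorem inner_normal_self (K : AffineHyperplane V P) : inner ℝ K.normal K.normal = 1 := by
  rw [real_inner_self_eq_norm_sq, K.norm_normal, one_pow]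

theorem mem_direction_iff (K : AffineHyperplane V P) (v : V) :
    v ∈ K.space.direction ↔ inner ℝ K.normal v = 0 := by
  rw [← Submodule.orthogonal_orthogonal K.space.direction, K.orthogonal_direction,
    Submodule.mem_orthogonal_singleton_iff_inner_right]

/-- A point of the hyperplane. -/
def base (K : AffineHyperplane V P) : P := (Classical.choice K.nonempty : K.space)

theorem base_mem (K : AffineHyperplane V P) : K.base ∈ K.space :=
  (Classical.choice K.nonempty : K.space).2

/-- The signed distance from the hyperplane. -/
def height (K : AffineHyperplane V P) (x : P) : ℝ := inner ℝ K.normal (x -ᵥ K.base)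

theorem mem_iff (K : AffineHyperplane V P) (x : P) : x ∈ K.space ↔ K.height x = 0 := by
  rw [height, ← K.mem_direction_iff, AffineSubspace.vsub_right_mem_direction_iff_mem K.base_mem]

theorem height_vadd (K : AffineHyperplane V P) (v : V) (x : P) :
    K.height (v +ᵥ x) = inner ℝ K.normal v + K.height x := by
  rw [height, height, vadd_vsub_assoc, inner_add_right]

theorem height_lineMap (K : AffineHyperplane V P) (x y : P) (r : ℝ) :
    K.height (AffineMap.lineMap x y r) = (1 - r) * K.height x + r * K.height y := by
  have : K.height y = inner ℝ K.normal (y -ᵥ x) + K.height x := by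
    rw [← height_vadd, vsub_vadd]
  rw [AffineMap.lineMap_apply, height_vadd, inner_smul_right, this]
  ring

theorem continuous_height (K : AffineHyperplane V P) : Continuous K.height := by
  unfold height
  fun_prop

theorem reflection_apply (K : AffineHyperplane V P) (x : P) :
    K.reflection x = (-(2 * K.height x) • K.normal) +ᵥ x := by
  have := K.nonempty
  have hm : (-K.height x • K.normal) +ᵥ x ∈ K.space := by
    rw [mem_iff, height_vadd, inner_smul_right, inner_normal_self]
    ring
  have hn : K.height x • K.normal ∈ K.space.directionᗮ := by
    rw [orthogonal_direction]
    exact Submodule.smul_mem _ _ (Submodule.mem_span_singleton_self _)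
  have := EuclideanGeometry.reflection_orthogonal_vadd hm hn
  rw [vadd_vadd, ← add_smul, add_neg_cancel, zero_smul, zero_vadd] at this
  refine this.trans ?_
  rw [vadd_vadd, ← neg_smul, ← add_smul]
  congr 2
  ring

theorem reflection_eq_self_iff (K : AffineHyperplane V P) (x : P) :
    K.reflection x = x ↔ x ∈ K.space :=
  haveI := K.nonempty
  EuclideanGeometry.reflection_eq_self_iff x

theorem reflection_mul_self (K : AffineHyperplane V P) : K.reflection * K.reflection = 1 :=
  haveI := K.nonempty
  AffineIsometryEquiv.ext fun x => EuclideanGeometry.reflection_reflection K.space x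

theorem reflection_apply_reflection (K : AffineHyperplane V P) (x : P) :
    K.reflection (K.reflection x) = x :=
  haveI := K.nonempty
  EuclideanGeometry.reflection_reflection K.space x

theorem height_reflection (K L : AffineHyperplane V P) (x : P) :
    L.height (K.reflection x) = L.height x - 2 * K.height x * inner ℝ L.normal K.normal := by
  rw [reflection_apply, height_vadd, inner_smul_right]
  ring

theorem height_reflection_self (K : AffineHyperplane V P) (x : P) :
    K.height (K.reflection x) = -K.height x := by
  rw [height_reflection, inner_normal_self]
  ring

theorem ext_space {K L : AffineHyperplane V P} (h : K.space = L.space) : K = L := by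
  cases K
  cases L
  cases h
  rfl

theorem reflection_injective :
    Function.Injective (reflection : AffineHyperplane V P → P ≃ᵃⁱ[ℝ] P) := by
  intro K L h
  refine ext_space (AffineSubspace.ext fun x => ?_)
  rw [← reflection_eq_self_iff, h, reflection_eq_self_iff]

theorem finrank_direction (K : AffineHyperplane V P) :
    Module.finrank ℝ K.space.direction + 1 = Module.finrank ℝ V := by
  rw [← K.space.direction.finrank_add_finrank_orthogonal, K.finrank_normal]

theorem eq_of_le {K L : AffineHyperplane V P} (h : K.space ≤ L.space) : K = L := by
  refine ext_space (AffineSubspace.eq_of_direction_eq_of_nonempty_of_le ?_ ⟨_, K.base_mem⟩ h)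
  refine Submodule.eq_of_le_of_finrank_eq (AffineSubspace.direction_le h) ?_
  have := K.finrank_direction
  have := L.finrank_direction
  omega

/-- The image of a hyperplane under an isometry. -/
def map (g : P ≃ᵃⁱ[ℝ] P) (K : AffineHyperplane V P) : AffineHyperplane V P where
  space := K.space.map g.toAffineEquiv.toAffineMap
  nonempty := ⟨⟨g K.base, AffineSubspace.mem_map_of_mem _ K.base_mem⟩⟩
  finrank_normal := by
    have h₁ := (K.space.map g.toAffineEquiv.toAffineMap).direction.finrank_add_finrank_orthogonal
    have h₂ := K.finrank_direction
    have h₃ : Module.finrank ℝ (K.space.map g.toAffineEquiv.toAffineMap).direction =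
        Module.finrank ℝ K.space.direction := by
      rw [AffineSubspace.map_direction]
      exact (Submodule.equivMapOfInjective _ g.toAffineEquiv.linear.injective _).finrank_eq.symm
    omega

theorem apply_mem_map_iff (g : P ≃ᵃⁱ[ℝ] P) (K : AffineHyperplane V P) (x : P) :
    g x ∈ (K.map g).space ↔ x ∈ K.space :=
  AffineSubspace.mem_map_iff_mem_of_injective g.injective

theorem reflection_map (g : P ≃ᵃⁱ[ℝ] P) (K : AffineHyperplane V P) :
    (K.map g).reflection = g * K.reflection * g⁻¹ := by
  have := K.nonempty
  have := (K.map g).nonempty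
  rw [eq_mul_inv_iff_mul_eq]
  refine AffineIsometryEquiv.ext fun x => ?_
  exact EuclideanGeometry.reflection_map K.space g.toAffineIsometry x

/-- The hyperplane separates the points `x` and `y`. -/
def Separates (K : AffineHyperplane V P) (x y : P) : Prop := K.height x * K.height y < 0

theorem not_separates_iff {K : AffineHyperplane V P} {x y : P} (hx : x ∉ K.space)
    (hy : y ∉ K.space) : ¬ K.Separates x y ↔ 0 < K.height x * K.height y := by
  rw [mem_iff] at hx hy
  rw [Separates, not_lt]
  exact ⟨fun h => lt_of_le_of_ne h (mul_ne_zero hx hy).symm, le_of_lt⟩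

theorem separates_iff_xor {K : AffineHyperplane V P} {x y z : P} (hx : x ∉ K.space)
    (hy : y ∉ K.space) (hz : z ∉ K.space) :
    K.Separates x z ↔ Xor (K.Separates x y) (K.Separates y z) := by
  rw [mem_iff] at hx hy hz
  simp only [Separates, Xor]
  rcases lt_or_gt_of_ne hx with hx | hx <;> rcases lt_or_gt_of_ne hy with hy | hy <;>
    rcases lt_or_gt_of_ne hz with hz | hz <;> simp [mul_neg_iff, hx, hy, hz,
      hx.not_gt, hy.not_gt, hz.not_gt]

theorem exists_lineMap_mem {K : AffineHyperplane V P} {x y : P}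
    (h : K.height x * K.height y ≤ 0) :
    ∃ r ∈ Icc (0 : ℝ) 1, AffineMap.lineMap x y r ∈ K.space := by
  by_cases hx : K.height x = 0
  · exact ⟨0, by simp, by rwa [AffineMap.lineMap_apply_zero, mem_iff]⟩
  have hxy : K.height x - K.height y ≠ 0 := by
    intro h'
    rw [← sub_eq_zero.1 h'] at h
    exact hx (mul_self_eq_zero.1 (le_antisymm h (mul_self_nonneg _)))
  refine ⟨K.height x / (K.height x - K.height y), ?_, ?_⟩
  · rcases lt_or_gt_of_ne hx with hx | hx
    · have hy : 0 ≤ K.height y := nonneg_of_mul_nonpos_right h hx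
      exact ⟨div_nonneg_of_nonpos hx.le (by linarith), (div_le_one_of_neg (by linarith)).2 (by linarith)⟩
    · have hy : K.height y ≤ 0 := nonpos_of_mul_nonpos_right h hx
      exact ⟨div_nonneg hx.le (by linarith), (div_le_one (by linarith)).2 (by linarith)⟩
  · rw [mem_iff, height_lineMap]
    field_simp
    ring

theorem lineMap_pos {K : AffineHyperplane V P} {x y : P} (h : 0 < K.height x * K.height y) {r : ℝ}
    (hr : r ∈ Icc (0 : ℝ) 1) : 0 < K.height x * K.height (AffineMap.lineMap x y r) := by
  rw [height_lineMap]
  have hx : 0 < K.height x * K.height x := mul_self_pos.2 (left_ne_zero_of_mul h.ne')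
  obtain hr' | hr' := hr.1.eq_or_lt
  · subst hr'
    simpa using hx
  · have := mul_pos hr' h
    have := mul_nonneg (sub_nonneg.2 hr.2) hx.le
    linarith

/-- Unlike `height`, this description does not depend on the chosen normal vector and base point, so
it can be transported along isometries. -/
theorem separates_iff {K : AffineHyperplane V P} {x y : P} (hx : x ∉ K.space) (hy : y ∉ K.space) :
    K.Separates x y ↔ ∃ r ∈ Icc (0 : ℝ) 1, AffineMap.lineMap x y r ∈ K.space := by
  refine ⟨fun h => exists_lineMap_mem (le_of_lt h), ?_⟩
  rintro ⟨r, hr, h⟩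
  rw [mem_iff] at h
  by_contra hxy
  have := lineMap_pos ((not_separates_iff hx hy).1 hxy) hr
  rw [h, mul_zero] at this
  exact this.false

theorem separates_map_iff {K : AffineHyperplane V P} {x y : P} (g : P ≃ᵃⁱ[ℝ] P) (hx : x ∉ K.space)
    (hy : y ∉ K.space) : (K.map g).Separates (g x) (g y) ↔ K.Separates x y := by
  rw [separates_iff hx hy, separates_iff (by rwa [apply_mem_map_iff]) (by rwa [apply_mem_map_iff])]
  refine exists_congr fun r => and_congr_right fun _ => ?_
  have : AffineMap.lineMap (g x) (g y) r = g (AffineMap.lineMap x y r) :=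
    (g.toAffineEquiv.toAffineMap.apply_lineMap x y r).symm
  rw [this, apply_mem_map_iff]

end AffineHyperplane

end HyperplaneGeometry

/-! ### Chambers and their walls -/

section Chambers

set_option linter.unusedSectionVars false

open Topology Set

variable {V P : Type u} [NormedAddCommGroup V] [InnerProductSpace ℝ V] [FiniteDimensional ℝ V]
  [MetricSpace P] [NormedAddTorsor V P] {W : Subgroup (P ≃ᵃⁱ[ℝ] P)}

theorem properSpace_of_finiteDimensional_torsor (V : Type u) {P : Type u} [NormedAddCommGroup V]
    [InnerProductSpace ℝ V] [FiniteDimensional ℝ V] [MetricSpace P] [NormedAddTorsor V P] :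
    ProperSpace P := by
  have : ProperSpace V := FiniteDimensional.proper ℝ V
  refine ⟨fun x r => ?_⟩
  have : Metric.closedBall x r = (fun v : V => v +ᵥ x) '' Metric.closedBall 0 r := by
    ext y
    constructor
    · intro hy
      exact ⟨y -ᵥ x, by simpa [dist_eq_norm_vsub V] using hy, vsub_vadd _ _⟩
    · rintro ⟨v, hv, rfl⟩
      simpa using hv
  rw [this]
  exact (isCompact_closedBall _ _).image (by fun_prop)

theorem continuous_lineMap (x y : P) :
    Continuous fun r : ℝ => (AffineMap.lineMap x y r : P) := by
  simp only [AffineMap.lineMap_apply]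
  fun_prop

theorem map_mem_reflectingHyperplanes {K : AffineHyperplane V P} {g : P ≃ᵃⁱ[ℝ] P} (hg : g ∈ W)
    (hK : K ∈ reflectingHyperplanes W) : K.map g ∈ reflectingHyperplanes W := by
  change (K.map g).reflection ∈ W
  rw [AffineHyperplane.reflection_map]
  exact mul_mem (mul_mem hg hK) (inv_mem hg)

theorem apply_mem_hyperplaneComplement {x : P} {g : P ≃ᵃⁱ[ℝ] P} (hg : g ∈ W)
    (hx : x ∈ hyperplaneComplement W) : g x ∈ hyperplaneComplement W := by
  intro K hK hgx
  refine hx _ (map_mem_reflectingHyperplanes (inv_mem hg) hK) ?_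
  have h := (K.apply_mem_map_iff g⁻¹ (g x)).2 hgx
  have hx' : g⁻¹ (g x) = x := g.symm_apply_apply x
  rwa [hx'] at h

namespace IsReflectionGroup

variable (hW : IsReflectionGroup W)

include hW

/-- A reflection fixes the points of its hyperplane, so it moves `B` to a set that meets `B`. -/
theorem finite_of_isCompact {B : Set P} (hB : IsCompact B) :
    {K | K ∈ reflectingHyperplanes W ∧ ∃ x ∈ B, x ∈ K.space}.Finite := by
  refine ((hW.properlyDiscontinuous B hB).preimage
    AffineHyperplane.reflection_injective.injOn).subset ?_
  rintro K ⟨hK, x, hxB, hx⟩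
  exact ⟨hK, x, ⟨x, hxB, (K.reflection_eq_self_iff x).2 hx⟩, hxB⟩

theorem finite_separates (x y : P) :
    {K | K ∈ reflectingHyperplanes W ∧ K.Separates x y}.Finite := by
  refine (hW.finite_of_isCompact ((isCompact_Icc (a := (0 : ℝ)) (b := 1)).image
    (continuous_lineMap x y))).subset ?_
  rintro K ⟨hK, h⟩
  obtain ⟨r, hr, hr'⟩ := AffineHyperplane.exists_lineMap_mem (le_of_lt h)
  exact ⟨hK, _, ⟨r, hr, rfl⟩, hr'⟩

/-- Finitely many hyperplanes meet the unit ball around `z`, and each of them not through `z` is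
avoided near `z`. Any other would have to cross the segment from `z` to `z'`, which stays in the
ball. -/
theorem eventually_pos (z : P) : ∀ᶠ z' in 𝓝 z, ∀ K ∈ reflectingHyperplanes W, z ∉ K.space →
    0 < K.height z * K.height z' := by
  have := properSpace_of_finiteDimensional_torsor V (P := P)
  have hfin := hW.finite_of_isCompact (isCompact_closedBall z 1)
  have h₁ : ∀ᶠ z' in 𝓝 z, ∀ K ∈ {K | K ∈ reflectingHyperplanes W ∧
      ∃ x ∈ Metric.closedBall z 1, x ∈ K.space}, z ∉ K.space → 0 < K.height z * K.height z' := by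
    rw [Filter.eventually_all_finite hfin]
    intro K _
    by_cases hz : z ∈ K.space
    · simp [hz]
    · rw [K.mem_iff] at hz
      have hc : Continuous fun z' => K.height z * K.height z' :=
        continuous_const.mul K.continuous_height
      filter_upwards [hc.continuousAt.eventually (lt_mem_nhds (mul_self_pos.2 hz))] with z' hz' _
      exact hz'
  filter_upwards [h₁, Metric.closedBall_mem_nhds z one_pos] with z' hz' hball K hK hz
  by_contra hneg
  obtain ⟨r, hr, hr'⟩ := AffineHyperplane.exists_lineMap_mem (not_lt.1 hneg)
  refine hneg (hz' K ⟨hK, _, ?_, hr'⟩ hz)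
  rw [Metric.mem_closedBall, dist_lineMap_left, Real.norm_of_nonneg hr.1]
  rw [Metric.mem_closedBall, dist_comm] at hball
  exact mul_le_one₀ hr.2 dist_nonneg hball

/-- Heights have constant sign on a connected set avoiding the hyperplanes; conversely, points on
equal sides are joined by a segment that avoids them. -/
theorem mem_isAlcove_iff {C : Set P} (hC : IsAlcove W C) {x y : P} (hx : x ∈ C) :
    y ∈ C ↔ ∀ K ∈ reflectingHyperplanes W, 0 < K.height x * K.height y := by
  obtain ⟨x₁, hx₁, rfl⟩ := hC
  rw [connectedComponentIn_eq hx]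
  have hx' := connectedComponentIn_subset _ _ hx
  constructor
  · intro hy K hK
    by_contra hneg
    have hpre : IsPreconnected (connectedComponentIn (hyperplaneComplement W) x) :=
      isPreconnected_connectedComponentIn
    have hne : ∀ z ∈ connectedComponentIn (hyperplaneComplement W) x, K.height z ≠ 0 := by
      intro z hz hz'
      exact connectedComponentIn_subset _ _ hz K hK ((K.mem_iff z).2 hz')
    have hx0 := mem_connectedComponentIn hx'
    rcases lt_or_gt_of_ne (hne x hx0) with h | h
    · have hy0 : 0 ≤ K.height y := nonneg_of_mul_nonpos_right (not_lt.1 hneg) h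
      obtain ⟨z, hz, hz'⟩ := hpre.intermediate_value hx0 hy K.continuous_height.continuousOn
        ⟨h.le, hy0⟩
      exact hne z hz hz'
    · have hy0 : K.height y ≤ 0 := nonpos_of_mul_nonpos_right (not_lt.1 hneg) h
      obtain ⟨z, hz, hz'⟩ := hpre.intermediate_value hy hx0 K.continuous_height.continuousOn
        ⟨hy0, h.le⟩
      exact hne z hz hz'
  · intro h
    have hpre : IsPreconnected ((fun r : ℝ => (AffineMap.lineMap x y r : P)) '' Icc 0 1) :=
      isPreconnected_Icc.image _ (continuous_lineMap x y).continuousOn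
    refine hpre.subset_connectedComponentIn ⟨0, by simp, by simp⟩ ?_ ⟨1, by simp, by simp⟩
    rintro _ ⟨r, hr, rfl⟩ K hK hK'
    have := AffineHyperplane.lineMap_pos (h K hK) hr
    rw [(K.mem_iff _).1 hK', mul_zero] at this
    exact this.false

end IsReflectionGroup

/-- The chamber of `x`. -/
def chamber (W : Subgroup (P ≃ᵃⁱ[ℝ] P)) (x : P) : Set P :=
  {y | ∀ K ∈ reflectingHyperplanes W, 0 < K.height x * K.height y}

theorem mem_chamber_self {x : P} (hx : x ∈ hyperplaneComplement W) : x ∈ chamber W x :=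
  fun K hK => mul_self_pos.2 fun h => hx K hK ((K.mem_iff x).2 h)

theorem nonneg_of_mem_closure_chamber {x y : P} (hy : y ∈ closure (chamber W x))
    {K : AffineHyperplane V P} (hK : K ∈ reflectingHyperplanes W) :
    0 ≤ K.height x * K.height y := by
  have hcl : IsClosed {y | 0 ≤ K.height x * K.height y} :=
    isClosed_le continuous_const (continuous_const.mul K.continuous_height)
  exact closure_minimal (fun y hy => (hy K hK).le) hcl hy

theorem notMem_space_of_mem_chamber {x y : P} (hy : y ∈ chamber W x)
    {K : AffineHyperplane V P} (hK : K ∈ reflectingHyperplanes W) : y ∉ K.space := by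
  rw [K.mem_iff]
  exact right_ne_zero_of_mul (hy K hK).ne'

theorem exists_height_ne_zero {x : P} {K L : AffineHyperplane V P}
    (hK : K ∈ alcoveWalls W (chamber W x)) (hKL : K ≠ L) :
    ∃ p ∈ K.space, p ∈ closure (chamber W x) ∧ L.height p ≠ 0 := by
  by_contra! h
  refine hKL (AffineHyperplane.eq_of_le ?_)
  rw [← hK.2, affineSpan_le]
  exact fun p hp => (L.mem_iff p).2 (h p hp.1 hp.2)

/-- A wall is the only hyperplane that separates the points of a chamber from their images under
the reflection in the wall. -/
theorem height_reflection_pos {x : P} (hx : x ∈ hyperplaneComplement W) {K L : AffineHyperplane V P}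
    (hK : K ∈ alcoveWalls W (chamber W x)) (hL : L ∈ reflectingHyperplanes W) (hKL : K ≠ L) {y : P}
    (hy : y ∈ chamber W x) : 0 < L.height x * L.height (K.reflection y) := by
  -- `p` lies on the wall but not on `L`. Points `c` of the chamber close to `p` have reflections
  -- close to `p`, hence on the side of `x`. The reflections of `c` and `y` are on the same side of
  -- `L`, because no hyperplane separates `c` from `y`.
  obtain ⟨p, hpK, hpC, hp⟩ := exists_height_ne_zero hK hKL
  have hx0 : L.height x ≠ 0 := fun h => hx L hL ((L.mem_iff x).2 h)
  have hp' : 0 < L.height x * L.height p :=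
    lt_of_le_of_ne (nonneg_of_mem_closure_chamber hpC hL) (mul_ne_zero hx0 hp).symm
  have hcont : Continuous fun y => L.height x * L.height (K.reflection y) :=
    continuous_const.mul (L.continuous_height.comp K.reflection.continuous)
  have hev : ∀ᶠ y in 𝓝 p, 0 < L.height x * L.height (K.reflection y) := by
    refine hcont.continuousAt.eventually (lt_mem_nhds ?_)
    beta_reduce
    rwa [(K.reflection_eq_self_iff p).2 hpK]
  obtain ⟨c, hc, hcC⟩ := mem_closure_iff_nhds.1 hpC _ hev
  change 0 < L.height x * L.height (K.reflection c) at hc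
  have hKL' := map_mem_reflectingHyperplanes hK.1 hL
  have hmem : ∀ z ∈ chamber W x, K.reflection z ∉ L.space := fun z hz =>
    apply_mem_hyperplaneComplement hK.1 (fun M hM => notMem_space_of_mem_chamber hz hM) L hL
  have hcc : ¬ L.Separates (K.reflection c) (K.reflection y) := by
    rw [← AffineHyperplane.separates_map_iff K.reflection (hmem c hcC) (hmem y hy),
      K.reflection_apply_reflection, K.reflection_apply_reflection,
      AffineHyperplane.not_separates_iff (notMem_space_of_mem_chamber hcC hKL')
      (notMem_space_of_mem_chamber hy hKL')]
    have := mul_pos (hcC _ hKL') (hy _ hKL')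
    nlinarith [sq_nonneg ((L.map K.reflection).height x)]
  rw [AffineHyperplane.not_separates_iff (hmem c hcC) (hmem y hy)] at hcc
  have := mul_pos hc hcc
  nlinarith [sq_nonneg (L.height (K.reflection c))]

/-- The vectors normal to distinct walls of a chamber that point to the chamber form an obtuse
angle. -/
theorem inner_normal_nonpos {x : P} (hx : x ∈ hyperplaneComplement W) {K L : AffineHyperplane V P}
    (hK : K ∈ alcoveWalls W (chamber W x)) (hL : L ∈ alcoveWalls W (chamber W x)) (hKL : K ≠ L) :
    inner ℝ L.normal K.normal * L.height x * K.height x ≤ 0 := by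
  -- Reflecting a point `p` of the wall `L` in `K` gives a point weakly on the side of `x`. Its
  -- height over `L` is `-2` times the height of `p` over `K` times the inner product, which fixes
  -- the sign of the latter.
  obtain ⟨p, hpL, hpC, hp⟩ := exists_height_ne_zero hL hKL.symm
  rw [L.mem_iff] at hpL
  have hx0 : K.height x ≠ 0 := fun h => hx K hK.1 ((K.mem_iff x).2 h)
  have hp' : 0 < K.height x * K.height p :=
    lt_of_le_of_ne (nonneg_of_mem_closure_chamber hpC hK.1) (mul_ne_zero hx0 hp).symm
  have hcl : IsClosed {y | 0 ≤ L.height x * L.height (K.reflection y)} :=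
    isClosed_le continuous_const
      (continuous_const.mul (L.continuous_height.comp K.reflection.continuous))
  have h : 0 ≤ L.height x * L.height (K.reflection p) :=
    closure_minimal (fun y hy => (height_reflection_pos hx hK hL.1 hKL hy).le) hcl hpC
  rw [K.height_reflection, hpL] at h
  by_contra! hneg
  have := mul_pos hneg hp'
  have : 0 < inner ℝ L.normal K.normal * L.height x * K.height p * (K.height x * K.height x) := by
    linarith
  have := pos_of_mul_pos_left this (mul_self_nonneg _)
  linarith

/-- Unit vectors with nonpositive inner products have distance at least `1`, and the unit sphere is
compact. So there are only finitely many inward normals. -/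
theorem finite_alcoveWalls_chamber {x : P} (hx : x ∈ hyperplaneComplement W) :
    (alcoveWalls W (chamber W x)).Finite := by
  by_contra hinf
  have hinf' : Infinite (alcoveWalls W (chamber W x)) := Set.infinite_coe_iff.2 hinf
  let e := Infinite.natEmbedding (alcoveWalls W (chamber W x))
  let σ : AffineHyperplane V P → ℝ := fun K => K.height x / |K.height x|
  have hx0 : ∀ n, (e n).1.height x ≠ 0 := fun n h => hx _ (e n).2.1 (((e n).1.mem_iff x).2 h)
  have hσ : ∀ n, |σ (e n).1| = 1 := fun n => by
    rw [abs_div, abs_abs, div_self (abs_ne_zero.2 (hx0 n))]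
  let f : ℕ → V := fun n => σ (e n).1 • (e n).1.normal
  have hf : ∀ n, ‖f n‖ = 1 := fun n => by
    rw [norm_smul, Real.norm_eq_abs, hσ, AffineHyperplane.norm_normal, one_mul]
  have hff : ∀ m n, m ≠ n → 1 ≤ dist (f m) (f n) := by
    intro m n hmn
    have hne : (e n).1 ≠ (e m).1 := fun h => hmn (e.injective (Subtype.ext h)).symm
    have h₁ := inner_normal_nonpos hx (e n).2 (e m).2 hne
    have h₂ : inner ℝ (f m) (f n) ≤ 0 := by
      rw [real_inner_smul_left, real_inner_smul_right]
      have : σ (e m).1 * (σ (e n).1 * inner ℝ (e m).1.normal (e n).1.normal) =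
          (inner ℝ (e m).1.normal (e n).1.normal * (e m).1.height x * (e n).1.height x) /
            (|(e m).1.height x| * |(e n).1.height x|) := by
        simp only [σ]
        field_simp
      rw [this]
      exact div_nonpos_of_nonpos_of_nonneg h₁ (by positivity)
    have h₃ := norm_sub_sq_real (f m) (f n)
    rw [hf, hf] at h₃
    rw [dist_eq_norm]
    nlinarith [norm_nonneg (f m - f n)]
  have : ProperSpace V := FiniteDimensional.proper ℝ V
  obtain ⟨a, -, φ, hφ, hlim⟩ := (isCompact_sphere (0 : V) 1).tendsto_subseq (x := f)
    fun n => by simpa using hf n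
  obtain ⟨N, hN⟩ := Metric.cauchySeq_iff'.1 hlim.cauchySeq 1 one_pos
  exact (hff _ _ (hφ.injective.ne (Nat.succ_ne_self N))).not_gt (hN (N + 1) (Nat.le_succ N))

end Chambers

/-! ### Existence of separating walls and generation by the walls -/

section WallExistence

set_option linter.unusedSectionVars false

open Topology Set

theorem dense_biInter_of_finite {X ι : Type*} [TopologicalSpace X] {s : Set ι} (hs : s.Finite)
    {U : ι → Set X} (ho : ∀ i ∈ s, IsOpen (U i)) (hd : ∀ i ∈ s, Dense (U i)) :
    Dense (⋂ i ∈ s, U i) := by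
  induction s, hs using Set.Finite.induction_on with
  | empty => simp
  | @insert a s _ hs ih =>
    rw [Set.biInter_insert]
    exact (hd a (Set.mem_insert _ _)).inter_of_isOpen_left
      (ih (fun i hi => ho i (Set.mem_insert_of_mem _ hi))
        fun i hi => hd i (Set.mem_insert_of_mem _ hi)) (ho a (Set.mem_insert _ _))

variable {V P : Type u} [NormedAddCommGroup V] [InnerProductSpace ℝ V] [FiniteDimensional ℝ V]
  [MetricSpace P] [NormedAddTorsor V P] {W : Subgroup (P ≃ᵃⁱ[ℝ] P)}

theorem tendsto_lineMap_nhds (x y : P) :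
    Filter.Tendsto (fun r : ℝ => (AffineMap.lineMap x y r : P)) (𝓝[>] 0) (𝓝 x) := by
  have := (continuous_lineMap x y).tendsto 0
  rw [AffineMap.lineMap_apply_zero] at this
  exact this.mono_left nhdsWithin_le_nhds

namespace AffineHyperplane

/-- The segments from a generic point to `y` meet two hyperplanes at different times. -/
theorem dense_ne {K L : AffineHyperplane V P} (hKL : K ≠ L) {y : P} (hK : y ∉ K.space) :
    Dense {x | K.height x * L.height y ≠ L.height x * K.height y} := by
  rw [K.mem_iff] at hK
  obtain ⟨z, hz, hz'⟩ : ∃ z ∈ K.space, z ∉ L.space := by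
    by_contra! h
    exact hKL (eq_of_le h)
  rw [mem_iff] at hz hz'
  intro x
  by_cases hx : K.height x * L.height y = L.height x * K.height y
  · refine mem_closure_of_tendsto (tendsto_lineMap_nhds x z) ?_
    filter_upwards [self_mem_nhdsWithin] with r hr
    simp only [height_lineMap, hz]
    intro h
    have : r * (L.height z * K.height y) = 0 := by linear_combination (1 - r) * hx - h
    exact mul_ne_zero (ne_of_gt hr) (mul_ne_zero hz' hK) this
  · exact subset_closure hx

theorem isOpen_ne (K L : AffineHyperplane V P) (y : P) :
    IsOpen {x | K.height x * L.height y ≠ L.height x * K.height y} :=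
  isOpen_ne_fun (K.continuous_height.mul continuous_const) (L.continuous_height.mul continuous_const)

end AffineHyperplane

namespace IsReflectionGroup

variable (hW : IsReflectionGroup W)

include hW

/-- A hyperplane is a wall of a chamber if it contains a point which is on no other hyperplane and
on the side of the chamber for all the other hyperplanes. -/
theorem mem_alcoveWalls {x z : P} {K : AffineHyperplane V P}
    (hx : x ∈ hyperplaneComplement W) (hK : K ∈ reflectingHyperplanes W)
    (hz : z ∈ K.space) (h : ∀ L ∈ reflectingHyperplanes W, L ≠ K → 0 < L.height x * L.height z) :
    K ∈ alcoveWalls W (chamber W x) := by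
  have hev : ∀ᶠ z' in 𝓝 z, ∀ L ∈ reflectingHyperplanes W, L ≠ K →
      0 < L.height x * L.height z' := by
    filter_upwards [hW.eventually_pos z] with z' hz' L hL hLK
    have h₁ := h L hL hLK
    have h₂ := hz' L hL fun h' => by
      rw [(L.mem_iff z).1 h', mul_zero] at h₁
      exact h₁.false
    have := mul_pos h₁ h₂
    nlinarith [sq_nonneg (L.height z)]
  have hcl : ∀ᶠ z' in 𝓝 z, z' ∈ K.space → z' ∈ closure (chamber W x) := by
    filter_upwards [hev.eventually_nhds] with z' hz' hz'K
    refine mem_closure_of_tendsto (tendsto_lineMap_nhds z' x) ?_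
    filter_upwards [(tendsto_lineMap_nhds z' x).eventually hz', self_mem_nhdsWithin] with r hr hr0 L hL
    by_cases hLK : L = K
    · subst hLK
      rw [AffineHyperplane.height_lineMap, (L.mem_iff z').1 hz'K]
      have := mul_pos (mem_chamber_self hx L hL) hr0
      linarith
    · exact hr L hL hLK
  refine ⟨hK, le_antisymm (affineSpan_le.2 inter_subset_left) fun w hw => ?_⟩
  -- Near `z` the whole hyperplane lies in the closure of the chamber. A point `w` of it is reached
  -- by shrinking towards `z` by a small factor `r` and extending the line again by `r⁻¹`.
  have h₁ := ((tendsto_lineMap_nhds z w).eventually hcl).and self_mem_nhdsWithin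
  obtain ⟨r, hr, hr0⟩ := h₁.exists
  have hmem : (AffineMap.lineMap z w r : P) ∈ K.space := AffineMap.lineMap_mem r hz hw
  have h₂ : (AffineMap.lineMap z w r : P) ∈ affineSpan ℝ ((K.space : Set P) ∩ closure (chamber W x)) :=
    subset_affineSpan ℝ _ ⟨hmem, hr hmem⟩
  have h₃ : z ∈ affineSpan ℝ ((K.space : Set P) ∩ closure (chamber W x)) :=
    subset_affineSpan ℝ _ ⟨hz, hcl.self_of_nhds hz⟩
  have h₄ := AffineMap.lineMap_mem r⁻¹ h₃ h₂
  rwa [AffineMap.lineMap_lineMap_right, inv_mul_cancel₀ (ne_of_gt hr0),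
    AffineMap.lineMap_apply_one] at h₄

/-- If a point is separated from `x`, then it is separated from `x` by a wall. -/
theorem exists_wall_separates {x y : P} (hx : x ∈ hyperplaneComplement W)
    (hy : y ∈ hyperplaneComplement W)
    (h : ∃ K ∈ reflectingHyperplanes W, K.Separates x y) :
    ∃ K ∈ alcoveWalls W (chamber W x), K.Separates x y := by
  have hfin := hW.finite_separates x y
  set F := {K | K ∈ reflectingHyperplanes W ∧ K.Separates x y} with hF
  -- For a generic starting point in the chamber, the segment to `y` meets the finitely many
  -- separating hyperplanes at distinct times.
  have hdense : Dense (⋂ q ∈ F.offDiag, {x | q.1.height x * q.2.height y ≠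
      q.2.height x * q.1.height y}) := by
    refine dense_biInter_of_finite hfin.offDiag (fun q _ => AffineHyperplane.isOpen_ne _ _ _) ?_
    intro q hq
    exact AffineHyperplane.dense_ne hq.2.2 (hy _ hq.1.1)
  have hnhds : chamber W x ∈ 𝓝 x := by
    filter_upwards [hW.eventually_pos x] with x' hx' K hK
    exact hx' K hK (hx K hK)
  obtain ⟨x', hx'C, hx'⟩ := mem_closure_iff_nhds.1 (hdense x) _ hnhds
  have hne : ∀ K ∈ F, ∀ L ∈ F, K ≠ L →
      K.height x' * L.height y ≠ L.height x' * K.height y := by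
    intro K hK L hL hKL
    exact Set.mem_iInter₂.1 hx' (K, L) ⟨hK, hL, hKL⟩
  have hF' : ∀ K ∈ F, K.height x' * K.height y < 0 := by
    intro K hK
    have h₁ : K.height x * K.height y < 0 := hK.2
    have h₂ := mul_neg_of_pos_of_neg (hx'C K hK.1) h₁
    by_contra! h₃
    nlinarith [mul_nonneg (mul_self_nonneg (K.height x)) h₃]
  obtain ⟨K₀, hK₀⟩ := h
  -- The quotient is the time at which the segment from `x'` to `y` meets `K`. At the first such
  -- time only one hyperplane is met, so it is a wall.
  obtain ⟨K, hK, hmin⟩ := Set.exists_min_image F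
    (fun K => K.height x' / (K.height x' - K.height y)) hfin ⟨K₀, hK₀⟩
  refine ⟨K, ?_, hK.2⟩
  have hdiv : ∀ L ∈ F, L.height x' - L.height y ≠ 0 := by
    intro L hL h₀
    have := hF' L hL
    rw [← sub_eq_zero.1 h₀] at this
    exact (mul_self_nonneg _).not_gt this
  set r := K.height x' / (K.height x' - K.height y) with hr
  have hr01 : r ∈ Icc (0 : ℝ) 1 := by
    rcases mul_neg_iff.1 (hF' K hK) with ⟨h₁, h₂⟩ | ⟨h₁, h₂⟩
    · exact ⟨div_nonneg h₁.le (by linarith), (div_le_one (by linarith)).2 (by linarith)⟩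
    · exact ⟨div_nonneg_of_nonpos h₁.le (by linarith),
        (div_le_one_of_neg (by linarith)).2 (by linarith)⟩
  refine hW.mem_alcoveWalls (z := AffineMap.lineMap x' y r) hx hK.1 ?_ ?_
  · rw [K.mem_iff, AffineHyperplane.height_lineMap, hr]
    have := hdiv K hK
    field_simp
    ring
  · intro L hL hLK
    suffices 0 < L.height x' * L.height (AffineMap.lineMap x' y r) by
      have h₁ := mul_pos (hx'C L hL) this
      by_contra! h₂
      nlinarith [mul_nonneg (mul_self_nonneg (L.height x')) (neg_nonneg.2 h₂)]
    by_cases hLF : L ∈ F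
    · have hlt : r < L.height x' / (L.height x' - L.height y) := by
        refine lt_of_le_of_ne (hmin L hLF) fun heq => hne K hK L hLF hLK.symm ?_
        rw [hr, div_eq_div_iff (hdiv K hK) (hdiv L hLF)] at heq
        linarith
      rw [AffineHyperplane.height_lineMap]
      rcases mul_neg_iff.1 (hF' L hLF) with ⟨h₁, h₂⟩ | ⟨h₁, h₂⟩
      · rw [lt_div_iff₀ (by linarith)] at hlt
        exact mul_pos h₁ (by linarith)
      · rw [lt_div_iff_of_neg (by linarith)] at hlt
        exact mul_pos_of_neg_of_neg h₁ (by linarith)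
    · refine AffineHyperplane.lineMap_pos ?_ hr01
      have h₁ : 0 < L.height x * L.height y := (AffineHyperplane.not_separates_iff (hx L hL)
        (hy L hL)).1 fun h => hLF ⟨hL, h⟩
      have h₂ := mul_pos (hx'C L hL) h₁
      by_contra! h₃
      nlinarith [mul_nonneg (mul_self_nonneg (L.height x)) (neg_nonneg.2 h₃)]

/-- The reflection cocycle of a chamber of a reflection group. -/
theorem reflectionCocycle {x : P} (hx : x ∈ hyperplaneComplement W) :
    ReflectionCocycle
      (fun K : alcoveWalls W (chamber W x) => (⟨K.1.reflection, K.2.1⟩ : W))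
      (fun w => {t | ∃ K : AffineHyperplane V P, t.1 = K.reflection ∧ K.Separates x (w.1 x)}) where
  mul_self K := Subtype.ext K.1.reflection_mul_self
  eq_singleton K := by
    ext t
    constructor
    · rintro ⟨L, hL, hLs⟩
      have hL' : L ∈ reflectingHyperplanes W := show L.reflection ∈ W from hL ▸ t.2
      by_contra hne
      have hKL : K.1 ≠ L := by
        rintro rfl
        exact hne (Subtype.ext hL)
      exact (height_reflection_pos hx K.2 hL' hKL (mem_chamber_self hx)).not_gt hLs
    · rintro rfl
      refine ⟨K.1, rfl, ?_⟩
      rw [AffineHyperplane.Separates]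
      change K.1.height x * K.1.height (K.1.reflection x) < 0
      rw [K.1.height_reflection_self]
      have := mem_chamber_self hx K.1 K.2.1
      linarith
  -- A hyperplane separates `x` from `u v x` if it separates exactly one of the pairs `x, u x` and
  -- `u x, u v x`; the second pair is the translate by `u` of `x, v x`.
  mem_mul_iff u v t := by
    by_cases ht : ∃ K : AffineHyperplane V P, t.1 = K.reflection
    · obtain ⟨K, hK⟩ := ht
      have hK' : K ∈ reflectingHyperplanes W := show K.reflection ∈ W from hK ▸ t.2
      have h₁ : ∀ w : W, t ∈ {t : W | ∃ K : AffineHyperplane V P, t.1 = K.reflection ∧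
          K.Separates x (w.1 x)} ↔ K.Separates x (w.1 x) := by
        intro w
        refine ⟨?_, fun h => ⟨K, hK, h⟩⟩
        rintro ⟨L, hL, h⟩
        rwa [AffineHyperplane.reflection_injective (hK.symm.trans hL)]
      have h₂ : (u⁻¹ * t * u).1 = (K.map u.1⁻¹).reflection := by
        rw [AffineHyperplane.reflection_map, ← hK, inv_inv]
        rfl
      have h₃ : u⁻¹ * t * u ∈ {t : W | ∃ K : AffineHyperplane V P, t.1 = K.reflection ∧
          K.Separates x (v.1 x)} ↔ (K.map u.1⁻¹).Separates x (v.1 x) := by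
        refine ⟨?_, fun h => ⟨_, h₂, h⟩⟩
        rintro ⟨L, hL, h⟩
        rwa [AffineHyperplane.reflection_injective (h₂.symm.trans hL)]
      have hu := apply_mem_hyperplaneComplement u.2 hx
      have huv := apply_mem_hyperplaneComplement (u * v).2 hx
      have h₄ := AffineHyperplane.separates_map_iff u.1⁻¹ (hu K hK') (huv K hK')
      have h₅ : (u.1⁻¹ : P ≃ᵃⁱ[ℝ] P) (u.1 x) = x := u.1.symm_apply_apply x
      have h₆ : (u.1⁻¹ : P ≃ᵃⁱ[ℝ] P) ((u * v).1 x) = v.1 x := u.1.symm_apply_apply (v.1 x)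
      rw [h₅, h₆] at h₄
      rw [h₁, h₁, h₃, h₄]
      exact AffineHyperplane.separates_iff_xor (hx K hK') (hu K hK') (huv K hK')
    · have h₁ : ∀ w : W, t ∉ {t : W | ∃ K : AffineHyperplane V P, t.1 = K.reflection ∧
          K.Separates x (w.1 x)} := fun w ⟨K, hK, _⟩ => ht ⟨K, hK⟩
      have h₂ : u⁻¹ * t * u ∉ {t : W | ∃ K : AffineHyperplane V P, t.1 = K.reflection ∧
          K.Separates x (v.1 x)} := by
        rintro ⟨K, hK, -⟩
        refine ht ⟨K.map u.1, ?_⟩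
        rw [AffineHyperplane.reflection_map, ← hK]
        change t.1 = u.1 * (u.1⁻¹ * t.1 * u.1) * u.1⁻¹
        group
      simp only [h₁, h₂, Xor, false_and, or_self]

theorem closure_range_reflection {x : P} (hx : x ∈ hyperplaneComplement W) :
    Subgroup.closure (Set.range
      (fun K : alcoveWalls W (chamber W x) => (⟨K.1.reflection, K.2.1⟩ : W))) = ⊤ := by
  refine (hW.reflectionCocycle hx).closure_range_eq_top (fun w => ?_) (fun w => ?_) ?_
  · refine Set.Finite.of_finite_image (f := Subtype.val) (Set.Finite.subset
      ((hW.finite_separates x (w.1 x)).image AffineHyperplane.reflection) ?_)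
      Subtype.val_injective.injOn
    rintro _ ⟨t, ⟨K, hK, h⟩, rfl⟩
    exact ⟨K, ⟨show K.reflection ∈ W from hK ▸ t.2, h⟩, hK.symm⟩
  · rintro ⟨t, K, hK, h⟩
    obtain ⟨L, hL, hL'⟩ := hW.exists_wall_separates hx
      (apply_mem_hyperplaneComplement w.2 hx) ⟨K, show K.reflection ∈ W from hK ▸ t.2, h⟩
    exact ⟨⟨L, hL⟩, L, rfl, hL'⟩
  · refine Subgroup.map_injective W.subtype_injective ?_
    rw [MonoidHom.map_closure, ← MonoidHom.range_eq_map, Subgroup.range_subtype]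
    conv_rhs => rw [← hW.closure_reflections]
    congr 1
    ext g
    constructor
    · rintro ⟨t, ⟨K, hK, -⟩, rfl⟩
      exact ⟨t.2, K, hK⟩
    · rintro ⟨hg, K, rfl⟩
      refine ⟨⟨K.reflection, hg⟩, ⟨K, rfl, ?_⟩, rfl⟩
      change K.height x * K.height (K.reflection x) < 0
      rw [K.height_reflection_self]
      have := mem_chamber_self hx K hg
      linarith

end IsReflectionGroup

end WallExistence

/-! ### Parabolic subgroups and the conclusion -/

section ReflectionGroupColimit

theorem Subgroup.subgroupOf_closure_image {G α : Type*} [Group G] (W : Subgroup G) (s : α → W)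
    (c : Set α) : (Subgroup.closure ((fun a => (s a).1) '' c)).subgroupOf W =
      Subgroup.closure (s '' c) := by
  have : (fun a => (s a).1) '' c = W.subtype '' (s '' c) := by
    rw [Set.image_image]
    rfl
  rw [this, ← MonoidHom.map_closure]
  exact Subgroup.comap_map_eq_self_of_injective W.subtype_injective _

namespace SSet

theorem isHomotopyColimitDiagram_of_descentSystem {α G : Type u} [Group G] [Finite α]
    (Γ : Set α → Subgroup G) (hΓ : Monotone Γ) {W : Subgroup G} (hW : Γ Set.univ = W)
    (𝒟 : DescentSystem fun I => (Γ I).subgroupOf W) :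
    IsHomotopyColimitDiagram (subgroupFunctor Γ hΓ ⋙ classifyingSpace) := by
  subst hW
  exact isHomotopyColimitDiagram_of_anodyneExtensions Γ hΓ 𝒟.anodyneExtensions

end SSet

/-- The classifying spaces of the parabolic subgroups of an infinite reflection group form a
homotopy colimit diagram. -/
theorem IsReflectionGroup.isHomotopyColimitDiagram {V P : Type u} [NormedAddCommGroup V]
    [InnerProductSpace ℝ V] [FiniteDimensional ℝ V] [MetricSpace P] [NormedAddTorsor V P]
    {W : Subgroup (P ≃ᵃⁱ[ℝ] P)} (hW : IsReflectionGroup W) [Infinite W] {x : P}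
    (hx : x ∈ hyperplaneComplement W) :
    IsHomotopyColimitDiagram
      (reflectionSubgroupFunctor (alcoveWalls W (chamber W x)) ⋙ classifyingSpace) := by
  set S := alcoveWalls W (chamber W x)
  have : Finite S := finite_alcoveWalls_chamber hx
  let s : S → W := fun K => ⟨K.1.reflection, K.2.1⟩
  have hs : ∀ I : Set S, reflectionSubgroup (Subtype.val '' I) =
      Subgroup.closure ((fun K => (s K).1) '' I) := fun I => by
    rw [reflectionSubgroup, Set.image_image]
  have hgen := hW.closure_range_reflection hx
  have huniv : reflectionSubgroup (Subtype.val '' (Set.univ : Set S)) = W := by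
    have h := congrArg (Subgroup.map W.subtype) hgen
    rw [MonoidHom.map_closure, ← MonoidHom.range_eq_map, Subgroup.range_subtype, ← Set.image_univ,
      Set.image_image] at h
    rw [hs]
    exact h
  have heq : (fun I : Set S => (reflectionSubgroup (Subtype.val '' I)).subgroupOf W) =
      fun I => Subgroup.closure (s '' I) := by
    funext I
    rw [hs, Subgroup.subgroupOf_closure_image]
  exact SSet.isHomotopyColimitDiagram_of_descentSystem
    (fun I : Set S => reflectionSubgroup (Subtype.val '' I))
    (fun _ _ h => Subgroup.closure_mono (Set.image_mono (Set.image_mono h))) huniv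
    (heq ▸ (hW.reflectionCocycle hx).descentSystem hgen)

end ReflectionGroupColimit

theorem corollary4p2 {V P : Type u} [NormedAddCommGroup V] [InnerProductSpace ℝ V]
    [FiniteDimensional ℝ V] [MetricSpace P] [NormedAddTorsor V P]
    (W : Subgroup (P ≃ᵃⁱ[ℝ] P)) (hW : IsReflectionGroup W) (hinf : Infinite W)
    (hess : IsEssential W) (hirr : IsIrreducibleReflectionGroup W)
    (C : Set P) (hC : IsAlcove W C) :
    IsHomotopyColimitDiagram (reflectionSubgroupFunctor (alcoveWalls W C) ⋙ classifyingSpace) := by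
  obtain ⟨x, hx, rfl⟩ := id hC
  have hC' : connectedComponentIn (hyperplaneComplement W) x = chamber W x :=
    Set.ext fun y => hW.mem_isAlcove_iff hC (mem_connectedComponentIn hx)
  rw [hC']
  exact hW.isHomotopyColimitDiagram hx
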